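/- Let $n\ge 0$ and let $0<a_n<b_n<\dots<a_1<b_1$. Put $T(z)=z\prod_{k=1}^n(z-a_k)(z-b_k)$ and consider the hyperelliptic surface $w^2=T(z)$. Let $\sqrt T$ denote the branch on the closed upper half plane obtained as the product of the principal square roots of $z$, $z-a_k$ and $z-b_k$. For a polynomial $R$, the periods of the differential $R\,dz/\sqrt T$ are $$\int_{\mathbf B_k}\frac{R\,dz}{\sqrt T}=2\int_{a_k}^{b_k}\frac{R\,dz}{\sqrt T},\qquad \int_{\mathbf A_k}\frac{R\,dz}{\sqrt T}=2\int_0^{a_k}\frac{R\,dz}{\sqrt T},$$ with integration along the upper edge of the real axis. Then: (i) There are unique monic real polynomials $P,P^{(1)}$ of degree $n$ such that, with $Q(z)=zP^{(1)}(z)$, all $\mathbf B_k$-periods of $d\Theta=\frac12\frac{P\,dz}{\sqrt T}$ and of $d\Theta^{(1)}=\frac32\frac{Q\,dz}{\sqrt T}$ vanish. For each $k$ there is a unique real polynomial $O^{(k)}$ of degree at most $n-1$ with $\frac1{2\pi i}\int_{\mathbf B_j}\frac{O^{(k)}dz}{\sqrt T}=\delta_{kj}$ for all $j$. Write $T(z)=z^{2n+1}+A_Tz^{2n}+\dots$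 and $Q(z)=z^{n+1}+A_Qz^n+\dots$, and put $$Q^{(t)}=Q-\left(A_Q-\tfrac12A_T\right)P,\qquad d\Theta^{(t)}=\frac32\frac{Q^{(t)}dz}{\sqrt T}=d\Theta^{(1)}-3\left(A_Q-\tfrac12A_T\right)d\Theta .$$ The space and time frequencies of the KdV evolution are $$\eta_k=\int_0^{a_k}d\Theta=\frac12\int_{\mathbf A_k}d\Theta,\qquad \eta^{(t)}_k=\int_0^{a_k}d\Theta^{(t)}=\frac12\int_{\mathbf A_k}d\Theta^{(t)}\qquad(k=1,\dots,n);$$ these numbers are real. (ii) Arbitrary variations of the frequencies are achieved by unique variations of the gap endpoints: the map $(a_k,b_k)_{k=1}^n\mapsto(\eta_k,\eta^{(t)}_k)_{k=1}^n$ is strictly differentiable at the given point, and for all $\dot\eta,\dot\eta^{(t)}\in\mathbb R^n$ there is exactly one $(\dot a,\dot b)\in\mathbb R^{2n}$ that its derivative sends to $(\dot\eta,\dot\eta^{(t)})$. (iii) Equivalently, the associated $2n\times2n$ linear system for $(\dot a,\dot b)$ is nondegenerate: the derivative sends $(\dot a,\dot b)$ to $(\dot\eta,\dot\eta^{(t)})$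 if and only if, for $k=1,\dots,n$, $$\sum_{j=1}^n\left(\frac{O^{(k)}(a_j)P(a_j)}{T'(a_j)}\dot a_j+\frac{O^{(k)}(b_j)P(b_j)}{T'(b_j)}\dot b_j\right)=-2\dot\eta_k,$$ $$3\sum_{j=1}^n\left(\frac{O^{(k)}(a_j)Q^{(t)}(a_j)}{T'(a_j)}\dot a_j+\frac{O^{(k)}(b_j)Q^{(t)}(b_j)}{T'(b_j)}\dot b_j\right)=-2\dot\eta^{(t)}_k,$$ and the matrix of this system has nonzero determinant. -/

import Mathlib

open Polynomial

namespace KdVGaps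

/-- `(a k, b k)` are the `n` gaps, enumerated from right to left:
`0 < a_n < b_n < ⋯ < a_1 < b_1`. -/
structure IsGapSystem {n : ℕ} (a b : Fin n → ℝ) : Prop where
  pos : ∀ k, 0 < a k
  lt : ∀ k, a k < b k
  sep : ∀ i j, i < j → b j < a i

/-- `T(z) = z ∏ (z - a_k) (z - b_k)`. -/
noncomputable def curvePoly {n : ℕ} (a b : Fin n → ℝ) : ℝ[X] :=
  X * ∏ k, ((X - C (a k)) * (X - C (b k)))

/-- The branch of `√T` on the closed upper half plane (upper sheet of `w² = T(z)`, upper edge of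
the cuts) with `√T(z) ∼ z ^ n √z`, `√z > 0` for `z > 0`. `Complex.sqrt` is the principal root,
continuous on the closed upper half plane, with `√(-x) = i √x` for `x > 0`. -/
noncomputable def rootT {n : ℕ} (a b : Fin n → ℝ) (z : ℂ) : ℂ :=
  Complex.sqrt z * ∏ k, (Complex.sqrt (z - (a k : ℂ)) * Complex.sqrt (z - (b k : ℂ)))

/-- `∫_x^y R(λ) dλ / √T(λ)` along the upper edge of the real axis. -/
noncomputable def abelInt {n : ℕ} (a b : Fin n → ℝ) (R : ℝ[X]) (x y : ℝ) : ℂ :=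
  ∫ t in x..y, ((R.eval t : ℝ) : ℂ) / rootT a b (t : ℂ)

/-- Period of `R dz / √T` over the cycle `B_k` (along the gap `(a_k, b_k)` on the upper sheet
and back on the lower sheet, where the differential has the opposite sign). -/
noncomputable def bPeriod {n : ℕ} (a b : Fin n → ℝ) (R : ℝ[X]) (k : Fin n) : ℂ :=
  2 * abelInt a b R (a k) (b k)

/-- Period of `R dz / √T` over the cycle `A_k` (through the gap `(a_k, b_k)`). -/
noncomputable def aPeriod {n : ℕ} (a b : Fin n → ℝ) (R : ℝ[X]) (k : Fin n) : ℂ :=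
  2 * abelInt a b R 0 (a k)

/-- The polynomial `P` of `dΘ = (1/2) P dz / √T`. -/
structure IsSpacePoly {n : ℕ} (a b : Fin n → ℝ) (P : ℝ[X]) : Prop where
  monic : P.Monic
  natDegree_eq : P.natDegree = n
  bPeriod_eq_zero : ∀ k, bPeriod a b P k = 0

/-- The polynomial `P⁽¹⁾` of `dΘ⁽¹⁾ = (3/2) z P⁽¹⁾ dz / √T`. -/
structure IsCubicPoly {n : ℕ} (a b : Fin n → ℝ) (P₁ : ℝ[X]) : Prop where
  monic : P₁.Monic
  natDegree_eq : P₁.natDegree = n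
  bPeriod_eq_zero : ∀ k, bPeriod a b (X * P₁) k = 0

/-- The polynomial `O⁽ᵏ⁾` of the normalized differential of the first kind
`dϑ_k = O⁽ᵏ⁾ dz / √T`, with `(1 / 2πi) ∫_{B_j} dϑ_k = δ_{kj}`. -/
structure IsFirstKindPoly {n : ℕ} (a b : Fin n → ℝ) (k : Fin n) (R : ℝ[X]) : Prop where
  degree_lt : R.degree < n
  bPeriod_eq : ∀ j, 1 / (2 * (Real.pi : ℂ) * Complex.I) * bPeriod a b R j = if k = j then 1 else 0

/-- `P`. -/
noncomputable def spacePoly {n : ℕ} (a b : Fin n → ℝ) : ℝ[X] :=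
  Classical.epsilon (IsSpacePoly a b)

/-- `Q = z P⁽¹⁾`. -/
noncomputable def cubicPoly {n : ℕ} (a b : Fin n → ℝ) : ℝ[X] :=
  X * Classical.epsilon (IsCubicPoly a b)

/-- `O⁽ᵏ⁾`. -/
noncomputable def firstKindPoly {n : ℕ} (a b : Fin n → ℝ) (k : Fin n) : ℝ[X] :=
  Classical.epsilon (IsFirstKindPoly a b k)

/-- `A_Q - A_T / 2`, with `T = z ^ (2n+1) + A_T z ^ (2n) + ⋯`, `Q = z ^ (n+1) + A_Q z ^ n + ⋯`.
At infinity, `Θ⁽¹⁾ = τ⁻³ + 3 (A_Q - A_T / 2) τ⁻¹ + ⋯` and `Θ = τ⁻¹ + ⋯` with `z = τ⁻²`. -/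
noncomputable def shiftConst {n : ℕ} (a b : Fin n → ℝ) : ℝ :=
  (cubicPoly a b).coeff n - (curvePoly a b).coeff (2 * n) / 2

/-- The polynomial `Q⁽ᵗ⁾` of `dΘ⁽ᵗ⁾ = (3/2) Q⁽ᵗ⁾ dz / √T`, where
`Θ⁽ᵗ⁾ = Θ⁽¹⁾ - 3 (A_Q - A_T / 2) Θ = τ⁻³ + regular`. -/
noncomputable def timePoly {n : ℕ} (a b : Fin n → ℝ) : ℝ[X] :=
  cubicPoly a b - C (shiftConst a b) * spacePoly a b

/-- The space frequencies `η_k = ∫_0^{a_k} dΘ = (1/2) ∫_{A_k} dΘ`. -/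
noncomputable def spaceFreq {n : ℕ} (a b : Fin n → ℝ) (k : Fin n) : ℝ :=
  (1 / 2 * (1 / 2 * aPeriod a b (spacePoly a b) k)).re

/-- The time frequencies `η_k⁽ᵗ⁾ = ∫_0^{a_k} dΘ⁽ᵗ⁾ = (1/2) ∫_{A_k} dΘ⁽ᵗ⁾`. -/
noncomputable def timeFreq {n : ℕ} (a b : Fin n → ℝ) (k : Fin n) : ℝ :=
  (1 / 2 * (3 / 2 * aPeriod a b (timePoly a b) k)).re

/-- The map from the gap endpoints `(a, b)` to the frequencies `(η, η⁽ᵗ⁾)`. -/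
noncomputable def freqMap {n : ℕ} (p : (Fin n → ℝ) × (Fin n → ℝ)) :
    (Fin n → ℝ) × (Fin n → ℝ) :=
  (spaceFreq p.1 p.2, timeFreq p.1 p.2)

/-- The coefficient `O⁽ᵏ⁾(e) R(e) / T'(e)`. -/
noncomputable def varCoeff {n : ℕ} (a b : Fin n → ℝ) (R : ℝ[X]) (k : Fin n) (e : ℝ) : ℝ :=
  (firstKindPoly a b k).eval e * R.eval e / (curvePoly a b).derivative.eval e

/-- The `2n × 2n` matrix of the linear system for the variations of the gap endpoints. -/
noncomputable def varMatrix {n : ℕ} (a b : Fin n → ℝ) :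
    Matrix (Fin n ⊕ Fin n) (Fin n ⊕ Fin n) ℝ :=
  Matrix.fromBlocks
    (Matrix.of fun k j => varCoeff a b (spacePoly a b) k (a j))
    (Matrix.of fun k j => varCoeff a b (spacePoly a b) k (b j))
    (Matrix.of fun k j => 3 * varCoeff a b (timePoly a b) k (a j))
    (Matrix.of fun k j => 3 * varCoeff a b (timePoly a b) k (b j))

end KdVGaps

/-! On a gap, `R dz / √T` is a unimodular constant times the real weighted form `R dx / √|T|`, so
the `B`-periods are real linear functionals `gapFun k` on polynomials. If `gapFun k` vanishes on `w
R` with `w ≥ 0` nonzero, then `R` has a root in the open gap. One root per gap makes the linear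
systems defining `P`, `P⁽¹⁾`, `O⁽ᵏ⁾` uniquely solvable (`eq_zero_of_gapFun`).

The main tool is an antisymmetric polynomial kernel `K(z, y)` (`kernelPoly`) such that `K(z, y) /
(√T(z) √T(y))` is a `z`-derivative plus a `y`-derivative. Integrating `K` in `y` over the gap `k`
gives a polynomial `gapDual k` whose integrals over all gaps vanish, and whose integral from `0` to
`a_j` is `(-1)^k π` if `j = k` and `0` otherwise. Therefore (`representation`) a polynomial `R` of
degree at most `2n` with vanishing `B`-periods is `c T' + ∑ ρ_k gapDual k`, where the `ρ_k` are its
half `A`-periods up to sign and `π`. Put `ℓ = ∑ ρ_k gapFun k`. If `deg R ≤ n + 1`, comparing top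
coefficients determines `ℓ` on polynomials of degree below `n` (`apply_eq_of_representation`).
Evaluated at `O⁽ᵏ⁾` this is Riemann's bilinear relation: with `O = O⁽ᵏ⁾`, `η_k = -O_{n-1}` and
`η_k⁽ᵗ⁾ = (A_T / 2) O_{n-1} - O_{n-2}`.

Thus only `O⁽ᵏ⁾` has to be differentiated. In the angular variable the gap integrals have a `C¹`
integrand, even when the ends of the gap itself move, and the derivative of `R dz / √T` in a branch
point `x` is, up to exact forms, a polynomial over `√T` that contains `K(x, ·)` (`endpointDeriv`).
Differentiating the normalization of `O⁽ᵏ⁾` and applying `ℓ` turns `K(x, ·)` into `R(x) - c T'(x)`,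
which produces the coefficients `O⁽ᵏ⁾(x) R(x) / T'(x)`.

For the determinant, a dependency among the rows gives `L`, `M` of degree below `n` with `L P + M
Q⁽ᵗ⁾` zero at all `2n` endpoints (`eq_zero_of_eval_endpoints`). No nontrivial combination of `P` and
`Q⁽ᵗ⁾` has a real double zero, so their Wronskian has constant sign (`wronskian_ne_zero`). A
Lagrange interpolation sum all of whose terms have one sign must nevertheless vanish, and this
forces `L = M = 0`. -/

namespace KdVGaps

/-! ### Integrals against the arcsine weight, in the angular variable -/

section Arc

open Real Set Filter Topology MeasureTheory

/-- The parametrization of `[α, β]` by the angle `θ ∈ [0, π]`. -/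
noncomputable def arcPoint (α β θ : ℝ) : ℝ := (α + β) / 2 - (β - α) / 2 * Real.cos θ

/-- The integral of `f` over `(α, β)` against the arcsine weight `1 / √((x - α) (β - x))`. -/
noncomputable def arcInt (α β : ℝ) (f : ℝ → ℝ) : ℝ := ∫ θ in (0 : ℝ)..π, f (arcPoint α β θ)

lemma arcPoint_mem_Icc {α β : ℝ} (h : α ≤ β) (θ : ℝ) : arcPoint α β θ ∈ Icc α β := by
  have h1 := Real.neg_one_le_cos θ
  have h2 := Real.cos_le_one θ
  constructor <;> unfold arcPoint <;> nlinarith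

lemma arcPoint_mul (α β θ : ℝ) :
    (arcPoint α β θ - α) * (β - arcPoint α β θ) = ((β - α) / 2 * Real.sin θ) ^ 2 := by
  have := Real.sin_sq_add_cos_sq θ
  unfold arcPoint
  linear_combination (-(β - α) ^ 2 / 4) * this

lemma continuous_arcPoint (α β : ℝ) : Continuous (arcPoint α β) := by
  unfold arcPoint; fun_prop

lemma hasDerivAt_arcPoint (α β θ : ℝ) :
    HasDerivAt (arcPoint α β) ((β - α) / 2 * Real.sin θ) θ :=
  (((Real.hasDerivAt_cos θ).const_mul ((β - α) / 2)).const_sub ((α + β) / 2)).congr_deriv (by ring)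

lemma arcPoint_zero (α β : ℝ) : arcPoint α β 0 = α := by simp [arcPoint]; ring

lemma arcPoint_pi (α β : ℝ) : arcPoint α β π = β := by simp [arcPoint]; ring

lemma strictMonoOn_arcPoint {α β : ℝ} (h : α < β) : StrictMonoOn (arcPoint α β) (Icc 0 π) := by
  intro x hx y hy hxy
  have := Real.strictAntiOn_cos hx hy hxy
  unfold arcPoint
  nlinarith

lemma image_arcPoint {α β : ℝ} (h : α < β) : arcPoint α β '' Ioo 0 π = Ioo α β := by
  apply Subset.antisymm
  · rintro _ ⟨θ, hθ, rfl⟩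
    have hm := strictMonoOn_arcPoint h
    have h1 := hm ⟨le_rfl, pi_pos.le⟩ ⟨hθ.1.le, hθ.2.le⟩ hθ.1
    have h2 := hm ⟨hθ.1.le, hθ.2.le⟩ ⟨pi_pos.le, le_rfl⟩ hθ.2
    rw [arcPoint_zero] at h1
    rw [arcPoint_pi] at h2
    exact ⟨h1, h2⟩
  · have := intermediate_value_Ioo pi_pos.le (continuous_arcPoint α β).continuousOn
    rwa [arcPoint_zero, arcPoint_pi] at this

lemma arcInt_congr {α β : ℝ} (h : α ≤ β) {f g : ℝ → ℝ} (hfg : ∀ x ∈ Icc α β, f x = g x) :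
    arcInt α β f = arcInt α β g := by
  unfold arcInt
  exact intervalIntegral.integral_congr fun θ _ => hfg _ (arcPoint_mem_Icc h θ)

lemma continuous_comp_arcPoint {α β : ℝ} (h : α ≤ β) {f : ℝ → ℝ} (hf : ContinuousOn f (Icc α β)) :
    Continuous fun θ => f (arcPoint α β θ) :=
  hf.comp_continuous (continuous_arcPoint α β) (arcPoint_mem_Icc h)

lemma arcInt_add {α β : ℝ} (h : α ≤ β) {f g : ℝ → ℝ} (hf : ContinuousOn f (Icc α β))
    (hg : ContinuousOn g (Icc α β)) :
    arcInt α β (fun x => f x + g x) = arcInt α β f + arcInt α β g :=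
  intervalIntegral.integral_add ((continuous_comp_arcPoint h hf).intervalIntegrable _ _)
    ((continuous_comp_arcPoint h hg).intervalIntegrable _ _)

lemma arcInt_sub {α β : ℝ} (h : α ≤ β) {f g : ℝ → ℝ} (hf : ContinuousOn f (Icc α β))
    (hg : ContinuousOn g (Icc α β)) :
    arcInt α β (fun x => f x - g x) = arcInt α β f - arcInt α β g :=
  intervalIntegral.integral_sub ((continuous_comp_arcPoint h hf).intervalIntegrable _ _)
    ((continuous_comp_arcPoint h hg).intervalIntegrable _ _)

lemma arcInt_const_mul (α β c : ℝ) (f : ℝ → ℝ) :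
    arcInt α β (fun x => c * f x) = c * arcInt α β f :=
  intervalIntegral.integral_const_mul _ _

lemma integral_div_sqrt_eq_arcInt {α β : ℝ} (h : α < β) (f : ℝ → ℝ) :
    ∫ x in α..β, f x / √((x - α) * (β - x)) = arcInt α β f := by
  rw [intervalIntegral.integral_of_le h.le, integral_Ioc_eq_integral_Ioo, ← image_arcPoint h,
    integral_image_eq_integral_abs_deriv_smul measurableSet_Ioo
      (fun θ _ => (hasDerivAt_arcPoint α β θ).hasDerivWithinAt)
      ((strictMonoOn_arcPoint h).injOn.mono Ioo_subset_Icc_self),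
    arcInt, intervalIntegral.integral_of_le pi_pos.le, integral_Ioc_eq_integral_Ioo]
  refine setIntegral_congr_fun measurableSet_Ioo fun θ hθ => ?_
  have h1 : 0 < (β - α) / 2 * Real.sin θ :=
    mul_pos (by linarith) (sin_pos_of_pos_of_lt_pi hθ.1 hθ.2)
  simp only [arcPoint_mul, sqrt_sq_eq_abs, smul_eq_mul]
  rw [mul_div_cancel₀ _ (abs_pos.2 h1.ne').ne']

/-- The integrand is `√((x - α)(β - x))` times the derivative of `√((x - α)(β - x)) g`. In the
angle, the primitive is `(β - α)/2 · sin θ · g`, which vanishes at `0` and `π`. -/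
lemma arcInt_deriv_eq_zero {α β : ℝ} (h : α ≤ β) {g g' : ℝ → ℝ}
    (hg : ∀ x ∈ Icc α β, HasDerivAt g (g' x) x) (hg' : ContinuousOn g' (Icc α β)) :
    arcInt α β (fun x => (x - α) * (β - x) * g' x + (α + β - 2 * x) / 2 * g x) = 0 := by
  have hd : ∀ θ : ℝ, HasDerivAt (fun θ => (β - α) / 2 * Real.sin θ * g (arcPoint α β θ))
      ((arcPoint α β θ - α) * (β - arcPoint α β θ) * g' (arcPoint α β θ)
        + (α + β - 2 * arcPoint α β θ) / 2 * g (arcPoint α β θ)) θ := by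
    intro θ
    have h1 := (hg _ (arcPoint_mem_Icc h θ)).comp θ (hasDerivAt_arcPoint α β θ)
    have h2 := ((Real.hasDerivAt_sin θ).const_mul ((β - α) / 2)).mul h1
    refine h2.congr_deriv ?_
    rw [arcPoint_mul]
    simp only [Function.comp]
    have : (α + β - 2 * arcPoint α β θ) / 2 = (β - α) / 2 * Real.cos θ := by
      unfold arcPoint; ring
    rw [this]; ring
  have hgc : ContinuousOn g (Icc α β) := fun x hx => (hg x hx).continuousAt.continuousWithinAt
  unfold arcInt
  rw [intervalIntegral.integral_eq_sub_of_hasDerivAt (fun θ _ => hd θ)]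
  · simp
  · exact (continuous_comp_arcPoint h (f := fun x => (x - α) * (β - x) * g' x
      + (α + β - 2 * x) / 2 * g x) (by fun_prop)).intervalIntegrable _ _

lemma integral_inv_sub_mul_cos {A h : ℝ} (hh : 0 < h) (hA : h < A) :
    ∫ θ in (0 : ℝ)..π, 1 / (A - h * Real.cos θ) = π / √(A ^ 2 - h ^ 2) := by
  set s := √(A ^ 2 - h ^ 2) with hs
  have hpos : 0 < A ^ 2 - h ^ 2 := by nlinarith
  have hs0 : 0 < s := sqrt_pos.2 hpos
  have hs2 : s ^ 2 = A ^ 2 - h ^ 2 := sq_sqrt hpos.le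
  have hden : ∀ θ : ℝ, 0 < A - h * Real.cos θ := fun θ => by
    nlinarith [Real.cos_le_one θ]
  have hden' : ∀ θ : ℝ, 0 < A + s - h * Real.cos θ := fun θ => by linarith [hden θ]
  -- The half-angle primitive is rewritten so that the arctangent has a denominator positive for
  -- every `θ`; it is then smooth up to `θ = π`, where `tan (θ / 2)` is not.
  have hd : ∀ θ : ℝ, HasDerivAt
      (fun θ => (θ + 2 * arctan (h * Real.sin θ / (A + s - h * Real.cos θ))) / s)
      (1 / (A - h * Real.cos θ)) θ := by
    intro θ
    have h1 := ((Real.hasDerivAt_sin θ).const_mul h).div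
      (((Real.hasDerivAt_cos θ).const_mul h).const_sub (A + s)) (hden' θ).ne'
    have h2 := ((hasDerivAt_id θ).add (h1.arctan.const_mul 2)).div_const s
    refine h2.congr_deriv ?_
    have e1 := hden θ
    have e2 := hden' θ
    have hsc := Real.sin_sq_add_cos_sq θ
    have key : (A + s - h * Real.cos θ) ^ 2 + (h * Real.sin θ) ^ 2
        = 2 * (A + s) * (A - h * Real.cos θ) := by
      linear_combination h ^ 2 * hsc + hs2
    have e3 : (1 : ℝ) + (h * Real.sin θ / (A + s - h * Real.cos θ)) ^ 2
        = 2 * (A + s) * (A - h * Real.cos θ) / (A + s - h * Real.cos θ) ^ 2 := by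
      rw [← key]; field_simp
    have e4 : h * Real.cos θ * (A + s - h * Real.cos θ) - h * Real.sin θ * -(h * -Real.sin θ)
        = h * ((A + s) * Real.cos θ - h) := by
      linear_combination (-h ^ 2) * hsc
    have e5 : 0 < A + s := by linarith
    simp only [Pi.div_apply]
    rw [e3, e4]
    field_simp
    linear_combination (-1) * hs2
  rw [intervalIntegral.integral_eq_sub_of_hasDerivAt (fun θ _ => hd θ)]
  · simp
  · refine Continuous.intervalIntegrable ?_ _ _
    exact continuous_const.div (by fun_prop) fun θ => (hden θ).ne'

lemma arcInt_inv_sub {α β z : ℝ} (h : α < β) (hz : z < α) :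
    arcInt α β (fun y => 1 / (y - z)) = π / √((α - z) * (β - z)) := by
  have := integral_inv_sub_mul_cos (A := (α + β) / 2 - z) (h := (β - α) / 2) (by linarith)
    (by linarith)
  rw [show (α - z) * (β - z) = ((α + β) / 2 - z) ^ 2 - ((β - α) / 2) ^ 2 by ring, ← this, arcInt]
  refine intervalIntegral.integral_congr fun θ _ => ?_
  simp only [arcPoint]
  ring

/-- Freezing `f` at `α` gives exactly `π f(α)` by `arcInt_inv_sub`. The remainder `(f(y) - f(α)) /
(y - z)` is bounded by `C`, because `y - α ≤ y - z`, and is multiplied by a square root that tends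
to zero. -/
lemma tendsto_sqrt_mul_arcInt_left {α β C : ℝ} (h : α < β) {f : ℝ → ℝ}
    (hf : ContinuousOn f (Icc α β)) (hC : ∀ y ∈ Icc α β, |f y - f α| ≤ C * (y - α)) :
    Tendsto (fun z => √((α - z) * (β - z)) * arcInt α β (fun y => f y / (y - z))) (𝓝[<] α)
      (𝓝 (π * f α)) := by
  have hC0 : 0 ≤ C := by
    have := (abs_nonneg _).trans (hC β ⟨h.le, le_rfl⟩)
    by_contra hneg
    nlinarith
  have hlim : Tendsto (fun z => √((α - z) * (β - z)) * (π * C)) (𝓝[<] α) (𝓝 0) := by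
    have : Continuous fun z => √((α - z) * (β - z)) * (π * C) := by fun_prop
    have h2 := (this.tendsto α).mono_left (nhdsWithin_le_nhds (s := Iio α))
    simpa using h2
  rw [tendsto_iff_norm_sub_tendsto_zero]
  refine squeeze_zero' (Eventually.of_forall fun _ => norm_nonneg _) ?_ hlim
  filter_upwards [self_mem_nhdsWithin] with z hz
  have hz : z < α := hz
  have hyz : ∀ y ∈ Icc α β, 0 < y - z := fun y hy => by linarith [hy.1]
  have hpos : 0 < (α - z) * (β - z) := mul_pos (by linarith) (by linarith)
  have hs := sqrt_pos.2 hpos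
  have c1 : ContinuousOn (fun y => f y / (y - z)) (Icc α β) :=
    hf.div (by fun_prop) fun y hy => (hyz y hy).ne'
  have c2 : ContinuousOn (fun y => f α * (1 / (y - z))) (Icc α β) :=
    continuousOn_const.mul (continuousOn_const.div (by fun_prop) fun y hy => (hyz y hy).ne')
  have e1 : √((α - z) * (β - z)) * arcInt α β (fun y => f y / (y - z)) - π * f α
      = √((α - z) * (β - z)) * arcInt α β (fun y => f y / (y - z) - f α * (1 / (y - z))) := by
    rw [arcInt_sub h.le c1 c2, arcInt_const_mul, arcInt_inv_sub h hz]
    field_simp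
  rw [e1, norm_mul, norm_of_nonneg hs.le]
  refine mul_le_mul_of_nonneg_left ?_ hs.le
  unfold arcInt
  refine (intervalIntegral.norm_integral_le_of_norm_le_const (C := C) fun θ _ => ?_).trans ?_
  · set y := arcPoint α β θ
    have hy : y ∈ Icc α β := arcPoint_mem_Icc h.le θ
    have h1 := hyz y hy
    change ‖f y / (y - z) - f α * (1 / (y - z))‖ ≤ C
    rw [show f y / (y - z) - f α * (1 / (y - z)) = (f y - f α) / (y - z) by ring, norm_div,
      norm_of_nonneg h1.le, div_le_iff₀ h1, norm_eq_abs]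
    exact (hC y hy).trans (mul_le_mul_of_nonneg_left (by linarith) hC0)
  · rw [sub_zero, abs_of_pos pi_pos, mul_comm]

lemma arcInt_reflect (α β : ℝ) (f : ℝ → ℝ) :
    arcInt α β f = arcInt (-β) (-α) fun x => f (-x) := by
  have := intervalIntegral.integral_comp_sub_left (fun θ => f (arcPoint α β θ)) π (a := 0) (b := π)
  simp only [sub_self, sub_zero] at this
  rw [arcInt, ← this, arcInt]
  refine intervalIntegral.integral_congr fun θ _ => ?_
  simp only [arcPoint, Real.cos_pi_sub]
  ring_nf

lemma tendsto_sqrt_mul_arcInt_right {α β C : ℝ} (h : α < β) {f : ℝ → ℝ}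
    (hf : ContinuousOn f (Icc α β)) (hC : ∀ y ∈ Icc α β, |f y - f β| ≤ C * (β - y)) :
    Tendsto (fun z => √((z - α) * (z - β)) * arcInt α β (fun y => f y / (z - y))) (𝓝[>] β)
      (𝓝 (π * f β)) := by
  have hmap : ∀ y ∈ Icc (-β) (-α), -y ∈ Icc α β := fun y hy =>
    ⟨by linarith [hy.2], by linarith [hy.1]⟩
  have h1 := tendsto_sqrt_mul_arcInt_left (α := -β) (β := -α) (C := C) (f := fun x => f (-x))
    (by linarith) (hf.comp (by fun_prop) hmap) (fun y hy => by
      simpa [sub_eq_add_neg, add_comm] using hC (-y) (hmap y hy))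
  have h2 : Tendsto (fun z : ℝ => -z) (𝓝[>] β) (𝓝[<] (-β)) := tendsto_neg_nhdsGT
  have h3 := h1.comp h2
  rw [neg_neg] at h3
  refine h3.congr fun z => ?_
  simp only [Function.comp]
  rw [arcInt_reflect α β]
  congr 1
  · congr 1; ring
  · congr 1; funext y; congr 1; ring

end Arc


/-! ### The antisymmetric kernel of a polynomial -/

section Kernel

open Finset

/-- This is the kernel identity for the single monomial `T = X ^ (r + 2)`; the general case follows
by linearity in `T`. -/
lemma sum_range_skew_mul_sq (z y : ℝ) (r : ℕ) :
    (∑ i ∈ range (r + 1), ((2 * (i : ℝ) - r) / 2) * z ^ i * y ^ (r - i)) * (z - y) ^ 2 =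
      (r + 2) * (z ^ (r + 1) + y ^ (r + 1)) * (z - y) / 2 - z ^ (r + 2) + y ^ (r + 2) := by
  induction r with
  | zero => simp; ring
  | succ r ih =>
    have hg : (∑ i ∈ range (r + 1), z ^ i * y ^ (r - i)) * (z - y) = z ^ (r + 1) - y ^ (r + 1) := by
      have := geom_sum₂_mul z y (r + 1)
      simpa using this
    have e : ∑ i ∈ range (r + 1 + 1), ((2 * (i : ℝ) - (r + 1 : ℕ)) / 2) * z ^ i * y ^ (r + 1 - i)
        = y * (∑ i ∈ range (r + 1), ((2 * (i : ℝ) - r) / 2) * z ^ i * y ^ (r - i))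
          - y / 2 * (∑ i ∈ range (r + 1), z ^ i * y ^ (r - i)) + ((r : ℝ) + 1) / 2 * z ^ (r + 1) := by
      rw [sum_range_succ, mul_sum, mul_sum, ← sum_sub_distrib]
      congr 1
      · refine sum_congr rfl fun i hi => ?_
        have : r + 1 - i = (r - i) + 1 := by have := mem_range.1 hi; omega
        rw [this, pow_succ]; push_cast; ring
      · rw [Nat.sub_self]; push_cast; ring
    rw [e]
    push_cast
    linear_combination y * ih - y / 2 * (z - y) * hg

/-- The polynomial `y ↦ ((T'(z) + T'(y)) (z - y) / 2 - T(z) + T(y)) / (z - y) ^ 2`. -/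
noncomputable def kernelPoly (T : ℝ[X]) (z : ℝ) : ℝ[X] :=
  ∑ i ∈ range T.natDegree, ∑ j ∈ range T.natDegree,
    C (T.coeff (i + j + 2) * (((i : ℝ) - j) / 2) * z ^ i) * X ^ j

/-- The kernel polynomial as a function of `z`, with the functional `ℓ` applied in `y`. -/
noncomputable def dualPoly (T : ℝ[X]) (ℓ : ℝ[X] →ₗ[ℝ] ℝ) : ℝ[X] :=
  ∑ i ∈ range T.natDegree, ∑ j ∈ range T.natDegree,
    C (T.coeff (i + j + 2) * (((i : ℝ) - j) / 2) * ℓ (X ^ j)) * X ^ i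

lemma eval_dualPoly (T : ℝ[X]) (ℓ : ℝ[X] →ₗ[ℝ] ℝ) (z : ℝ) :
    (dualPoly T ℓ).eval z = ℓ (kernelPoly T z) := by
  simp only [dualPoly, kernelPoly, eval_finsetSum, map_sum, eval_smul, eval_pow, eval_X,
    ← smul_eq_C_mul, map_smul, smul_eq_mul]
  exact sum_congr rfl fun i _ => sum_congr rfl fun j _ => by ring

lemma coeff_dualPoly (T : ℝ[X]) (ℓ : ℝ[X] →ₗ[ℝ] ℝ) (i : ℕ) :
    (dualPoly T ℓ).coeff i =
      ∑ j ∈ range T.natDegree, T.coeff (i + j + 2) * (((i : ℝ) - j) / 2) * ℓ (X ^ j) := by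
  simp only [dualPoly, finsetSum_coeff, coeff_C_mul, coeff_X_pow, mul_ite, mul_one, mul_zero]
  rw [sum_comm]
  refine sum_congr rfl fun j _ => ?_
  rw [sum_ite_eq]
  split_ifs with h
  · rfl
  · rw [coeff_eq_zero_of_natDegree_lt, zero_mul, zero_mul]
    simp only [mem_range, not_lt] at h
    omega

lemma dualPoly_add (T : ℝ[X]) (ℓ₁ ℓ₂ : ℝ[X] →ₗ[ℝ] ℝ) :
    dualPoly T (ℓ₁ + ℓ₂) = dualPoly T ℓ₁ + dualPoly T ℓ₂ := by
  ext i
  simp only [coeff_dualPoly, coeff_add, LinearMap.add_apply, mul_add, sum_add_distrib]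

lemma dualPoly_smul (T : ℝ[X]) (c : ℝ) (ℓ : ℝ[X] →ₗ[ℝ] ℝ) :
    dualPoly T (c • ℓ) = C c * dualPoly T ℓ := by
  ext i
  simp only [coeff_dualPoly, coeff_C_mul, LinearMap.smul_apply, mul_sum, smul_eq_mul]
  exact sum_congr rfl fun j _ => by ring

lemma dualPoly_sum {ι : Type*} (s : Finset ι) (T : ℝ[X]) (ℓ : ι → ℝ[X] →ₗ[ℝ] ℝ) (c : ι → ℝ) :
    dualPoly T (∑ k ∈ s, c k • ℓ k) = ∑ k ∈ s, C (c k) * dualPoly T (ℓ k) := by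
  classical
  induction s using Finset.induction_on with
  | empty => ext i; simp [coeff_dualPoly]
  | insert k s hk ih => rw [sum_insert hk, sum_insert hk, dualPoly_add, dualPoly_smul, ih]

/-- The coefficient of `z ^ i y ^ j` in the kernel changes sign when `i` and `j` are exchanged. -/
lemma apply_dualPoly (T : ℝ[X]) (ℓ ℓ' : ℝ[X] →ₗ[ℝ] ℝ) :
    ℓ' (dualPoly T ℓ) = -ℓ (dualPoly T ℓ') := by
  simp only [dualPoly, map_sum, ← smul_eq_C_mul, map_smul, smul_eq_mul]
  rw [sum_comm, ← sum_neg_distrib]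
  refine sum_congr rfl fun i _ => ?_
  rw [← sum_neg_distrib]
  refine sum_congr rfl fun j _ => ?_
  rw [add_comm j i]; ring

/-- Divided by `(z - y) ^ 2`, the right side is `√T(z) ∂_z (√T(z) / (z - y)) + √T(y) ∂_y (√T(y) / (z
- y))`. This splitting into two exact parts is the only property of the kernel used with the
integrals. -/
lemma eval_kernelPoly_mul_sq (T : ℝ[X]) (z y : ℝ) :
    (kernelPoly T z).eval y * (z - y) ^ 2 =
      (T.derivative.eval z + T.derivative.eval y) * (z - y) / 2 - T.eval z + T.eval y := by
  set N := T.natDegree with hN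
  -- `S m` is the kernel of `X ^ m`; constants and linear terms of `T` have kernel zero.
  set S : ℕ → ℝ := fun m => if 2 ≤ m then
    ∑ i ∈ range (m - 2 + 1), ((2 * (i : ℝ) - (m - 2 : ℕ)) / 2) * z ^ i * y ^ (m - 2 - i) else 0
    with hS
  have h1 : (kernelPoly T z).eval y = ∑ m ∈ range (N + 1), T.coeff m * S m := by
    have hin : ∀ m ∈ range (N + 1), T.coeff m * S m = ∑ i ∈ range N, ∑ j ∈ range N,
        if m = i + j + 2 then T.coeff m * (((i : ℝ) - j) / 2) * z ^ i * y ^ j else 0 := by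
      intro m hm
      have hmN : m < N + 1 := mem_range.1 hm
      by_cases h2 : 2 ≤ m
      · have h3 : ∀ i ∈ range N, (∑ j ∈ range N,
            if m = i + j + 2 then T.coeff m * (((i : ℝ) - j) / 2) * z ^ i * y ^ j else 0)
            = if i ∈ range (m - 2 + 1) then
              T.coeff m * (((2 * (i : ℝ) - (m - 2 : ℕ)) / 2) * z ^ i * y ^ (m - 2 - i)) else 0 := by
          intro i _
          split_ifs with hi
          · have hi' := mem_range.1 hi
            rw [sum_eq_single (m - 2 - i)]
            · rw [if_pos (by omega)]
              have : ((m - 2 - i : ℕ) : ℝ) = ((m - 2 : ℕ) : ℝ) - i := by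
                rw [Nat.cast_sub (by omega)]
              rw [this]; ring
            · intro j _ hj
              rw [if_neg (by omega)]
            · intro h; simp only [mem_range, not_lt] at h; omega
          · refine sum_eq_zero fun j _ => if_neg ?_
            simp only [mem_range, not_lt] at hi; omega
        rw [sum_congr rfl h3, ← sum_filter, hS]
        simp only [if_pos h2, mul_sum]
        refine sum_congr ?_ fun _ _ => rfl
        ext i
        simp only [mem_filter, mem_range]; omega
      · rw [hS]
        simp only [if_neg h2, mul_zero]
        symm
        refine sum_eq_zero fun i _ => sum_eq_zero fun j _ => if_neg (by omega)
    rw [sum_congr rfl hin, sum_comm]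
    simp only [kernelPoly, eval_finsetSum, eval_mul, eval_C, eval_pow, eval_X]
    refine sum_congr rfl fun i _ => ?_
    rw [sum_comm]
    refine sum_congr rfl fun j _ => ?_
    rw [sum_ite_eq']
    split_ifs with h
    · ring
    · rw [coeff_eq_zero_of_natDegree_lt (by simp only [mem_range, not_lt] at h; omega)]; ring
  have hT : ∀ x : ℝ, T.eval x = ∑ m ∈ range (N + 1), T.coeff m * x ^ m := fun x =>
    eval_eq_sum_range x
  have hT' : ∀ x : ℝ, T.derivative.eval x = ∑ m ∈ range (N + 1), T.coeff m * (m * x ^ (m - 1)) := by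
    intro x
    conv_lhs => rw [T.as_sum_range_C_mul_X_pow]
    simp only [derivative_sum, eval_finsetSum, derivative_C_mul_X_pow, eval_mul, eval_C, eval_pow,
      eval_X, mul_assoc]
    rfl
  rw [h1, hT, hT, hT', hT', ← sum_add_distrib, sum_mul, sum_mul, sum_div, ← sum_sub_distrib,
    ← sum_add_distrib]
  refine sum_congr rfl fun m _ => ?_
  rcases m with _ | _ | r
  · simp [hS]
  · simp [hS]; ring
  · have := sum_range_skew_mul_sq z y r
    have e0 : r + 1 + 1 - 2 = r := rfl
    have e1 : r + 1 + 1 - 1 = r + 1 := rfl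
    simp only [hS, if_pos (Nat.le_add_left 2 r)]
    rw [mul_assoc, e0, this, e1]
    push_cast
    ring

end Kernel

/-! ### Strict differentiability of parametric integrals -/

section ParametricIntegral

open Set Filter Topology MeasureTheory

lemma aestronglyMeasurable_uIoc {G : Type*} [NormedAddCommGroup G] {f : ℝ → G} {c d : ℝ}
    (hcd : c ≤ d) (hf : ContinuousOn f (Icc c d)) :
    AEStronglyMeasurable f (volume.restrict (uIoc c d)) := by
  rw [uIoc_of_le hcd]
  exact (hf.aestronglyMeasurable_of_isCompact isCompact_Icc measurableSet_Icc).mono_measure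
    (Measure.restrict_mono Ioc_subset_Icc_self le_rfl)

/-- Compactness of a closed ball times `[c, d]` bounds the partial derivative, which permits
differentiation under the integral at every nearby point. The resulting derivative is continuous at
`x₀`, and this upgrades differentiability to strict differentiability. -/
theorem hasStrictFDerivAt_intervalIntegral {E : Type*} [NormedAddCommGroup E] [NormedSpace ℝ E]
    [ProperSpace E] {F : E → ℝ → ℝ} {U : Set E} (hU : IsOpen U) {x₀ : E} (hx₀ : x₀ ∈ U) {c d : ℝ}
    (hcd : c ≤ d)
    (hF : ∀ x ∈ U, ∀ t ∈ Icc c d, ContDiffAt ℝ 1 (fun p : E × ℝ => F p.1 p.2) (x, t)) :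
    (∀ t ∈ Icc c d, DifferentiableAt ℝ (fun x => F x t) x₀) ∧
    IntervalIntegrable (fun t => fderiv ℝ (fun x => F x t) x₀) volume c d ∧
    HasStrictFDerivAt (fun x => ∫ t in c..d, F x t)
      (∫ t in c..d, fderiv ℝ (fun x => F x t) x₀) x₀ := by
  set F' : E → ℝ → E →L[ℝ] ℝ := fun x t =>
    (fderiv ℝ (fun p : E × ℝ => F p.1 p.2) (x, t)).comp (ContinuousLinearMap.inl ℝ E ℝ) with hF'
  have hd : ∀ x ∈ U, ∀ t ∈ Icc c d, HasFDerivAt (fun x => F x t) (F' x t) x := by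
    intro x hx t ht
    have h1 := ((hF x hx t ht).differentiableAt (by norm_num)).hasFDerivAt
    have h2 : HasFDerivAt (fun x : E => (x, t)) (ContinuousLinearMap.inl ℝ E ℝ) x :=
      hasFDerivAt_prodMk_left x t
    exact h1.comp x h2
  have hc : ∀ x ∈ U, ∀ t ∈ Icc c d, ContinuousAt (fun p : E × ℝ => F' p.1 p.2) (x, t) := by
    intro x hx t ht
    have h1 : ContinuousAt (fderiv ℝ (fun p : E × ℝ => F p.1 p.2)) (x, t) :=
      ((hF x hx t ht).fderiv_right (m := 0) (by norm_num)).continuousAt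
    have h2 : Continuous fun L : E × ℝ →L[ℝ] ℝ => L.comp (ContinuousLinearMap.inl ℝ E ℝ) := by
      fun_prop
    exact h2.continuousAt.comp h1
  have hFc : ∀ x ∈ U, ContinuousOn (F x) (Icc c d) := fun x hx t ht => by
    have h2 : ContinuousAt (fun t : ℝ => (x, t)) t := by fun_prop
    exact (ContinuousAt.comp (f := fun t : ℝ => (x, t)) (g := fun p : E × ℝ => F p.1 p.2)
      (hF x hx t ht).continuousAt h2).continuousWithinAt
  have hF'c : ∀ x ∈ U, ContinuousOn (F' x) (Icc c d) := fun x hx t ht => by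
    have h2 : ContinuousAt (fun t : ℝ => (x, t)) t := by fun_prop
    exact (ContinuousAt.comp (f := fun t : ℝ => (x, t)) (g := fun p : E × ℝ => F' p.1 p.2)
      (hc x hx t ht) h2).continuousWithinAt
  obtain ⟨ε, hε, hball⟩ := Metric.nhds_basis_closedBall.mem_iff.1 (hU.mem_nhds hx₀)
  have hK : IsCompact (Metric.closedBall x₀ ε ×ˢ Icc c d) :=
    (isCompact_closedBall _ _).prod isCompact_Icc
  obtain ⟨B, hB⟩ := hK.exists_bound_of_continuousOn (f := fun p : E × ℝ => F' p.1 p.2)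
    fun p hp => (hc p.1 (hball hp.1) p.2 hp.2).continuousWithinAt
  have hsub : uIoc c d ⊆ Icc c d := by rw [uIoc_of_le hcd]; exact Ioc_subset_Icc_self
  have hder : ∀ x ∈ Metric.ball x₀ ε,
      HasFDerivAt (fun x => ∫ t in c..d, F x t) (∫ t in c..d, F' x t) x := by
    intro x hx
    have hxU := hball (Metric.ball_subset_closedBall hx)
    refine intervalIntegral.hasFDerivAt_integral_of_dominated_of_fderiv_le
      (bound := fun _ => B) (Metric.isOpen_ball.mem_nhds hx) ?_ ?_ ?_ ?_ ?_ ?_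
    · filter_upwards [hU.mem_nhds hxU] with y hy using aestronglyMeasurable_uIoc hcd (hFc y hy)
    · exact ContinuousOn.intervalIntegrable (by rw [uIcc_of_le hcd]; exact hFc x hxU)
    · exact aestronglyMeasurable_uIoc hcd (hF'c x hxU)
    · exact Eventually.of_forall fun t ht y hy =>
        hB (y, t) ⟨Metric.ball_subset_closedBall hy, hsub ht⟩
    · exact intervalIntegrable_const
    · exact Eventually.of_forall fun t ht y hy =>
        hd y (hball (Metric.ball_subset_closedBall hy)) t (hsub ht)
  have hcont : ContinuousAt (fun x => ∫ t in c..d, F' x t) x₀ := by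
    refine intervalIntegral.continuousAt_of_dominated_interval (bound := fun _ => B) ?_ ?_ ?_ ?_
    · filter_upwards [hU.mem_nhds hx₀] with y hy using aestronglyMeasurable_uIoc hcd (hF'c y hy)
    · filter_upwards [Metric.closedBall_mem_nhds x₀ hε] with y hy
      exact Eventually.of_forall fun t ht => hB (y, t) ⟨hy, hsub ht⟩
    · exact intervalIntegrable_const
    · refine Eventually.of_forall fun t ht => ?_
      have h2 : ContinuousAt (fun x : E => (x, t)) x₀ := by fun_prop
      exact ContinuousAt.comp (f := fun x : E => (x, t)) (g := fun p : E × ℝ => F' p.1 p.2)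
        (hc x₀ hx₀ t (hsub ht)) h2
  have hstrict := hasStrictFDerivAt_of_hasFDerivAt_of_continuousAt
    (Filter.eventually_of_mem (Metric.ball_mem_nhds x₀ hε) hder) hcont
  have hEq : ∀ t ∈ uIcc c d, F' x₀ t = fderiv ℝ (fun x => F x t) x₀ := fun t ht => by
    rw [uIcc_of_le hcd] at ht
    exact (hd x₀ hx₀ t ht).fderiv.symm
  refine ⟨fun t ht => (hd x₀ hx₀ t ht).differentiableAt, ?_, ?_⟩
  · have : IntervalIntegrable (F' x₀) volume c d :=
      ContinuousOn.intervalIntegrable (by rw [uIcc_of_le hcd]; exact hF'c x₀ hx₀)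
    exact this.congr fun t ht => hEq t (uIoc_subset_uIcc ht)
  · rw [← intervalIntegral.integral_congr hEq]
    exact hstrict

end ParametricIntegral


/-! ### Integrals over a gap and exact differentials -/

section GapIntegral

open Real Set Filter Topology MeasureTheory Finset

variable {ι : Type*} [Fintype ι] [DecidableEq ι]

/-- The polynomial `z ∏ (z - e i)`. -/
noncomputable def branchPoly (e : ι → ℝ) : ℝ[X] := X * ∏ i, (X - C (e i))

/-- The polynomial `branchPoly e / ((z - e s) (z - e s'))`. -/
noncomputable def gapCofactor (e : ι → ℝ) (s s' : ι) : ℝ[X] :=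
  X * ∏ i ∈ (univ.erase s).erase s', (X - C (e i))

/-- Positivity of the cofactor encodes both that `T` is negative on the open gap and that the closed
gap contains neither `0` nor any further branch point. -/
structure IsGap (e : ι → ℝ) (s s' : ι) : Prop where
  lt : e s < e s'
  pos : ∀ x ∈ Icc (e s) (e s'), 0 < (gapCofactor e s s').eval x

/-- The integral of `f / √|T|` over the gap `(e s, e s')`. -/
noncomputable def gapInt (e : ι → ℝ) (s s' : ι) (f : ℝ → ℝ) : ℝ :=
  arcInt (e s) (e s') fun y => f y / √((gapCofactor e s s').eval y)

variable {e : ι → ℝ} {s s' : ι}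

lemma IsGap.ne (h : IsGap e s s') : s ≠ s' := fun hs => by
  have := h.lt; rw [hs] at this; exact lt_irrefl _ this

lemma branchPoly_eq (h : s ≠ s') :
    branchPoly e = (X - C (e s)) * (X - C (e s')) * gapCofactor e s s' := by
  rw [branchPoly, gapCofactor, ← mul_prod_erase univ _ (mem_univ s),
    ← mul_prod_erase (univ.erase s) _ (mem_erase.2 ⟨h.symm, mem_univ s'⟩)]
  ring

lemma IsGap.eval_branchPoly (h : IsGap e s s') (x : ℝ) :
    (branchPoly e).eval x = -((x - e s) * (e s' - x) * (gapCofactor e s s').eval x) := by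
  rw [branchPoly_eq h.ne]; simp only [eval_mul, eval_sub, eval_X, eval_C]; ring

lemma IsGap.eval_derivative_branchPoly (h : IsGap e s s') (x : ℝ) :
    (branchPoly e).derivative.eval x = -((e s + e s' - 2 * x) * (gapCofactor e s s').eval x +
      (x - e s) * (e s' - x) * (gapCofactor e s s').derivative.eval x) := by
  rw [branchPoly_eq h.ne]
  simp only [derivative_mul, derivative_sub, derivative_X, derivative_C, eval_mul, eval_sub, eval_X,
    eval_C, eval_add, sub_zero, one_mul, mul_one]
  ring

lemma IsGap.continuousOn (h : IsGap e s s') :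
    ContinuousOn (fun y => 1 / √((gapCofactor e s s').eval y)) (Icc (e s) (e s')) :=
  continuousOn_const.div (by fun_prop) fun y hy => (sqrt_pos.2 (h.pos y hy)).ne'

lemma IsGap.continuousOn_div (h : IsGap e s s') {f : ℝ → ℝ}
    (hf : ContinuousOn f (Icc (e s) (e s'))) :
    ContinuousOn (fun y => f y / √((gapCofactor e s s').eval y)) (Icc (e s) (e s')) :=
  hf.div (by fun_prop) fun y hy => (sqrt_pos.2 (h.pos y hy)).ne'

lemma IsGap.gapInt_add (h : IsGap e s s') {f g : ℝ → ℝ} (hf : ContinuousOn f (Icc (e s) (e s')))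
    (hg : ContinuousOn g (Icc (e s) (e s'))) :
    gapInt e s s' (fun x => f x + g x) = gapInt e s s' f + gapInt e s s' g := by
  simp only [gapInt, add_div]
  exact arcInt_add h.lt.le (h.continuousOn_div hf) (h.continuousOn_div hg)

lemma gapInt_const_mul (c : ℝ) (f : ℝ → ℝ) :
    gapInt e s s' (fun x => c * f x) = c * gapInt e s s' f := by
  simp only [gapInt, mul_div_assoc]
  exact arcInt_const_mul _ _ _ _

lemma IsGap.gapInt_congr (h : IsGap e s s') {f g : ℝ → ℝ}
    (hfg : ∀ x ∈ Icc (e s) (e s'), f x = g x) : gapInt e s s' f = gapInt e s s' g :=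
  arcInt_congr h.lt.le fun x hx => by rw [hfg x hx]

/-- The functional `R ↦ ∫ R / √|T|` over a gap. -/
noncomputable def gapLin (h : IsGap e s s') : ℝ[X] →ₗ[ℝ] ℝ where
  toFun R := gapInt e s s' fun y => R.eval y
  map_add' R S := by
    simp only [eval_add]
    exact h.gapInt_add R.continuousOn S.continuousOn
  map_smul' c R := by
    simp only [eval_smul, smul_eq_mul, RingHom.id_apply]
    exact gapInt_const_mul _ _

lemma gapLin_apply (h : IsGap e s s') (R : ℝ[X]) :
    gapLin h R = gapInt e s s' fun y => R.eval y := rfl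

/-- This is `arcInt_deriv_eq_zero` for `g = N / √m`, with `m` the cofactor. -/
lemma IsGap.gapInt_exact (h : IsGap e s s') {N N' : ℝ → ℝ}
    (hN : ∀ x ∈ Icc (e s) (e s'), HasDerivAt N (N' x) x)
    (hN' : ContinuousOn N' (Icc (e s) (e s'))) :
    gapInt e s s' (fun x => (x - e s) * (e s' - x) *
      (N' x - N x * ((gapCofactor e s s').derivative.eval x / (2 * (gapCofactor e s s').eval x)))
      + (e s + e s' - 2 * x) / 2 * N x) = 0 := by
  set m := gapCofactor e s s' with hm
  have hNc : ContinuousOn N (Icc (e s) (e s')) := fun x hx =>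
    (hN x hx).continuousAt.continuousWithinAt
  have hd : ∀ x ∈ Icc (e s) (e s'), HasDerivAt (fun y => N y / √(m.eval y))
      ((N' x - N x * (m.derivative.eval x / (2 * m.eval x))) / √(m.eval x)) x := by
    intro x hx
    have hp : 0 < m.eval x := h.pos x hx
    have h1 := (m.hasDerivAt x).sqrt hp.ne'
    refine ((hN x hx).div h1 (sqrt_pos.2 hp).ne').congr_deriv ?_
    have h2 := sqrt_pos.2 hp
    have h3 : √(m.eval x) ^ 2 = m.eval x := sq_sqrt hp.le
    change _ = (N' x - N x * (m.derivative.eval x / (2 * m.eval x))) / √(m.eval x)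
    rw [h3]
    have h4 : eval x m = √(m.eval x) * √(m.eval x) := by rw [← sq, h3]
    rw [div_eq_div_iff hp.ne' h2.ne']
    field_simp
    rw [h3]; ring
  rw [← arcInt_deriv_eq_zero h.lt.le hd ?_]
  · refine arcInt_congr h.lt.le fun x hx => ?_
    have h2 := sqrt_pos.2 (h.pos x hx)
    change (_ : ℝ) / √(m.eval x) = _
    ring
  · refine h.continuousOn_div (hN'.sub (hNc.mul (m.derivative.continuousOn.div (by fun_prop)
      fun y hy => ?_)))
    exact (mul_pos two_pos (h.pos y hy)).ne'

/-- Formally `T f' + T' f / 2 = √T (√T f)'`, so the integrand over `√T` is the differential of `√T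
f`, which vanishes at both ends of the gap. -/
lemma IsGap.gapInt_exact' (h : IsGap e s s') {f f' : ℝ → ℝ}
    (hf : ∀ x ∈ Icc (e s) (e s'), HasDerivAt f (f' x) x)
    (hf' : ContinuousOn f' (Icc (e s) (e s'))) :
    gapInt e s s' (fun x => (branchPoly e).eval x * f' x + (branchPoly e).derivative.eval x / 2 * f x)
      = 0 := by
  have hfc : ContinuousOn f (Icc (e s) (e s')) := fun x hx =>
    (hf x hx).continuousAt.continuousWithinAt
  rw [← h.gapInt_exact (N := fun x => -((gapCofactor e s s').eval x * f x))
    (fun x hx => (((gapCofactor e s s').hasDerivAt x).mul (hf x hx)).neg) (by fun_prop)]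
  refine h.gapInt_congr fun x hx => ?_
  have hp := (h.pos x hx).ne'
  rw [h.eval_branchPoly, h.eval_derivative_branchPoly]
  field_simp
  ring

/-- The polynomial that represents, up to exact differentials, the derivative of `R dz / √T` with
respect to the branch point `x`. -/
noncomputable def endpointDeriv (T R : ℝ[X]) (x : ℝ) : ℝ[X] :=
  C (-(R.eval x / T.derivative.eval x)) * kernelPoly T x + C (1 / 2) * (R /ₘ (X - C x))

lemma eval_divByMonic_X_sub_C (R : ℝ[X]) (x y : ℝ) :
    (y - x) * (R /ₘ (X - C x)).eval y = R.eval y - R.eval x := by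
  have := congrArg (eval y) (modByMonic_add_div R (X - C x))
  rw [modByMonic_X_sub_C_eq_C_eval] at this
  simp only [eval_add, eval_mul, eval_sub, eval_X, eval_C] at this
  linarith

/-- The right side is the naive derivative of the integral in a branch point `z` off the gap. Its
pole at `z` is removed by adding a multiple of the exact form `d(√T / (z - y))`, and what remains is
the polynomial `endpointDeriv`. -/
lemma IsGap.gapLin_endpointDeriv_of_ne (h : IsGap e s s') {z : ℝ} (hz : z ∉ Icc (e s) (e s'))
    (hT : (branchPoly e).eval z = 0) (hT' : (branchPoly e).derivative.eval z ≠ 0) (R : ℝ[X]) :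
    gapLin h (endpointDeriv (branchPoly e) R z) = gapInt e s s' fun y => R.eval y / (2 * (y - z)) := by
  set T := branchPoly e
  have hne : ∀ y ∈ Icc (e s) (e s'), z - y ≠ 0 := fun y hy h0 => hz (by
    rw [sub_eq_zero.1 h0]; exact hy)
  have hd : ∀ y ∈ Icc (e s) (e s'), HasDerivAt (fun y => 1 / (z - y)) (1 / (z - y) ^ 2) y := by
    intro y hy
    have : HasDerivAt (fun y => (z - y)⁻¹) (-(-1) / (z - y) ^ 2) y :=
      ((hasDerivAt_id y).const_sub z).inv (hne y hy)
    simpa [one_div] using this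
  have h1 := h.gapInt_exact' hd (continuousOn_const.div (by fun_prop) fun y hy =>
    pow_ne_zero 2 (hne y hy))
  have e1 : gapInt e s s' (fun y => R.eval y / (2 * (y - z))) =
      gapInt e s s' (fun y => (endpointDeriv T R z).eval y +
        R.eval z / T.derivative.eval z * (T.eval y * (1 / (z - y) ^ 2)
          + T.derivative.eval y / 2 * (1 / (z - y)))) := by
    refine h.gapInt_congr fun y hy => ?_
    have hzy := hne y hy
    have hyz : y - z ≠ 0 := fun h0 => hzy (by linarith)
    have k1 : (kernelPoly T z).eval y = ((T.derivative.eval z + T.derivative.eval y) * (z - y) / 2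
        + T.eval y) / (z - y) ^ 2 := by
      rw [eq_div_iff (pow_ne_zero 2 hzy), eval_kernelPoly_mul_sq, hT]; ring
    have k2 : (R /ₘ (X - C z)).eval y = (R.eval y - R.eval z) / (y - z) := by
      rw [eq_div_iff hyz, ← eval_divByMonic_X_sub_C]; ring
    simp only [endpointDeriv, eval_add, eval_mul, eval_C]
    rw [k1, k2, show z - y = -(y - z) by ring]
    field_simp
    ring
  rw [e1, h.gapInt_add (endpointDeriv T R z).continuousOn, gapInt_const_mul, h1, mul_zero, add_zero,
    gapLin_apply]
  refine continuousOn_const.mul ((T.continuousOn.mul (continuousOn_const.div (by fun_prop)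
    fun y hy => pow_ne_zero 2 (hne y hy))).add ((T.derivative.continuousOn.div_const 2).mul
    (continuousOn_const.div (by fun_prop) hne)))

/-- When the left end of the gap moves, the cofactor is unchanged and a point at fixed angle moves
with velocity `(β - y) / (β - α)`; the right side is the resulting derivative. It agrees with
`endpointDeriv` up to an exact form. -/
lemma IsGap.gapLin_endpointDeriv_left (h : IsGap e s s') (R : ℝ[X]) :
    gapLin h (endpointDeriv (branchPoly e) R (e s)) = gapInt e s s' fun y =>
      (R.derivative.eval y - R.eval y * ((gapCofactor e s s').derivative.eval y /
        (2 * (gapCofactor e s s').eval y))) * ((e s' - y) / (e s' - e s)) := by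
  set T := branchPoly e with hTdef
  set m := gapCofactor e s s' with hm
  set α := e s with hα
  set β := e s' with hβ
  have hαβ : α < β := h.lt
  have hmα : 0 < m.eval α := h.pos α ⟨le_rfl, hαβ.le⟩
  set R₁ := R /ₘ (X - C α) with hR₁
  set m₁ := m /ₘ (X - C α) with hm₁
  have hR : R = C (R.eval α) + (X - C α) * R₁ := by
    have := modByMonic_add_div R (X - C α)
    rwa [modByMonic_X_sub_C_eq_C_eval, eq_comm] at this
  have hm' : m = C (m.eval α) + (X - C α) * m₁ := by
    have := modByMonic_add_div m (X - C α)
    rwa [modByMonic_X_sub_C_eq_C_eval, eq_comm] at this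
  have hRd : R.derivative = R₁ + (X - C α) * R₁.derivative := by
    conv_lhs => rw [hR]
    simp
  have hmd : m.derivative = m₁ + (X - C α) * m₁.derivative := by
    conv_lhs => rw [hm']
    simp
  have hT'α : T.derivative.eval α = (α - β) * m.eval α := by
    rw [hTdef, h.eval_derivative_branchPoly]; simp only [← hα, ← hβ, ← hm]; ring
  -- Since `T = (X - α)(X - β) m`, the division by `(α - y) ^ 2` in the kernel can be carried out
  -- explicitly at the branch point `α`.
  have hK : C 2 * kernelPoly T α = C (m.eval α) + (X - C β) * m₁ - m - (X - C β) * m.derivative := by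
    have hpoly : (C 2 * kernelPoly T α) * (C α - X) ^ 2 =
        (C (m.eval α) + (X - C β) * m₁ - m - (X - C β) * m.derivative) * (C α - X) ^ 2 := by
      refine Polynomial.funext fun y => ?_
      have h1 := eval_kernelPoly_mul_sq T α y
      have hTα : T.eval α = 0 := by
        rw [hTdef, h.eval_branchPoly]; simp only [← hα, ← hβ, ← hm]; ring
      rw [hTα, hT'α, hTdef, h.eval_derivative_branchPoly, h.eval_branchPoly] at h1
      simp only [← hα, ← hβ, ← hm, ← hTdef] at h1
      have h2 := congrArg (eval y) hm'
      have h3 := congrArg (eval y) hmd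
      simp only [eval_add, eval_mul, eval_sub, eval_C, eval_X, eval_pow] at h2 h3 ⊢
      rw [mul_assoc, h1, h3, h2]
      ring
    exact mul_right_cancel₀ (pow_ne_zero 2 (sub_ne_zero.2 (X_ne_C α).symm)) hpoly
  -- The correcting exact form is built from the difference quotients `R₁`, `m₁` of `R` and `m` at
  -- `α`.
  have hex := h.gapInt_exact (N := fun y => (R₁.eval y - R.eval α / m.eval α * m₁.eval y) / (β - α))
    (N' := fun y => (R₁.derivative.eval y - R.eval α / m.eval α * m₁.derivative.eval y) / (β - α))
    (fun x _ => ((R₁.hasDerivAt x).sub ((m₁.hasDerivAt x).const_mul _)).div_const _) (by fun_prop)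
  simp only [← hα, ← hβ, ← hm] at hex
  have hmc : ContinuousOn (fun y => m.derivative.eval y / (2 * m.eval y)) (Icc α β) :=
    m.derivative.continuousOn.div (by fun_prop) fun y hy => (mul_pos two_pos (h.pos y hy)).ne'
  rw [gapLin_apply, ← add_zero (gapInt e s s' fun y => (endpointDeriv T R α).eval y), ← hex,
    ← h.gapInt_add (endpointDeriv T R α).continuousOn]
  · refine h.gapInt_congr fun y hy => ?_
    have hy0 := (h.pos y hy).ne'
    rw [← hm] at hy0
    have h1 := congrArg (eval y) hK
    have h2 := congrArg (eval y) hm'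
    have h3 := congrArg (eval y) hmd
    have h4 := congrArg (eval y) hR
    have h5 := congrArg (eval y) hRd
    simp only [eval_add, eval_mul, eval_sub, eval_C, eval_X] at h1 h2 h3 h4 h5
    have h1' : (kernelPoly T α).eval y = (m.eval α + (y - β) * m₁.eval y - m.eval y -
        (y - β) * m.derivative.eval y) / 2 := by linarith
    simp only [endpointDeriv, eval_add, eval_mul, eval_C]
    rw [hT'α, h1', ← hR₁]
    have hba : β - α ≠ 0 := by linarith
    have hab : α - β ≠ 0 := by linarith
    rw [show α - β = -(β - α) by ring]
    field_simp
    rw [h5, h4, h3, h2]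
    ring
  · fun_prop

lemma IsGap.gapLin_endpointDeriv_right (h : IsGap e s s') (R : ℝ[X]) :
    gapLin h (endpointDeriv (branchPoly e) R (e s')) = gapInt e s s' fun y =>
      (R.derivative.eval y - R.eval y * ((gapCofactor e s s').derivative.eval y /
        (2 * (gapCofactor e s s').eval y))) * ((y - e s) / (e s' - e s)) := by
  set T := branchPoly e with hTdef
  set m := gapCofactor e s s' with hm
  set α := e s with hα
  set β := e s' with hβ
  have hαβ : α < β := h.lt
  have hmβ : 0 < m.eval β := h.pos β ⟨hαβ.le, le_rfl⟩
  set R₁ := R /ₘ (X - C β) with hR₁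
  set m₁ := m /ₘ (X - C β) with hm₁
  have hR : R = C (R.eval β) + (X - C β) * R₁ := by
    have := modByMonic_add_div R (X - C β)
    rwa [modByMonic_X_sub_C_eq_C_eval, eq_comm] at this
  have hm' : m = C (m.eval β) + (X - C β) * m₁ := by
    have := modByMonic_add_div m (X - C β)
    rwa [modByMonic_X_sub_C_eq_C_eval, eq_comm] at this
  have hRd : R.derivative = R₁ + (X - C β) * R₁.derivative := by
    conv_lhs => rw [hR]
    simp
  have hmd : m.derivative = m₁ + (X - C β) * m₁.derivative := by
    conv_lhs => rw [hm']
    simp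
  have hT'β : T.derivative.eval β = (β - α) * m.eval β := by
    rw [hTdef, h.eval_derivative_branchPoly]; simp only [← hα, ← hβ, ← hm]; ring
  have hK : C 2 * kernelPoly T β = C (m.eval β) + (X - C α) * m₁ - m - (X - C α) * m.derivative := by
    have hpoly : (C 2 * kernelPoly T β) * (C β - X) ^ 2 =
        (C (m.eval β) + (X - C α) * m₁ - m - (X - C α) * m.derivative) * (C β - X) ^ 2 := by
      refine Polynomial.funext fun y => ?_
      have h1 := eval_kernelPoly_mul_sq T β y
      have hTβ : T.eval β = 0 := by
        rw [hTdef, h.eval_branchPoly]; simp only [← hα, ← hβ, ← hm]; ring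
      rw [hTβ, hT'β, hTdef, h.eval_derivative_branchPoly, h.eval_branchPoly] at h1
      simp only [← hα, ← hβ, ← hm, ← hTdef] at h1
      have h2 := congrArg (eval y) hm'
      have h3 := congrArg (eval y) hmd
      simp only [eval_add, eval_mul, eval_sub, eval_C, eval_X, eval_pow] at h2 h3 ⊢
      rw [mul_assoc, h1, h3, h2]
      ring
    exact mul_right_cancel₀ (pow_ne_zero 2 (sub_ne_zero.2 (X_ne_C β).symm)) hpoly
  have hex := h.gapInt_exact
    (N := fun y => -(R₁.eval y - R.eval β / m.eval β * m₁.eval y) / (β - α))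
    (N' := fun y => -(R₁.derivative.eval y - R.eval β / m.eval β * m₁.derivative.eval y) / (β - α))
    (fun x _ => ((R₁.hasDerivAt x).sub ((m₁.hasDerivAt x).const_mul _)).neg.div_const _)
    (by fun_prop)
  simp only [← hα, ← hβ, ← hm] at hex
  have hmc : ContinuousOn (fun y => m.derivative.eval y / (2 * m.eval y)) (Icc α β) :=
    m.derivative.continuousOn.div (by fun_prop) fun y hy => (mul_pos two_pos (h.pos y hy)).ne'
  rw [gapLin_apply, ← add_zero (gapInt e s s' fun y => (endpointDeriv T R β).eval y), ← hex,
    ← h.gapInt_add (endpointDeriv T R β).continuousOn]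
  · refine h.gapInt_congr fun y hy => ?_
    have hy0 := (h.pos y hy).ne'
    rw [← hm] at hy0
    have h1 := congrArg (eval y) hK
    have h2 := congrArg (eval y) hm'
    have h3 := congrArg (eval y) hmd
    have h4 := congrArg (eval y) hR
    have h5 := congrArg (eval y) hRd
    simp only [eval_add, eval_mul, eval_sub, eval_C, eval_X] at h1 h2 h3 h4 h5
    have h1' : (kernelPoly T β).eval y = (m.eval β + (y - α) * m₁.eval y - m.eval y -
        (y - α) * m.derivative.eval y) / 2 := by linarith
    simp only [endpointDeriv, eval_add, eval_mul, eval_C]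
    rw [hT'β, h1', ← hR₁]
    have hba : β - α ≠ 0 := by linarith
    field_simp
    rw [h5, h4, h3, h2]
    ring
  · fun_prop

end GapIntegral


/-! ### Derivative of gap integrals in the branch points -/

section EndpointVariation

open Real Set Filter Topology MeasureTheory Finset

variable {ι : Type*} [Fintype ι] [DecidableEq ι] {e : ι → ℝ} {s s' : ι}

lemma eval_gapCofactor (e : ι → ℝ) (s s' : ι) (x : ℝ) :
    (gapCofactor e s s').eval x = x * ∏ i ∈ (univ.erase s).erase s', (x - e i) := by
  simp [gapCofactor, eval_prod]

lemma IsGap.notMem_Icc (h : IsGap e s s') {i : ι} (hs : i ≠ s) (hs' : i ≠ s') :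
    e i ∉ Set.Icc (e s) (e s') := fun hi => by
  have := h.pos _ hi
  rw [eval_gapCofactor, prod_eq_zero (i := i) (by simp [hs, hs']) (sub_self _), mul_zero] at this
  exact lt_irrefl _ this

lemma eval_branchPoly_self {κ : Type*} [Fintype κ] (e : κ → ℝ) (i : κ) : (branchPoly e).eval (e i) = 0 := by
  simp [branchPoly, eval_prod, prod_eq_zero (mem_univ i)]

lemma IsGap.hasDerivAt_of_ne (h : IsGap e s s') {i : ι} (hs : i ≠ s) (hs' : i ≠ s') (r : ℝ) {y : ℝ}
    (hy : y ∈ Set.Icc (e s) (e s')) :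
    HasDerivAt (fun t : ℝ => r / √((gapCofactor (e + t • Pi.single i (1 : ℝ)) s s').eval y))
      (r / (2 * (y - e i)) / √((gapCofactor e s s').eval y)) 0 := by
  have hi : i ∈ (univ.erase s).erase s' := by simp [hs, hs']
  set c := y * ∏ j ∈ ((univ.erase s).erase s').erase i, (y - e j) with hc
  have h1 : ∀ t : ℝ, (gapCofactor (e + t • Pi.single i (1 : ℝ)) s s').eval y
      = c * (y - e i - t) := by
    intro t
    rw [eval_gapCofactor, ← mul_prod_erase _ _ hi, hc]
    have : ∏ j ∈ ((univ.erase s).erase s').erase i, (y - (e + t • (Pi.single i (1 : ℝ) : ι → ℝ)) j)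
        = ∏ j ∈ ((univ.erase s).erase s').erase i, (y - e j) := by
      refine prod_congr rfl fun j hj => ?_
      simp [Pi.single_eq_of_ne (ne_of_mem_erase hj)]
    rw [this]
    simp; ring
  have h2 := h1 0
  rw [zero_smul, add_zero, sub_zero] at h2
  have hp := h.pos y hy
  rw [h2] at hp
  have hp' : 0 < c * (y - e i - 0) := by simpa using hp
  have hy : y - e i ≠ 0 := fun h0 => by rw [h0, mul_zero] at hp; exact lt_irrefl _ hp
  simp only [h1, h2]
  have h3 : HasDerivAt (fun t : ℝ => c * (y - e i - t)) (c * (-1)) 0 :=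
    ((hasDerivAt_id (0 : ℝ)).const_sub (y - e i)).const_mul c
  have h4 := (hasDerivAt_const (0 : ℝ) r).div (h3.sqrt hp'.ne') (sqrt_pos.2 hp').ne'
  refine h4.congr_deriv ?_
  rw [sub_zero, sq_sqrt hp.le]
  have h5 := sqrt_pos.2 hp
  have h6 : √(c * (y - e i)) * √(c * (y - e i)) = c * (y - e i) := mul_self_sqrt hp.le
  have hc0 : c ≠ 0 := fun h0 => by rw [h0, zero_mul] at hp; exact lt_irrefl _ hp
  field_simp
  ring

lemma IsGap.hasDerivAt_comp (h : IsGap e s s') (R : ℝ[X]) {x : ℝ → ℝ} {x' : ℝ}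
    (hx : HasDerivAt x x' 0) (hmem : x 0 ∈ Set.Icc (e s) (e s')) :
    HasDerivAt (fun t : ℝ => R.eval (x t) / √((gapCofactor e s s').eval (x t)))
      ((R.derivative.eval (x 0) - R.eval (x 0) * ((gapCofactor e s s').derivative.eval (x 0) /
        (2 * (gapCofactor e s s').eval (x 0)))) * x' / √((gapCofactor e s s').eval (x 0))) 0 := by
  set m := gapCofactor e s s'
  have hp : 0 < m.eval (x 0) := h.pos _ hmem
  have h1 : HasDerivAt (fun t => R.eval (x t)) (R.derivative.eval (x 0) * x') 0 :=
    (R.hasDerivAt (x 0)).comp 0 hx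
  have h2 : HasDerivAt (fun t => m.eval (x t)) (m.derivative.eval (x 0) * x') 0 :=
    (m.hasDerivAt (x 0)).comp 0 hx
  refine (h1.div (h2.sqrt hp.ne') (sqrt_pos.2 hp).ne').congr_deriv ?_
  have h5 := sqrt_pos.2 hp
  have h6 : √(m.eval (x 0)) ^ 2 = m.eval (x 0) := sq_sqrt hp.le
  rw [h6, div_eq_div_iff hp.ne' h5.ne']
  field_simp
  rw [h6]; ring

lemma gapCofactor_add_single (e : ι → ℝ) {i : ι} (hi : i = s ∨ i = s') (t : ℝ) :
    gapCofactor (e + t • Pi.single i (1 : ℝ)) s s' = gapCofactor e s s' := by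
  simp only [gapCofactor]
  congr 1
  refine prod_congr rfl fun j hj => ?_
  have hj' : j ≠ i := by
    rintro rfl
    rcases hi with rfl | rfl <;> simp at hj
  simp [Pi.single_eq_of_ne hj']

/-- The angular variable fixes the interval of integration and absorbs the endpoint singularities,
so the integrand is jointly `C¹` in the branch points and the angle. Each partial derivative is then
computed along a coordinate line, with separate formulas for the left end, the right end and a
branch point off the gap. -/
theorem hasStrictFDerivAt_gapInt {U : Set (ι → ℝ)} (hU : IsOpen U) (hg : ∀ e ∈ U, IsGap e s s')
    (he : e ∈ U) (hT' : ∀ i, (branchPoly e).derivative.eval (e i) ≠ 0) (R : ℝ[X]) :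
    HasStrictFDerivAt (fun e => gapInt e s s' fun y => R.eval y)
      (∑ i, gapLin (hg e he) (endpointDeriv (branchPoly e) R (e i)) •
        (ContinuousLinearMap.proj i : (ι → ℝ) →L[ℝ] ℝ)) e := by
  have h := hg e he
  set F : (ι → ℝ) → ℝ → ℝ := fun e θ => R.eval (arcPoint (e s) (e s') θ) /
    √((gapCofactor e s s').eval (arcPoint (e s) (e s') θ)) with hF
  have hcd : ∀ e ∈ U, ∀ t ∈ Set.Icc 0 π, ContDiffAt ℝ 1 (fun p : (ι → ℝ) × ℝ => F p.1 p.2) (e, t) := by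
    intro e he t _
    have hx : ContDiff ℝ 1 fun p : (ι → ℝ) × ℝ => arcPoint (p.1 s) (p.1 s') p.2 := by
      unfold arcPoint; fun_prop
    have hpos := (hg e he).pos _ (arcPoint_mem_Icc (hg e he).lt.le t)
    have hm : ContDiff ℝ 1 fun p : (ι → ℝ) × ℝ =>
        (gapCofactor p.1 s s').eval (arcPoint (p.1 s) (p.1 s') p.2) := by
      simp only [eval_gapCofactor]
      refine hx.mul (contDiff_prod fun i _ => hx.sub ?_)
      fun_prop
    have hR : ContDiff ℝ 1 fun p : (ι → ℝ) × ℝ => R.eval (arcPoint (p.1 s) (p.1 s') p.2) := by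
      have : ContDiff ℝ 1 fun x : ℝ => R.eval x := by
        simpa using R.contDiff_aeval (𝕜 := ℝ) 1
      exact this.comp hx
    exact hR.contDiffAt.div (hm.contDiffAt.sqrt hpos.ne') (sqrt_pos.2 hpos).ne'
  obtain ⟨hdiff, hint, hstrict⟩ := hasStrictFDerivAt_intervalIntegral hU he pi_pos.le hcd
  refine hstrict.congr_fderiv (Eq.symm ?_)
  apply ContinuousLinearMap.coe_injective
  apply LinearMap.pi_ext'
  intro i
  ext
  simp only [ContinuousLinearMap.toLinearMap_sum, ContinuousLinearMap.toLinearMap_smul, LinearMap.coe_comp,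
    Function.comp, LinearMap.coe_single, ContinuousLinearMap.coe_coe, LinearMap.sum_apply,
    LinearMap.smul_apply, ContinuousLinearMap.proj_apply, smul_eq_mul]
  rw [ContinuousLinearMap.intervalIntegral_apply hint, Finset.sum_eq_single i
    (fun j _ hj => by rw [Pi.single_eq_of_ne hj, mul_zero]) (by simp), Pi.single_eq_same, mul_one]
  have hline : ∀ {δ : ℝ → ℝ}, (∀ θ, HasDerivAt (fun t : ℝ => F (e + t • Pi.single i (1 : ℝ)) θ)
      (δ θ) 0) → ∫ t in (0 : ℝ)..π, fderiv ℝ (fun x => F x t) e (Pi.single i 1)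
        = ∫ θ in (0 : ℝ)..π, δ θ := by
    intro δ hδ
    refine intervalIntegral.integral_congr fun θ hθ => ?_
    rw [Set.uIcc_of_le pi_pos.le] at hθ
    have h1 := (hdiff θ hθ).hasFDerivAt.hasLineDerivAt (Pi.single i 1)
    exact HasDerivAt.unique h1 (hδ θ)
  have hα : ∀ θ, arcPoint (e s) (e s') θ ∈ Set.Icc (e s) (e s') := arcPoint_mem_Icc h.lt.le
  have hba : e s' - e s ≠ 0 := by linarith [h.lt]
  by_cases his : i = s
  · subst his
    rw [h.gapLin_endpointDeriv_left, gapInt, arcInt]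
    symm
    refine hline fun θ => ?_
    have hx : HasDerivAt (fun t : ℝ => arcPoint (e i + t) (e s') θ)
        ((e s' - arcPoint (e i) (e s') θ) / (e s' - e i)) 0 := by
      have h1 := (((hasDerivAt_id (0 : ℝ)).const_add (e i)).add_const (e s')).div_const 2
      have h2 := ((((hasDerivAt_id (0 : ℝ)).const_add (e i)).const_sub (e s')).div_const 2).mul_const
        (Real.cos θ)
      refine (h1.sub h2).congr_deriv ?_
      unfold arcPoint; field_simp; ring
    have := h.hasDerivAt_comp R hx (by simpa using hα θ)
    simp only [add_zero] at this
    refine this.congr_of_eventuallyEq (Filter.Eventually.of_forall fun t => ?_)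
    simp only [hF, gapCofactor_add_single e (Or.inl rfl)]
    simp [Pi.single_eq_of_ne h.ne.symm]
  by_cases his' : i = s'
  · subst his'
    rw [h.gapLin_endpointDeriv_right, gapInt, arcInt]
    symm
    refine hline fun θ => ?_
    have hx : HasDerivAt (fun t : ℝ => arcPoint (e s) (e i + t) θ)
        ((arcPoint (e s) (e i) θ - e s) / (e i - e s)) 0 := by
      have h1 := (((hasDerivAt_id (0 : ℝ)).const_add (e i)).const_add (e s)).div_const 2
      have h2 := ((((hasDerivAt_id (0 : ℝ)).const_add (e i)).sub_const (e s)).div_const 2).mul_const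
        (Real.cos θ)
      refine (h1.sub h2).congr_deriv ?_
      unfold arcPoint; field_simp; ring
    have := h.hasDerivAt_comp R hx (by simpa using hα θ)
    simp only [add_zero] at this
    refine this.congr_of_eventuallyEq (Filter.Eventually.of_forall fun t => ?_)
    simp only [hF, gapCofactor_add_single e (Or.inr rfl)]
    simp [Pi.single_eq_of_ne h.ne]
  · rw [h.gapLin_endpointDeriv_of_ne (h.notMem_Icc his his') (eval_branchPoly_self e i) (hT' i),
      gapInt, arcInt]
    symm
    refine hline fun θ => ?_
    have := h.hasDerivAt_of_ne his his' (R.eval (arcPoint (e s) (e s') θ)) (hα θ)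
    refine this.congr_of_eventuallyEq (Filter.Eventually.of_forall fun t => ?_)
    simp [hF, Pi.single_eq_of_ne (Ne.symm his), Pi.single_eq_of_ne (Ne.symm his')]

end EndpointVariation


/-! ### The branch of the root on the real axis -/

section RootT

open Real Set Filter Topology MeasureTheory Finset
open scoped ComplexOrder

/-- Real powers of a negative base carry the factor `cos (π p)`, which is zero for `p = -1/2`, so at
most one summand survives. At `x = 0` all terms take the default value zero. -/
lemma one_div_sqrt_abs (x : ℝ) :
    1 / √|x| = x ^ (-(1 / 2) : ℝ) + (-x) ^ (-(1 / 2) : ℝ) := by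
  have hneg : ∀ y : ℝ, y < 0 → y ^ (-(1 / 2) : ℝ) = 0 := fun y hy => by
    rw [rpow_def_of_neg hy, show -(1 / 2) * π = -(π / 2) by ring, Real.cos_neg, Real.cos_pi_div_two,
      mul_zero]
  have hpos : ∀ y : ℝ, 0 < y → y ^ (-(1 / 2) : ℝ) = 1 / √y := fun y hy => by
    rw [rpow_neg hy.le, ← sqrt_eq_rpow, one_div]
  rcases lt_trichotomy x 0 with hx | rfl | hx
  · rw [hneg x hx, hpos _ (neg_pos.2 hx), abs_of_neg hx, zero_add]
  · rw [neg_zero, zero_rpow (by norm_num)]; simp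
  · rw [hpos x hx, hneg _ (neg_neg_of_pos hx), abs_of_pos hx, add_zero]

lemma intervalIntegrable_one_div_sqrt_abs_sub (v c d : ℝ) :
    IntervalIntegrable (fun x => 1 / √|x - v|) volume c d := by
  have h1 : ∀ c d : ℝ, IntervalIntegrable (fun x : ℝ => x ^ (-(1 / 2) : ℝ)) volume c d := fun c d =>
    intervalIntegral.intervalIntegrable_rpow' (by norm_num)
  have h2 : IntervalIntegrable (fun x : ℝ => (-x) ^ (-(1 / 2) : ℝ)) volume (c - v) (d - v) := by
    simpa using (h1 (-(c - v)) (-(d - v))).comp_sub_left 0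
  have h3 : IntervalIntegrable (fun x => 1 / √|x|) volume (c - v) (d - v) := by
    simp only [one_div_sqrt_abs]
    exact (h1 _ _).add h2
  simpa using h3.comp_sub_right v

/-- The Lagrange basis polynomials sum to one; dividing by the product gives a partial fraction
bound for `1 / |∏ (x - v i)|`, and the square root of a sum is at most the sum of square roots.
Local integrability thereby reduces to a single square root singularity. -/
lemma one_div_sqrt_abs_prod_le {κ : Type*} [Fintype κ] [Nonempty κ] {v : κ → ℝ}
    (hv : Function.Injective v) :
    ∃ c : κ → ℝ, ∀ x, 1 / √|∏ i, (x - v i)| ≤ ∑ i, c i * (1 / √|x - v i|) := by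
  classical
  set d : κ → ℝ := fun i => |∏ j ∈ univ.erase i, (v i - v j)⁻¹| with hd
  refine ⟨fun i => √(d i), fun x => ?_⟩
  have hrhs : 0 ≤ ∑ i, √(d i) * (1 / √|x - v i|) := by positivity
  by_cases hx : ∏ i, (x - v i) = 0
  · rw [hx]; simpa using hrhs
  have hxi : ∀ i, 0 < |x - v i| := fun i => abs_pos.2 (Finset.prod_ne_zero_iff.1 hx i (mem_univ i))
  have h1 : (1 : ℝ) = ∑ i, ∏ j ∈ univ.erase i, ((v i - v j)⁻¹ * (x - v j)) := by
    have := congrArg (eval x) (Lagrange.sum_basis (s := univ) (v := v) hv.injOn univ_nonempty)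
    simp only [eval_finsetSum, Lagrange.basis, eval_prod, Lagrange.basisDivisor, eval_mul, eval_C,
      eval_sub, eval_X, eval_one] at this
    exact this.symm
  have h2 : (1 : ℝ) ≤ ∑ i, d i * (|∏ i, (x - v i)| / |x - v i|) := by
    calc (1 : ℝ) = |∑ i, ∏ j ∈ univ.erase i, ((v i - v j)⁻¹ * (x - v j))| := by rw [← h1, abs_one]
      _ ≤ ∑ i, |∏ j ∈ univ.erase i, ((v i - v j)⁻¹ * (x - v j))| := abs_sum_le_sum_abs _ _
      _ = _ := by
        refine sum_congr rfl fun i _ => ?_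
        rw [prod_mul_distrib, abs_mul, ← mul_prod_erase univ _ (mem_univ i), abs_mul,
          mul_div_cancel_left₀ _ (hxi i).ne']
  have hP : 0 < |∏ i, (x - v i)| := abs_pos.2 hx
  have h3 : 1 / |∏ i, (x - v i)| ≤ ∑ i, (√(d i) * (1 / √|x - v i|)) ^ 2 := by
    rw [div_le_iff₀ hP, sum_mul]
    refine h2.trans (le_of_eq (sum_congr rfl fun i _ => ?_))
    rw [mul_pow, div_pow, sq_sqrt (abs_nonneg _), sq_sqrt (hxi i).le]
    ring
  rw [← sqrt_one, ← sqrt_div zero_le_one, sqrt_one]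
  refine Real.sqrt_le_iff.2 ⟨hrhs, h3.trans (sum_sq_le_sq_sum_of_nonneg fun i _ => by positivity)⟩

lemma intervalIntegrable_one_div_sqrt_abs_prod {κ : Type*} [Fintype κ] [Nonempty κ] {v : κ → ℝ}
    (hv : Function.Injective v) (c d : ℝ) :
    IntervalIntegrable (fun x => 1 / √|∏ i, (x - v i)|) volume c d := by
  obtain ⟨w, hw⟩ := one_div_sqrt_abs_prod_le hv
  have h1 : IntervalIntegrable (fun x => ∑ i, w i * (1 / √|x - v i|)) volume c d := by
    have := IntervalIntegrable.sum (μ := volume) (a := c) (b := d) univ (f := fun i x => w i * (1 / √|x - v i|))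
      fun i _ => (intervalIntegrable_one_div_sqrt_abs_sub (v i) c d).const_mul (w i)
    have e : (fun x => ∑ i, w i * (1 / √|x - v i|)) = ∑ i, fun x => w i * (1 / √|x - v i|) := by
      funext x; simp
    rwa [e]
  refine h1.mono_fun ?_ (Eventually.of_forall fun x => ?_)
  · refine Measurable.aestronglyMeasurable ?_
    fun_prop
  · simp only
    rw [norm_of_nonneg (by positivity)]
    exact (hw x).trans (le_abs_self _)

/-- From `(r y - r x)(r y + r x) = f y - f x`, continuity and `r x ≠ 0` suffice to divide the
slopes. This avoids differentiating the principal root on its cut. -/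
lemma hasDerivAt_of_sq_eq {r f : ℝ → ℂ} {f' : ℂ} {x : ℝ} (hr : ContinuousAt r x)
    (hf : HasDerivAt f f' x) (hsq : ∀ y, r y ^ 2 = f y) (hx : r x ≠ 0) :
    HasDerivAt r (f' / (2 * r x)) x := by
  rw [hasDerivAt_iff_tendsto_slope] at hf ⊢
  have h2 : r x + r x ≠ 0 := by rw [← two_mul]; exact mul_ne_zero two_ne_zero hx
  have hs : Tendsto (fun y => r y + r x) (𝓝[≠] x) (𝓝 (r x + r x)) :=
    (hr.tendsto.mono_left nhdsWithin_le_nhds).add_const _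
  have h3 := hf.div hs h2
  rw [← two_mul] at h3
  refine h3.congr' ?_
  filter_upwards [hs.eventually_ne h2] with y hy
  rw [Pi.div_apply, slope, slope, vsub_eq_sub, vsub_eq_sub, ← hsq, ← hsq, div_eq_iff hy, smul_mul_assoc]
  congr 1; ring

lemma sqrt_ofReal_eq (x : ℝ) : Complex.sqrt (x : ℂ) = √x + Complex.I * √(-x) := by
  rcases le_total 0 x with h | h
  · rw [Complex.sqrt_of_nonneg (by exact_mod_cast h), sqrt_eq_zero_of_nonpos (neg_nonpos.2 h)]
    simp
  · have h' : (0 : ℂ) ≤ ((-x : ℝ) : ℂ) := by exact_mod_cast neg_nonneg.2 h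
    have := Complex.sqrt_neg_of_nonneg h'
    rw [Complex.sqrt_of_nonneg h', ← Complex.ofReal_neg, neg_neg, Complex.ofReal_re] at this
    rw [this, sqrt_eq_zero_of_nonpos h]
    simp

lemma sqrt_ofReal_sq (x : ℝ) : Complex.sqrt (x : ℂ) ^ 2 = x := by
  rw [sqrt_ofReal_eq]
  rcases le_total 0 x with h | h
  · rw [sqrt_eq_zero_of_nonpos (neg_nonpos.2 h)]
    simp only [Complex.ofReal_zero, mul_zero, add_zero]
    exact_mod_cast sq_sqrt h
  · rw [sqrt_eq_zero_of_nonpos h, Complex.ofReal_zero, zero_add, mul_pow, Complex.I_sq]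
    have : ((√(-x) : ℝ) : ℂ) ^ 2 = ((-x : ℝ) : ℂ) := by exact_mod_cast sq_sqrt (neg_nonneg.2 h)
    rw [this]; push_cast; ring

lemma continuous_sqrt_ofReal : Continuous fun x : ℝ => Complex.sqrt (x : ℂ) := by
  simp only [sqrt_ofReal_eq]
  fun_prop

variable {n : ℕ}

lemma rootT_ofReal (a b : Fin n → ℝ) (x : ℝ) : rootT a b (x : ℂ) =
    Complex.sqrt (x : ℂ) * ∏ k, (Complex.sqrt ((x - a k : ℝ) : ℂ) * Complex.sqrt ((x - b k : ℝ) : ℂ)) := by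
  simp only [rootT, Complex.ofReal_sub]

lemma eval_curvePoly (a b : Fin n → ℝ) (x : ℝ) :
    (curvePoly a b).eval x = x * ∏ k, ((x - a k) * (x - b k)) := by
  simp [curvePoly, eval_prod]

lemma rootT_sq (a b : Fin n → ℝ) (x : ℝ) :
    rootT a b (x : ℂ) ^ 2 = ((curvePoly a b).eval x : ℝ) := by
  rw [rootT_ofReal, mul_pow, ← Finset.prod_pow, sqrt_ofReal_sq, eval_curvePoly]
  simp only [mul_pow, sqrt_ofReal_sq]
  push_cast
  rfl

lemma continuous_rootT (a b : Fin n → ℝ) : Continuous fun x : ℝ => rootT a b (x : ℂ) := by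
  simp only [rootT_ofReal]
  refine continuous_sqrt_ofReal.mul (continuous_finsetProd _ fun k _ => ?_)
  exact (continuous_sqrt_ofReal.comp (continuous_sub_right _)).mul
    (continuous_sqrt_ofReal.comp (continuous_sub_right _))

lemma rootT_ne_zero {a b : Fin n → ℝ} {x : ℝ} (hx : (curvePoly a b).eval x ≠ 0) :
    rootT a b (x : ℂ) ≠ 0 := fun h => hx (by
  have := rootT_sq a b x
  rw [h] at this
  simpa using this.symm)

lemma rootT_eq_zero {a b : Fin n → ℝ} {x : ℝ} (hx : (curvePoly a b).eval x = 0) :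
    rootT a b (x : ℂ) = 0 := by
  have := rootT_sq a b x
  rw [hx] at this
  simpa using this

lemma hasDerivAt_ofReal_eval (R : ℝ[X]) (x : ℝ) :
    HasDerivAt (fun y : ℝ => ((R.eval y : ℝ) : ℂ)) ((R.derivative.eval x : ℝ) : ℂ) x :=
  (R.hasDerivAt x).ofReal_comp

lemma hasDerivAt_rootT {a b : Fin n → ℝ} {x : ℝ} (hx : (curvePoly a b).eval x ≠ 0) :
    HasDerivAt (fun x : ℝ => rootT a b (x : ℂ))
      ((((curvePoly a b).derivative.eval x : ℝ) : ℂ) / (2 * rootT a b (x : ℂ))) x :=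
  hasDerivAt_of_sq_eq (continuous_rootT a b).continuousAt (hasDerivAt_ofReal_eval _ x)
    (rootT_sq a b) (rootT_ne_zero hx)

lemma norm_rootT (a b : Fin n → ℝ) (x : ℝ) :
    ‖rootT a b (x : ℂ)‖ = √|(curvePoly a b).eval x| := by
  have := congrArg norm (rootT_sq a b x)
  rw [norm_pow, Complex.norm_real, norm_eq_abs] at this
  rw [← this, sqrt_sq (norm_nonneg _)]

/-- The endpoints of the gaps as one family. -/
noncomputable def endpoints (a b : Fin n → ℝ) : Fin n ⊕ Fin n → ℝ := Sum.elim a b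

lemma curvePoly_eq_branchPoly (a b : Fin n → ℝ) : curvePoly a b = branchPoly (endpoints a b) := by
  simp [curvePoly, branchPoly, endpoints, prod_mul_distrib]

variable {a b : Fin n → ℝ}

lemma IsGapSystem.b_pos (hab : IsGapSystem a b) (k : Fin n) : 0 < b k :=
  (hab.pos k).trans (hab.lt k)

lemma IsGapSystem.a_lt_a (hab : IsGapSystem a b) {i j : Fin n} (h : i < j) : a j < a i :=
  (hab.lt j).trans (hab.sep i j h)

lemma IsGapSystem.injective_endpoints (hab : IsGapSystem a b) :
    Function.Injective (endpoints a b) := by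
  rintro (i | i) (j | j) h <;> simp only [endpoints, Sum.elim_inl, Sum.elim_inr] at h
  · rcases lt_trichotomy i j with hij | hij | hij
    · linarith [hab.a_lt_a hij]
    · rw [hij]
    · linarith [hab.a_lt_a hij]
  · rcases lt_trichotomy i j with hij | hij | hij
    · linarith [hab.sep i j hij]
    · subst hij; linarith [hab.lt i]
    · linarith [hab.a_lt_a hij, hab.lt j]
  · rcases lt_trichotomy i j with hij | hij | hij
    · linarith [hab.lt i, hab.a_lt_a hij]
    · subst hij; linarith [hab.lt i]
    · linarith [hab.sep j i hij]
  · rcases lt_trichotomy i j with hij | hij | hij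
    · linarith [hab.sep i j hij, hab.lt i]
    · rw [hij]
    · linarith [hab.sep j i hij, hab.lt j]

lemma IsGapSystem.endpoints_pos (hab : IsGapSystem a b) (s : Fin n ⊕ Fin n) :
    0 < endpoints a b s := by
  rcases s with k | k
  · exact hab.pos k
  · exact hab.b_pos k

lemma IsGapSystem.intervalIntegrable (hab : IsGapSystem a b) (R : ℝ[X]) (c d : ℝ) :
    IntervalIntegrable (fun t : ℝ => ((R.eval t : ℝ) : ℂ) / rootT a b (t : ℂ)) volume c d := by
  set v : Option (Fin n ⊕ Fin n) → ℝ := fun o => o.elim 0 (endpoints a b) with hv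
  have hinj : Function.Injective v := by
    rintro (_ | s) (_ | t) h
    · rfl
    · exact absurd h (hab.endpoints_pos t).ne
    · exact absurd h (hab.endpoints_pos s).ne'
    · rw [hab.injective_endpoints h]
  have h1 := (intervalIntegrable_one_div_sqrt_abs_prod hinj c d).continuousOn_mul
    (g := fun x => R.eval x) R.continuousOn
  refine h1.mono_fun ?_ (Eventually.of_forall fun x => ?_)
  · refine Measurable.aestronglyMeasurable (Measurable.div ?_ (continuous_rootT a b).measurable)
    exact (Complex.continuous_ofReal.comp R.continuous).measurable
  · have h2 : ∏ o, (x - v o) = (curvePoly a b).eval x := by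
      rw [curvePoly_eq_branchPoly, branchPoly, eval_mul, eval_X, eval_prod, Fintype.prod_option]
      simp [hv]
    simp only
    rw [norm_div, norm_rootT, Complex.norm_real, h2, norm_mul, norm_div, norm_one,
      norm_of_nonneg (sqrt_nonneg _), mul_one_div]

lemma gapCofactor_endpoints (a b : Fin n → ℝ) (k : Fin n) :
    gapCofactor (endpoints a b) (.inl k) (.inr k) =
      X * ∏ i ∈ univ.erase k, ((X - C (a i)) * (X - C (b i))) := by
  have h1 := branchPoly_eq (e := endpoints a b) (s := Sum.inl k) (s' := Sum.inr k) (by simp)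
  rw [← curvePoly_eq_branchPoly, curvePoly, ← mul_prod_erase univ _ (mem_univ k)] at h1
  have h2 : (X - C (a k)) * (X - C (b k)) ≠ 0 := mul_ne_zero (X_sub_C_ne_zero _) (X_sub_C_ne_zero _)
  refine mul_left_cancel₀ h2 ?_
  rw [show (X - C (a k)) * (X - C (b k)) * gapCofactor (endpoints a b) (.inl k) (.inr k) = _ from
    h1.symm]
  ring

lemma IsGapSystem.pair_pos (hab : IsGapSystem a b) {k i : Fin n} (hik : i ≠ k) {x : ℝ}
    (hx : x ∈ Set.Icc (a k) (b k)) : 0 < (x - a i) * (x - b i) := by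
  rcases lt_or_gt_of_ne hik with h | h
  · exact mul_pos_of_neg_of_neg (by linarith [hab.sep i k h, hx.2])
      (by linarith [hab.sep i k h, hx.2, hab.lt i])
  · exact mul_pos (by linarith [hab.sep k i h, hx.1, hab.lt i]) (by linarith [hab.sep k i h, hx.1])

lemma IsGapSystem.isGap (hab : IsGapSystem a b) (k : Fin n) :
    IsGap (endpoints a b) (.inl k) (.inr k) where
  lt := hab.lt k
  pos x hx := by
    rw [gapCofactor_endpoints]
    simp only [eval_mul, eval_X, eval_prod, eval_sub, eval_C]
    exact mul_pos ((hab.pos k).trans_le hx.1) (prod_pos fun i hi =>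
      hab.pair_pos (ne_of_mem_erase hi) hx)

lemma sqrt_mul_sqrt_of_lt {u v x : ℝ} (huv : u < v) (hx : x < u) :
    Complex.sqrt ((x - u : ℝ) : ℂ) * Complex.sqrt ((x - v : ℝ) : ℂ) = -√((x - u) * (x - v)) := by
  rw [sqrt_ofReal_eq, sqrt_ofReal_eq, sqrt_eq_zero_of_nonpos (by linarith : x - u ≤ 0),
    sqrt_eq_zero_of_nonpos (by linarith : x - v ≤ 0),
    show (x - u) * (x - v) = -(x - u) * -(x - v) by ring, sqrt_mul (by linarith)]
  push_cast
  linear_combination (√(-(x - u)) : ℂ) * √(-(x - v)) * Complex.I_mul_I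

lemma sqrt_mul_sqrt_of_gt {u v x : ℝ} (huv : u < v) (hx : v < x) :
    Complex.sqrt ((x - u : ℝ) : ℂ) * Complex.sqrt ((x - v : ℝ) : ℂ) = √((x - u) * (x - v)) := by
  rw [sqrt_ofReal_eq, sqrt_ofReal_eq, sqrt_eq_zero_of_nonpos (by linarith : -(x - u) ≤ 0),
    sqrt_eq_zero_of_nonpos (by linarith : -(x - v) ≤ 0), sqrt_mul (by linarith)]
  push_cast
  ring

lemma sqrt_mul_sqrt_of_mem {u v x : ℝ} (hx : x ∈ Set.Ioo u v) :
    Complex.sqrt ((x - u : ℝ) : ℂ) * Complex.sqrt ((x - v : ℝ) : ℂ) =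
      Complex.I * √((x - u) * (v - x)) := by
  rw [sqrt_ofReal_eq, sqrt_ofReal_eq, sqrt_eq_zero_of_nonpos (by linarith [hx.1] : -(x - u) ≤ 0),
    sqrt_eq_zero_of_nonpos (by linarith [hx.2] : x - v ≤ 0), sqrt_mul (by linarith [hx.1]), neg_sub]
  push_cast
  ring

lemma prod_ite_neg_one_mul {s : Finset (Fin n)} {p : Fin n → Prop} [DecidablePred p] {w : Fin n → ℝ}
    (hw : ∀ i ∈ s, 0 ≤ w i) :
    ∏ i ∈ s, (((if p i then -1 else 1 : ℝ) : ℂ) * (√(w i) : ℂ)) =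
      (-1) ^ (s.filter p).card * (√(∏ i ∈ s, w i) : ℝ) := by
  rw [prod_mul_distrib]
  congr 1
  · rw [← Complex.ofReal_prod, prod_ite]; simp
  · induction s using Finset.induction_on with
    | empty => simp
    | insert i s hi ih =>
      rw [prod_insert hi, prod_insert hi, sqrt_mul (hw i (mem_insert_self _ _)),
        ih fun j hj => hw j (mem_insert_of_mem hj)]
      push_cast; rfl

/-- A pair of factors from a gap to the right of `x` contributes `i · i = -1`, a pair from the left
contributes `+1`, and the gap containing `x` contributes `i`. The gaps to the right are those of
smaller index, `k` in number. -/
lemma IsGapSystem.rootT_gap (hab : IsGapSystem a b) (k : Fin n) {x : ℝ}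
    (hx : x ∈ Set.Ioo (a k) (b k)) :
    rootT a b (x : ℂ) = Complex.I * (-1) ^ (k : ℕ) * ((√((x - a k) * (b k - x)) *
      √((gapCofactor (endpoints a b) (.inl k) (.inr k)).eval x) : ℝ) : ℂ) := by
  have hx' : x ∈ Set.Icc (a k) (b k) := Ioo_subset_Icc_self hx
  have hx0 : 0 ≤ x := (hab.pos k).le.trans hx'.1
  have h1 : ∀ i ∈ univ.erase k, Complex.sqrt ((x - a i : ℝ) : ℂ) * Complex.sqrt ((x - b i : ℝ) : ℂ)
      = ((if i < k then -1 else 1 : ℝ) : ℂ) * (√((x - a i) * (x - b i)) : ℂ) := by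
    intro i hi
    have hik := ne_of_mem_erase hi
    split_ifs with h
    · rw [sqrt_mul_sqrt_of_lt (hab.lt i) (by linarith [hab.sep i k h, hx.2])]; push_cast; ring
    · have h' : k < i := lt_of_le_of_ne (not_lt.1 h) hik.symm
      rw [sqrt_mul_sqrt_of_gt (hab.lt i) (by linarith [hab.sep k i h', hx.1])]; push_cast; ring
  have hcard : ((univ.erase k).filter (· < k)).card = (k : ℕ) := by
    rw [← Fin.card_Iio k]; congr 1; ext i; simp only [mem_filter, mem_erase, Finset.mem_univ,
      Finset.mem_Iio]
    exact ⟨fun h => h.2, fun h => ⟨⟨h.ne, trivial⟩, h⟩⟩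
  rw [rootT_ofReal, ← mul_prod_erase univ _ (mem_univ k), prod_congr rfl h1,
    prod_ite_neg_one_mul fun i hi => (hab.pair_pos (ne_of_mem_erase hi) hx').le, hcard,
    sqrt_mul_sqrt_of_mem hx, gapCofactor_endpoints, sqrt_ofReal_eq,
    sqrt_eq_zero_of_nonpos (neg_nonpos.2 hx0)]
  simp only [eval_mul, eval_X, eval_prod, eval_sub, eval_C]
  rw [sqrt_mul hx0]
  push_cast
  ring

lemma IsGapSystem.rootT_band (hab : IsGapSystem a b) {x : ℝ} (hx0 : 0 ≤ x)
    (hx : ∀ i, x < a i ∨ b i < x) :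
    rootT a b (x : ℂ) = (-1) ^ (univ.filter fun i => x < a i).card *
      (√((curvePoly a b).eval x) : ℝ) := by
  have h1 : ∀ i ∈ Finset.univ, Complex.sqrt ((x - a i : ℝ) : ℂ) * Complex.sqrt ((x - b i : ℝ) : ℂ)
      = ((if x < a i then -1 else 1 : ℝ) : ℂ) * (√((x - a i) * (x - b i)) : ℂ) := by
    intro i _
    split_ifs with h
    · rw [sqrt_mul_sqrt_of_lt (hab.lt i) h]; push_cast; ring
    · rw [sqrt_mul_sqrt_of_gt (hab.lt i) ((hx i).resolve_left h)]; push_cast; ring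
  have h2 : ∀ i ∈ Finset.univ, 0 ≤ (x - a i) * (x - b i) := by
    intro i _
    rcases hx i with h | h
    · exact mul_nonneg_of_nonpos_of_nonpos (by linarith) (by linarith [hab.lt i])
    · exact mul_nonneg (by linarith [hab.lt i]) (by linarith)
  rw [rootT_ofReal, prod_congr rfl h1, prod_ite_neg_one_mul h2, eval_curvePoly, sqrt_mul hx0,
    sqrt_ofReal_eq, sqrt_eq_zero_of_nonpos (neg_nonpos.2 hx0)]
  push_cast
  ring

lemma IsGapSystem.curvePoly_pos_band (hab : IsGapSystem a b) {x : ℝ} (hx0 : 0 < x)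
    (hx : ∀ i, x < a i ∨ b i < x) : 0 < (curvePoly a b).eval x := by
  rw [eval_curvePoly]
  refine mul_pos hx0 (prod_pos fun i _ => ?_)
  rcases hx i with h | h
  · exact mul_pos_of_neg_of_neg (by linarith) (by linarith [hab.lt i])
  · exact mul_pos (by linarith [hab.lt i]) (by linarith)

/-- The functional `R ↦ ∫ R / √|T|` over the `k`-th gap. -/
noncomputable def IsGapSystem.gapFun (hab : IsGapSystem a b) (k : Fin n) : ℝ[X] →ₗ[ℝ] ℝ :=
  gapLin (hab.isGap k)

lemma IsGapSystem.abelInt_gap (hab : IsGapSystem a b) (R : ℝ[X]) (k : Fin n) :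
    abelInt a b R (a k) (b k) = -Complex.I * (-1) ^ (k : ℕ) * (hab.gapFun k R : ℝ) := by
  set m := gapCofactor (endpoints a b) (.inl k) (.inr k)
  have h1 : ∫ x in a k..b k, (R.eval x / √(m.eval x)) / √((x - a k) * (b k - x)) = hab.gapFun k R :=
    integral_div_sqrt_eq_arcInt (hab.lt k) _
  rw [← h1, ← intervalIntegral.integral_ofReal, abelInt, ← intervalIntegral.integral_const_mul,
    intervalIntegral.integral_of_le (hab.lt k).le, intervalIntegral.integral_of_le (hab.lt k).le,
    integral_Ioc_eq_integral_Ioo, integral_Ioc_eq_integral_Ioo]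
  refine setIntegral_congr_fun measurableSet_Ioo fun x hx => ?_
  rw [hab.rootT_gap k hx]
  have hi : (Complex.I * (-1) ^ (k : ℕ))⁻¹ = -Complex.I * (-1) ^ (k : ℕ) := by
    rw [mul_inv, Complex.inv_I, ← inv_pow]; norm_num
  rw [div_eq_mul_inv, mul_inv, hi]
  push_cast
  field_simp
  rfl

lemma IsGapSystem.bPeriod_eq (hab : IsGapSystem a b) (R : ℝ[X]) (k : Fin n) :
    bPeriod a b R k = -2 * Complex.I * (-1) ^ (k : ℕ) * (hab.gapFun k R : ℝ) := by
  rw [bPeriod, hab.abelInt_gap]; ring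

end RootT


/-! ### Cauchy transform of the gap weight -/

section Resolvent

open Real Set Filter Topology MeasureTheory

variable {ι : Type*} [Fintype ι] [DecidableEq ι] {e : ι → ℝ} {s s' : ι}

lemma IsGap.hasDerivAt_gapInt_pow (h : IsGap e s s') (p : ℕ) {z : ℝ} (hz : z ∉ Icc (e s) (e s')) :
    HasDerivAt (fun z => gapInt e s s' fun y => 1 / (z - y) ^ p)
      (-p * gapInt e s s' fun y => 1 / (z - y) ^ (p + 1)) z := by
  set m := gapCofactor e s s' with hm
  set x := arcPoint (e s) (e s') with hx
  have hmem : ∀ θ, x θ ∈ Icc (e s) (e s') := arcPoint_mem_Icc h.lt.le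
  have hpos : ∀ θ, 0 < m.eval (x θ) := fun θ => h.pos _ (hmem θ)
  have hU : IsOpen (Icc (e s) (e s'))ᶜ := isClosed_Icc.isOpen_compl
  have hne : ∀ w ∈ (Icc (e s) (e s'))ᶜ, ∀ θ, w - x θ ≠ 0 := fun w hw θ h0 => hw (by
    rw [sub_eq_zero.1 h0]; exact hmem θ)
  set F : ℝ → ℝ → ℝ := fun w θ => 1 / (w - x θ) ^ p / √(m.eval (x θ)) with hF
  have hcd : ∀ w ∈ (Icc (e s) (e s'))ᶜ, ∀ t ∈ Icc 0 π,
      ContDiffAt ℝ 1 (fun q : ℝ × ℝ => F q.1 q.2) (w, t) := by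
    intro w hw t _
    have hxc : ContDiff ℝ 1 fun q : ℝ × ℝ => x q.2 := by
      simp only [hx]; unfold arcPoint; fun_prop
    have hmc : ContDiff ℝ 1 fun q : ℝ × ℝ => m.eval (x q.2) := by
      have : ContDiff ℝ 1 fun x : ℝ => m.eval x := by
        simpa using m.contDiff_aeval (𝕜 := ℝ) 1
      exact this.comp hxc
    exact (contDiffAt_const.div ((contDiffAt_fst.sub hxc.contDiffAt).pow p)
      (pow_ne_zero p (hne w hw t))).div (hmc.contDiffAt.sqrt (hpos t).ne') (sqrt_pos.2 (hpos t)).ne'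
  obtain ⟨hdiff, hint, hstrict⟩ := hasStrictFDerivAt_intervalIntegral hU hz pi_pos.le hcd
  have h1 := hstrict.hasFDerivAt.hasDerivAt
  rw [ContinuousLinearMap.intervalIntegral_apply hint] at h1
  refine h1.congr_deriv ?_
  rw [← gapInt_const_mul, gapInt, arcInt]
  refine intervalIntegral.integral_congr fun θ hθ => ?_
  rw [uIcc_of_le pi_pos.le] at hθ
  have h2 : HasDerivAt (fun w => F w θ)
      (-p * (1 / (z - x θ) ^ (p + 1)) / √(m.eval (x θ))) z := by
    have h0 := hne z hz θ
    have h3 : HasDerivAt (fun w : ℝ => (w - x θ) ^ p) (p * (z - x θ) ^ (p - 1) * 1) z :=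
      ((hasDerivAt_id z).sub_const (x θ)).pow p
    have h4 := ((hasDerivAt_const z (1 : ℝ)).div h3 (pow_ne_zero p h0)).div_const
      (√(m.eval (x θ)))
    refine h4.congr_deriv ?_
    congr 1
    rcases p with _ | p
    · simp
    · simp only [Nat.add_sub_cancel]
      field_simp
      ring
  exact (hdiff θ hθ).hasFDerivAt.hasDerivAt.unique h2

/-- The Cauchy transform of the weight `1 / √|T|` on a gap. -/
noncomputable def resolvent (e : ι → ℝ) (s s' : ι) (z : ℝ) : ℝ :=
  gapInt e s s' fun y => 1 / (z - y)

lemma IsGap.hasDerivAt_resolvent (h : IsGap e s s') {z : ℝ} (hz : z ∉ Icc (e s) (e s')) :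
    HasDerivAt (resolvent e s s') (-gapInt e s s' fun y => 1 / (z - y) ^ 2) z := by
  have := h.hasDerivAt_gapInt_pow 1 hz
  change HasDerivAt (fun z => gapInt e s s' fun y => 1 / (z - y)) _ z
  simpa using this

/-- In the two-part splitting of the kernel, the `y`-exact part integrates to zero over the gap. The
`z`-exact part survives and says that `dualPoly / √T` has primitive `√T` times the resolvent. -/
lemma IsGap.eval_dualPoly (h : IsGap e s s') {z : ℝ} (hz : z ∉ Icc (e s) (e s')) :
    (dualPoly (branchPoly e) (gapLin h)).eval z =
      (branchPoly e).eval z * (-gapInt e s s' fun y => 1 / (z - y) ^ 2) +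
        (branchPoly e).derivative.eval z / 2 * resolvent e s s' z := by
  have hne : ∀ y ∈ Icc (e s) (e s'), z - y ≠ 0 := fun y hy h0 => hz (by
    rw [sub_eq_zero.1 h0]; exact hy)
  have hd : ∀ y ∈ Icc (e s) (e s'), HasDerivAt (fun y => 1 / (z - y)) (1 / (z - y) ^ 2) y := by
    intro y hy
    have : HasDerivAt (fun y => (z - y)⁻¹) (-(-1) / (z - y) ^ 2) y :=
      ((hasDerivAt_id y).const_sub z).inv (hne y hy)
    simpa [one_div] using this
  have c1 : ContinuousOn (fun y => 1 / (z - y)) (Icc (e s) (e s')) :=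
    continuousOn_const.div (by fun_prop) hne
  have c2 : ContinuousOn (fun y => 1 / (z - y) ^ 2) (Icc (e s) (e s')) :=
    continuousOn_const.div (by fun_prop) fun y hy => pow_ne_zero 2 (hne y hy)
  have h1 := h.gapInt_exact' hd c2
  rw [KdVGaps.eval_dualPoly, gapLin_apply, resolvent]
  rw [show ∀ u v w : ℝ, (branchPoly e).eval z * -u + v / 2 * w = (-(branchPoly e).eval z) * u + v / 2 * w by intros; ring]
  rw [← gapInt_const_mul, ← gapInt_const_mul, ← h.gapInt_add (by fun_prop) (by fun_prop)]
  symm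
  rw [← add_zero (gapInt e s s' _), ← h1, ← h.gapInt_add (by fun_prop) (by fun_prop)]
  refine h.gapInt_congr fun y hy => ?_
  have hzy := hne y hy
  have k1 : (kernelPoly (branchPoly e) z).eval y = (((branchPoly e).derivative.eval z + (branchPoly e).derivative.eval y) * (z - y) / 2
      - (branchPoly e).eval z + (branchPoly e).eval y) / (z - y) ^ 2 := by
    rw [eq_div_iff (pow_ne_zero 2 hzy), eval_kernelPoly_mul_sq]
  rw [k1]
  field_simp
  ring

lemma IsGap.gapLin_derivative_branchPoly (h : IsGap e s s') :
    gapLin h (branchPoly e).derivative = 0 := by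
  have := h.gapInt_exact' (f := fun _ => 2) (f' := fun _ => 0) (fun x _ => hasDerivAt_const x 2)
    continuousOn_const
  rw [gapLin_apply, ← this]
  exact h.gapInt_congr fun y _ => by ring

/-- The resolvent is smooth on every other gap, so there the differential is exact in the sense of
`gapInt_exact'`. -/
lemma IsGap.gapLin_dualPoly_of_disjoint {u u' : ι} (h : IsGap e s s') (h' : IsGap e u u')
    (hd : ∀ x ∈ Icc (e u) (e u'), x ∉ Icc (e s) (e s')) :
    gapLin h' (dualPoly (branchPoly e) (gapLin h)) = 0 := by
  rw [← h'.gapInt_exact' (fun x hx => h.hasDerivAt_resolvent (hd x hx)) ?_, gapLin_apply]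
  · exact h'.gapInt_congr fun x hx => h.eval_dualPoly (hd x hx)
  · exact fun x hx => (h.hasDerivAt_gapInt_pow 2 (hd x hx)).continuousAt.neg.continuousWithinAt

/-- On its own gap the resolvent is singular, but antisymmetry makes the value equal to its own
negative. -/
lemma gapLin_dualPoly_self (h : IsGap e s s') (T : ℝ[X]) :
    gapLin h (dualPoly T (gapLin h)) = 0 := by
  have := apply_dualPoly T (gapLin h) (gapLin h)
  linarith

lemma IsGap.exists_lipschitz (h : IsGap e s s') : ∃ C : ℝ, ∀ x ∈ Icc (e s) (e s'),
    ∀ y ∈ Icc (e s) (e s'), |1 / √((gapCofactor e s s').eval y) - 1 / √((gapCofactor e s s').eval x)|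
      ≤ C * |y - x| := by
  set m := gapCofactor e s s' with hm
  have hd : ∀ x ∈ Icc (e s) (e s'), HasDerivAt (fun y => 1 / √(m.eval y))
      ((0 * √(m.eval x) - 1 * (m.derivative.eval x / (2 * √(m.eval x)))) / √(m.eval x) ^ 2) x :=
    fun x hx => (hasDerivAt_const x (1 : ℝ)).div ((m.hasDerivAt x).sqrt (h.pos x hx).ne')
      (sqrt_pos.2 (h.pos x hx)).ne'
  have hs : ∀ x ∈ Icc (e s) (e s'), √(m.eval x) ≠ 0 := fun x hx => (sqrt_pos.2 (h.pos x hx)).ne'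
  have hc : ContinuousOn (fun x => (0 * √(m.eval x) - 1 * (m.derivative.eval x / (2 * √(m.eval x))))
      / √(m.eval x) ^ 2) (Icc (e s) (e s')) := by
    have c1 : ContinuousOn (fun x => √(m.eval x)) (Icc (e s) (e s')) := by fun_prop
    refine ContinuousOn.div ?_ (c1.pow 2) fun x hx => pow_ne_zero 2 (hs x hx)
    exact (continuousOn_const.mul c1).sub (continuousOn_const.mul (m.derivative.continuousOn.div
      (continuousOn_const.mul c1) fun x hx => mul_ne_zero two_ne_zero (hs x hx)))
  obtain ⟨C, hC⟩ := isCompact_Icc.exists_bound_of_continuousOn hc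
  exact ⟨C, fun x hx y hy => (convex_Icc _ _).norm_image_sub_le_of_norm_hasDerivWithin_le
    (fun z hz => (hd z hz).hasDerivWithinAt) hC hx hy⟩

/-- The resolvent has an inverse square root singularity that exactly cancels the zero of `√|T|`;
the factor `1 / √m` in the weight makes the limit independent of the cofactor. -/
lemma IsGap.tendsto_left (h : IsGap e s s') :
    Tendsto (fun z => √((gapCofactor e s s').eval z) * √((e s - z) * (e s' - z)) * resolvent e s s' z)
      (𝓝[<] (e s)) (𝓝 (-π)) := by
  set m := gapCofactor e s s' with hm
  obtain ⟨C, hC⟩ := h.exists_lipschitz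
  have hα : e s ∈ Icc (e s) (e s') := ⟨le_rfl, h.lt.le⟩
  have h1 := tendsto_sqrt_mul_arcInt_left h.lt h.continuousOn fun y hy => by
    have := hC (e s) hα y hy
    rwa [abs_of_nonneg (sub_nonneg.2 hy.1)] at this
  have h2 : Tendsto (fun z => √(m.eval z)) (𝓝[<] (e s)) (𝓝 (√(m.eval (e s)))) := by
    have : Continuous fun z => √(m.eval z) := by fun_prop
    exact (this.tendsto _).mono_left nhdsWithin_le_nhds
  have h3 := (h2.mul h1).neg
  have h4 : √(m.eval (e s)) ≠ 0 := (sqrt_pos.2 (h.pos _ hα)).ne'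
  rw [show -(√(m.eval (e s)) * (π * (1 / √(m.eval (e s))))) = -π by
    field_simp] at h3
  refine h3.congr fun z => ?_
  rw [← mul_neg, ← mul_neg, ← mul_assoc, resolvent, gapInt]
  congr 1
  rw [← neg_one_mul, ← arcInt_const_mul]
  congr 1
  funext y
  rw [show y - z = -(z - y) by ring, div_neg, neg_one_mul, neg_neg, div_right_comm]

lemma IsGap.tendsto_right (h : IsGap e s s') :
    Tendsto (fun z => √((gapCofactor e s s').eval z) * √((z - e s) * (z - e s')) * resolvent e s s' z)
      (𝓝[>] (e s')) (𝓝 π) := by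
  set m := gapCofactor e s s' with hm
  obtain ⟨C, hC⟩ := h.exists_lipschitz
  have hβ : e s' ∈ Icc (e s) (e s') := ⟨h.lt.le, le_rfl⟩
  have h1 := tendsto_sqrt_mul_arcInt_right h.lt h.continuousOn fun y hy => by
    have := hC (e s') hβ y hy
    rwa [abs_sub_comm y, abs_of_nonneg (sub_nonneg.2 hy.2)] at this
  have h2 : Tendsto (fun z => √(m.eval z)) (𝓝[>] (e s')) (𝓝 (√(m.eval (e s')))) := by
    have : Continuous fun z => √(m.eval z) := by fun_prop
    exact (this.tendsto _).mono_left nhdsWithin_le_nhds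
  have h3 := h2.mul h1
  have h4 : √(m.eval (e s')) ≠ 0 := (sqrt_pos.2 (h.pos _ hβ)).ne'
  rw [show √(m.eval (e s')) * (π * (1 / √(m.eval (e s')))) = π by
    field_simp] at h3
  refine h3.congr fun z => ?_
  rw [← mul_assoc, resolvent, gapInt]
  congr 2
  funext y
  rw [div_right_comm]

end Resolvent

/-! ### Periods of the dual differentials -/

section Periods

open Real Set Filter Topology MeasureTheory

variable {n : ℕ} {a b : Fin n → ℝ}

lemma IsGapSystem.abelInt_add (hab : IsGapSystem a b) (R : ℝ[X]) (x y z : ℝ) :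
    abelInt a b R x y + abelInt a b R y z = abelInt a b R x z :=
  intervalIntegral.integral_add_adjacent_intervals (hab.intervalIntegrable R x y)
    (hab.intervalIntegrable R y z)

lemma curvePoly_ne_zero (a b : Fin n → ℝ) : curvePoly a b ≠ 0 :=
  mul_ne_zero X_ne_zero (Finset.prod_ne_zero_iff.2 fun _ _ =>
    mul_ne_zero (X_sub_C_ne_zero _) (X_sub_C_ne_zero _))

lemma countable_zeros (a b : Fin n → ℝ) : {z : ℝ | (curvePoly a b).eval z = 0}.Countable := by
  have : {z : ℝ | (curvePoly a b).eval z = 0} ⊆ ↑((curvePoly a b).roots.toFinset) := fun z hz => by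
    simpa [curvePoly_ne_zero] using hz
  exact ((curvePoly a b).roots.toFinset.countable_toSet).mono this

lemma IsGapSystem.abelInt_derivative_curvePoly (hab : IsGapSystem a b) {x y : ℝ} (hxy : x ≤ y) :
    abelInt a b (curvePoly a b).derivative x y = 2 * rootT a b (y : ℂ) - 2 * rootT a b (x : ℂ) := by
  refine integral_eq_of_hasDerivAt_off_countable_of_le (fun t : ℝ => 2 * rootT a b (t : ℂ)) _ hxy
    (countable_zeros a b) (continuous_const.mul (continuous_rootT a b)).continuousOn ?_
    (hab.intervalIntegrable _ _ _)
  intro z hz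
  refine ((hasDerivAt_rootT hz.2).const_mul 2).congr_deriv ?_
  have := rootT_ne_zero hz.2
  field_simp

/-- The polynomial of the second kind differential with the primitive `√T` times the resolvent of
the `k`-th gap. -/
noncomputable def IsGapSystem.gapDual (hab : IsGapSystem a b) (k : Fin n) : ℝ[X] :=
  dualPoly (curvePoly a b) (hab.gapFun k)

/-- The primitive of the differential `gapDual k dz / √T` outside the gap. -/
noncomputable def gapPrimitive (a b : Fin n → ℝ) (k : Fin n) (z : ℝ) : ℂ :=
  rootT a b (z : ℂ) * (resolvent (endpoints a b) (.inl k) (.inr k) z : ℝ)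

lemma IsGapSystem.hasDerivAt_gapPrimitive (hab : IsGapSystem a b) (k : Fin n) {z : ℝ}
    (hz : z ∉ Icc (a k) (b k)) (hT : (curvePoly a b).eval z ≠ 0) :
    HasDerivAt (gapPrimitive a b k)
      ((((hab.gapDual k).eval z : ℝ) : ℂ) / rootT a b (z : ℂ)) z := by
  have h1 := ((hab.isGap k).hasDerivAt_resolvent hz).ofReal_comp
  refine ((hasDerivAt_rootT hT).mul h1).congr_deriv ?_
  have h2 := (hab.isGap k).eval_dualPoly hz
  rw [← curvePoly_eq_branchPoly] at h2
  rw [gapDual, gapFun, h2]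
  have hr := rootT_ne_zero hT
  have h3 := rootT_sq a b z
  rw [eq_div_iff hr]
  push_cast
  rw [← h3]
  field_simp
  ring

lemma IsGapSystem.continuousAt_gapPrimitive (hab : IsGapSystem a b) (k : Fin n) {z : ℝ}
    (hz : z ∉ Icc (a k) (b k)) : ContinuousAt (gapPrimitive a b k) z :=
  (continuous_rootT a b).continuousAt.mul
    (Complex.continuous_ofReal.continuousAt.comp ((hab.isGap k).hasDerivAt_resolvent hz).continuousAt)

/-- The primitive is allowed to differ from `gapPrimitive` at the ends: at an end of the gap `k` the
vanishing root gives the product the value zero, which is not its one-sided limit from outside. -/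
lemma IsGapSystem.abelInt_gapDual (hab : IsGapSystem a b) (k : Fin n) {x y : ℝ} (hxy : x ≤ y)
    (hd : ∀ z ∈ Ioo x y, z ∉ Icc (a k) (b k)) {Ψ : ℝ → ℂ} (hΨ : ContinuousOn Ψ (Icc x y))
    (heq : ∀ z ∈ Ioo x y, Ψ z = gapPrimitive a b k z) :
    abelInt a b (hab.gapDual k) x y = Ψ y - Ψ x := by
  refine integral_eq_of_hasDerivAt_off_countable_of_le Ψ _ hxy (countable_zeros a b) hΨ ?_
    (hab.intervalIntegrable _ _ _)
  intro z hz
  refine (hab.hasDerivAt_gapPrimitive k (hd z hz.1) hz.2).congr_of_eventuallyEq ?_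
  filter_upwards [Ioo_mem_nhds hz.1.1 hz.1.2] with w hw using heq w hw

lemma gapPrimitive_eq_zero (k : Fin n) {z : ℝ} (hz : (curvePoly a b).eval z = 0) :
    gapPrimitive a b k z = 0 := by
  rw [gapPrimitive, rootT_eq_zero hz, zero_mul]

lemma eval_curvePoly_a (a b : Fin n → ℝ) (k : Fin n) : (curvePoly a b).eval (a k) = 0 := by
  rw [eval_curvePoly, Finset.prod_eq_zero (Finset.mem_univ k) (by simp), mul_zero]

lemma eval_curvePoly_zero (a b : Fin n → ℝ) : (curvePoly a b).eval 0 = 0 := by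
  rw [eval_curvePoly, zero_mul]

lemma eval_curvePoly_eq_gapCofactor (a b : Fin n → ℝ) (k : Fin n) (z : ℝ) : (curvePoly a b).eval z =
    (z - a k) * (z - b k) * (gapCofactor (endpoints a b) (.inl k) (.inr k)).eval z := by
  rw [curvePoly_eq_branchPoly, branchPoly_eq (s := Sum.inl k) (s' := Sum.inr k) (by simp)]
  simp [endpoints]

lemma card_filter_le (k : Fin n) : (Finset.univ.filter fun i : Fin n => i ≤ k).card = k + 1 := by
  rw [← Fin.card_Iic k]; congr 1; ext i; simp

lemma card_filter_lt (k : Fin n) : (Finset.univ.filter fun i : Fin n => i < k).card = k := by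
  rw [← Fin.card_Iio k]; congr 1; ext i; simp

lemma IsGapSystem.tendsto_gapPrimitive_left (hab : IsGapSystem a b) (k : Fin n) :
    Tendsto (gapPrimitive a b k) (𝓝[<] (a k)) (𝓝 ((-1) ^ (k : ℕ) * (π : ℂ))) := by
  have h1 := (Complex.continuous_ofReal.tendsto _).comp (hab.isGap k).tendsto_left
  -- Just left of `a_k` the gaps to the right are those with index at most `k`, hence `k + 1` signs;
  -- the extra one cancels the sign of `-π`.
  have h2 := h1.const_mul ((-1 : ℂ) ^ ((k : ℕ) + 1))
  have e1 : (-1 : ℂ) ^ ((k : ℕ) + 1) * ((-π : ℝ) : ℂ) = (-1) ^ (k : ℕ) * (π : ℂ) := by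
    push_cast; ring
  rw [e1] at h2
  refine h2.congr' ?_
  have hev : ∀ᶠ z in 𝓝[<] (a k), ∀ i, k < i → b i < z := by
    refine (Filter.eventually_all (ι := Fin n)).2 fun i => ?_
    by_cases hki : k < i
    · filter_upwards [mem_nhdsWithin_of_mem_nhds (Ioi_mem_nhds (hab.sep k i hki))] with z hz _ using hz
    · exact Eventually.of_forall fun z hz => absurd hz hki
  filter_upwards [hev, self_mem_nhdsWithin,
    mem_nhdsWithin_of_mem_nhds (Ioi_mem_nhds (hab.pos k))] with z hz hzk hz0
  have hzk : z < a k := hzk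
  have hz0 : 0 < z := hz0
  have hlt : ∀ i, i ≤ k → z < a i := fun i hi => by
    rcases hi.lt_or_eq with h | h
    · exact hzk.trans (hab.a_lt_a h)
    · rw [h]; exact hzk
  have hband : ∀ i, z < a i ∨ b i < z := fun i => by
    rcases le_or_gt i k with h | h
    · exact Or.inl (hlt i h)
    · exact Or.inr (hz i h)
  have hfilt : (Finset.univ.filter fun i => z < a i) = Finset.univ.filter fun i => i ≤ k := by
    ext i
    simp only [Finset.mem_filter, Finset.mem_univ, true_and]
    refine ⟨fun h => ?_, hlt i⟩
    by_contra hik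
    have := hz i (not_le.1 hik)
    linarith [hab.lt i]
  rw [gapPrimitive, hab.rootT_band hz0.le hband, hfilt, card_filter_le,
    eval_curvePoly_eq_gapCofactor a b k,
    show (z - a k) * (z - b k) = (a k - z) * (b k - z) by ring,
    sqrt_mul (mul_nonneg (by linarith) (by linarith [hab.lt k]))]
  simp only [Function.comp, endpoints, Sum.elim_inl, Sum.elim_inr]
  push_cast
  ring

lemma IsGapSystem.tendsto_gapPrimitive_right (hab : IsGapSystem a b) (k : Fin n) :
    Tendsto (gapPrimitive a b k) (𝓝[>] (b k)) (𝓝 ((-1) ^ (k : ℕ) * (π : ℂ))) := by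
  have h1 := (Complex.continuous_ofReal.tendsto _).comp (hab.isGap k).tendsto_right
  refine (h1.const_mul ((-1 : ℂ) ^ (k : ℕ))).congr' ?_
  have hev : ∀ᶠ z in 𝓝[>] (b k), ∀ i, i < k → z < a i := by
    refine (Filter.eventually_all (ι := Fin n)).2 fun i => ?_
    by_cases hki : i < k
    · filter_upwards [mem_nhdsWithin_of_mem_nhds (Iio_mem_nhds (hab.sep i k hki))] with z hz _ using hz
    · exact Eventually.of_forall fun z hz => absurd hz hki
  filter_upwards [hev, self_mem_nhdsWithin] with z hz hzk
  have hzk : b k < z := hzk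
  have hz0 : 0 < z := (hab.b_pos k).trans hzk
  have hgt : ∀ i, k ≤ i → b i < z := fun i hi => by
    rcases hi.lt_or_eq with h | h
    · linarith [hab.sep k i h, hab.lt k]
    · rw [← h]; exact hzk
  have hband : ∀ i, z < a i ∨ b i < z := fun i => by
    rcases le_or_gt k i with h | h
    · exact Or.inr (hgt i h)
    · exact Or.inl (hz i h)
  have hfilt : (Finset.univ.filter fun i => z < a i) = Finset.univ.filter fun i => i < k := by
    ext i
    simp only [Finset.mem_filter, Finset.mem_univ, true_and]
    refine ⟨fun h => ?_, hz i⟩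
    by_contra hik
    have := hgt i (not_lt.1 hik)
    linarith [hab.lt i]
  rw [gapPrimitive, hab.rootT_band hz0.le hband, hfilt, card_filter_lt,
    eval_curvePoly_eq_gapCofactor a b k,
    sqrt_mul (mul_nonneg (by linarith [hab.lt k]) (by linarith))]
  simp only [Function.comp, endpoints, Sum.elim_inl, Sum.elim_inr]
  push_cast
  ring

lemma IsGapSystem.gapFun_gapDual (hab : IsGapSystem a b) (j k : Fin n) :
    hab.gapFun j (hab.gapDual k) = 0 := by
  rcases eq_or_ne j k with rfl | hjk
  · exact gapLin_dualPoly_self _ _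
  · rw [gapDual, curvePoly_eq_branchPoly]
    refine (hab.isGap k).gapLin_dualPoly_of_disjoint (hab.isGap j) fun x hx hx' => ?_
    have h1 := hab.pair_pos hjk.symm (k := j) hx
    have hx' : x ∈ Icc (a k) (b k) := hx'
    nlinarith [hx'.1, hx'.2, mul_nonneg (sub_nonneg.2 hx'.1) (sub_nonneg.2 hx'.2)]

lemma IsGapSystem.abelInt_gapDual_left (hab : IsGapSystem a b) (k : Fin n) :
    abelInt a b (hab.gapDual k) 0 (a k) = (-1) ^ (k : ℕ) * (π : ℂ) := by
  have h0 := (hab.pos k).ne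
  rw [hab.abelInt_gapDual k (hab.pos k).le (fun z hz hz' => absurd hz.2 (not_lt.2 hz'.1))
    (Ψ := Function.update (gapPrimitive a b k) (a k) ((-1) ^ (k : ℕ) * (π : ℂ))),
    Function.update_self, Function.update_of_ne h0, gapPrimitive_eq_zero k (eval_curvePoly_zero a b),
    sub_zero]
  · rw [continuousOn_update_iff, Icc_sdiff_right]
    refine ⟨fun z hz => (hab.continuousAt_gapPrimitive k fun hz' =>
      absurd hz.2 (not_lt.2 hz'.1)).continuousWithinAt, fun _ => ?_⟩
    exact (hab.tendsto_gapPrimitive_left k).mono_left (nhdsWithin_mono _ Ico_subset_Iio_self)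
  · exact fun z hz => Function.update_of_ne hz.2.ne _ _

lemma IsGapSystem.abelInt_gapDual_right (hab : IsGapSystem a b) {j k : Fin n} (hjk : j < k) :
    abelInt a b (hab.gapDual k) (b k) (a j) = -((-1) ^ (k : ℕ) * (π : ℂ)) := by
  have hlt := hab.sep j k hjk
  rw [hab.abelInt_gapDual k hlt.le (fun z hz hz' => absurd hz.1 (not_lt.2 hz'.2))
    (Ψ := Function.update (gapPrimitive a b k) (b k) ((-1) ^ (k : ℕ) * (π : ℂ))),
    Function.update_self, Function.update_of_ne hlt.ne',
    gapPrimitive_eq_zero k (eval_curvePoly_a a b j), zero_sub]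
  · rw [continuousOn_update_iff, Icc_sdiff_left]
    refine ⟨fun z hz => (hab.continuousAt_gapPrimitive k fun hz' =>
      absurd hz.1 (not_lt.2 hz'.2)).continuousWithinAt, fun _ => ?_⟩
    exact (hab.tendsto_gapPrimitive_right k).mono_left (nhdsWithin_mono _ Ioc_subset_Ioi_self)
  · exact fun z hz => Function.update_of_ne hz.1.ne' _ _

/-- If `a_j` lies beyond the gap `k`, the path collects `(-1)^k π` before that gap, nothing across
it, and `-(-1)^k π` after it. If `a_j` lies before the gap, the primitive is continuous along the
path and vanishes at both ends. -/
lemma IsGapSystem.abelInt_gapDual_eq (hab : IsGapSystem a b) (k j : Fin n) :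
    abelInt a b (hab.gapDual k) 0 (a j) = if k = j then (-1) ^ (k : ℕ) * (π : ℂ) else 0 := by
  rcases lt_trichotomy j k with h | rfl | h
  · rw [if_neg h.ne', ← hab.abelInt_add _ 0 (a k) (a j), ← hab.abelInt_add _ (a k) (b k) (a j),
      hab.abelInt_gapDual_left, hab.abelInt_gapDual_right h, hab.abelInt_gap, hab.gapFun_gapDual]
    simp
  · rw [if_pos rfl, hab.abelInt_gapDual_left]
  · have hlt := hab.a_lt_a h
    rw [if_neg h.ne, hab.abelInt_gapDual k (hab.pos j).le
      (fun z hz hz' => absurd (hz.2.trans hlt) (not_lt.2 hz'.1)) (Ψ := gapPrimitive a b k)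
      (fun z hz => (hab.continuousAt_gapPrimitive k fun hz' =>
        absurd (hz.2.trans_lt hlt) (not_lt.2 hz'.1)).continuousWithinAt) (fun z _ => rfl),
      gapPrimitive_eq_zero k (eval_curvePoly_a a b j),
      gapPrimitive_eq_zero k (eval_curvePoly_zero a b), sub_zero]

end Periods


/-! ### Existence and uniqueness of the normalized polynomials -/

section Uniqueness

open Real Set Filter Topology MeasureTheory

variable {n : ℕ} {a b : Fin n → ℝ}

lemma pos_or_neg_of_forall_ne_zero {f : ℝ → ℝ} {s : Set ℝ} (hs : IsPreconnected s)
    (hf : ContinuousOn f s) (h0 : ∀ x ∈ s, f x ≠ 0) :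
    (∀ x ∈ s, 0 < f x) ∨ (∀ x ∈ s, f x < 0) := by
  by_contra hcon
  push Not at hcon
  obtain ⟨⟨x, hx, hfx⟩, ⟨y, hy, hfy⟩⟩ := hcon
  obtain ⟨z, hz, hfz⟩ := hs.intermediate_value hx hy hf ⟨hfx, hfy⟩
  exact h0 z hz hfz

lemma exists_mem_Ioo_eval_ne_zero {w : ℝ[X]} (hw : w ≠ 0) {c d : ℝ} (hcd : c < d) :
    ∃ x ∈ Ioo c d, w.eval x ≠ 0 := by
  by_contra hcon
  push Not at hcon
  exact hw (eq_zero_of_infinite_isRoot w ((Ioo_infinite hcd).mono hcon))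

lemma IsGap.gapInt_pos {ι : Type*} [Fintype ι] [DecidableEq ι] {e : ι → ℝ} {s s' : ι}
    (h : IsGap e s s') {w F : ℝ[X]} (hw0 : w ≠ 0) (hw : ∀ x ∈ Icc (e s) (e s'), 0 ≤ w.eval x)
    (hF : ∀ x ∈ Ioo (e s) (e s'), 0 < F.eval x) : 0 < gapLin h (w * F) := by
  have hF' : ∀ x ∈ Icc (e s) (e s'), 0 ≤ F.eval x := by
    intro x hx
    rw [← closure_Ioo h.lt.ne] at hx
    have hcl : IsClosed {x : ℝ | 0 ≤ F.eval x} := isClosed_Ici.preimage F.continuous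
    exact closure_minimal (fun y hy => (hF y hy).le) hcl hx
  obtain ⟨x, hx, hwx⟩ := exists_mem_Ioo_eval_ne_zero hw0 h.lt
  obtain ⟨θ, hθ, rfl⟩ : x ∈ arcPoint (e s) (e s') '' Ioo 0 π := by rwa [image_arcPoint h.lt]
  refine intervalIntegral.integral_pos pi_pos
    (continuous_comp_arcPoint h.lt.le (h.continuousOn_div (w * F).continuousOn)).continuousOn
    (fun t _ => ?_) ⟨θ, Ioo_subset_Icc_self hθ, ?_⟩
  · have hm := arcPoint_mem_Icc h.lt.le t
    simp only [eval_mul]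
    exact div_nonneg (mul_nonneg (hw _ hm) (hF' _ hm)) (sqrt_nonneg _)
  · simp only [eval_mul]
    exact div_pos (mul_pos (lt_of_le_of_ne (hw _ (Ioo_subset_Icc_self hx)) hwx.symm) (hF _ hx))
      (sqrt_pos.2 (h.pos _ (Ioo_subset_Icc_self hx)))

lemma IsGapSystem.exists_root_gap (hab : IsGapSystem a b) {k : Fin n} {w F : ℝ[X]} (hw0 : w ≠ 0)
    (hw : ∀ x ∈ Icc (a k) (b k), 0 ≤ w.eval x) (h : hab.gapFun k (w * F) = 0) :
    ∃ x ∈ Ioo (a k) (b k), F.eval x = 0 := by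
  by_contra hcon
  push Not at hcon
  rcases pos_or_neg_of_forall_ne_zero isPreconnected_Ioo F.continuousOn hcon with hF | hF
  · exact ((hab.isGap k).gapInt_pos hw0 hw hF).ne' h
  · have := (hab.isGap k).gapInt_pos (F := -F) hw0 hw fun x hx => by
      rw [eval_neg]; exact neg_pos.2 (hF x hx)
    rw [mul_neg, map_neg] at this
    change 0 < -hab.gapFun k (w * F) at this
    rw [h] at this
    simp at this

lemma IsGapSystem.exists_root_gap' (hab : IsGapSystem a b) {k : Fin n} {F : ℝ[X]}
    (h : hab.gapFun k F = 0) : ∃ x ∈ Ioo (a k) (b k), F.eval x = 0 :=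
  hab.exists_root_gap (w := 1) one_ne_zero (fun x _ => by simp) (by rwa [one_mul])

lemma IsGapSystem.injective_of_mem_gap (hab : IsGapSystem a b) {x : Fin n → ℝ}
    (hx : ∀ k, x k ∈ Ioo (a k) (b k)) : Function.Injective x := by
  intro i j hij
  rcases lt_trichotomy i j with h | h | h
  · linarith [hab.sep i j h, (hx i).1, (hx j).2]
  · exact h
  · linarith [hab.sep j i h, (hx i).2, (hx j).1]

/-- Every gap contributes a root of `S`, and these `n` roots are distinct because the gaps are
disjoint. The weight covers `w = 1` for `P` and `O⁽ᵏ⁾`, `w = X` for `P⁽¹⁾`, and a square in the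
Wronskian argument. -/
lemma IsGapSystem.eq_zero_of_gapFun (hab : IsGapSystem a b) {w S : ℝ[X]} (hw0 : w ≠ 0)
    (hw : ∀ k, ∀ x ∈ Icc (a k) (b k), 0 ≤ w.eval x) (hS : S.degree < n)
    (h : ∀ k, hab.gapFun k (w * S) = 0) : S = 0 := by
  choose x hx hx0 using fun k => hab.exists_root_gap hw0 (hw k) (h k)
  refine eq_zero_of_degree_lt_of_eval_index_eq_zero (v := x) (s := Finset.univ)
    (hab.injective_of_mem_gap hx).injOn (by simpa using hS) fun k _ => hx0 k

/-- There are `n` conditions on an `n`-dimensional space, so injectivity from `eq_zero_of_gapFun`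
gives bijectivity. -/
lemma IsGapSystem.existsUnique_gapFun (hab : IsGapSystem a b) {w : ℝ[X]} (hw0 : w ≠ 0)
    (hw : ∀ k, ∀ x ∈ Icc (a k) (b k), 0 ≤ w.eval x) (c : Fin n → ℝ) :
    ∃! S : ℝ[X], S.degree < n ∧ ∀ k, hab.gapFun k (w * S) = c k := by
  set Φ : degreeLT ℝ n →ₗ[ℝ] (Fin n → ℝ) :=
    (LinearMap.pi fun k => (hab.gapFun k).comp (LinearMap.mulLeft ℝ w)).comp
      (degreeLT ℝ n).subtype with hΦ
  have hinj : Function.Injective Φ := by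
    rw [← LinearMap.ker_eq_bot, LinearMap.ker_eq_bot']
    intro S hS
    ext1
    exact hab.eq_zero_of_gapFun hw0 hw (mem_degreeLT.1 S.2) fun k => congrFun hS k
  have hfin : Module.finrank ℝ (degreeLT ℝ n) = Module.finrank ℝ (Fin n → ℝ) :=
    (degreeLTEquiv ℝ n).finrank_eq
  have : FiniteDimensional ℝ (degreeLT ℝ n) := (degreeLTEquiv ℝ n).symm.finiteDimensional
  obtain ⟨S, hS⟩ := (LinearMap.injective_iff_surjective_of_finrank_eq_finrank hfin).1 hinj c
  refine ⟨S, ⟨mem_degreeLT.1 S.2, fun k => congrFun hS k⟩, fun S' hS' => ?_⟩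
  have := hinj (a₁ := ⟨S', mem_degreeLT.2 hS'.1⟩) (a₂ := S) (by
    rw [hS]; funext k; exact hS'.2 k)
  exact congrArg Subtype.val this

lemma monic_natDegree_iff {n : ℕ} {R : ℝ[X]} :
    (R.Monic ∧ R.natDegree = n) ↔ (R - X ^ n).degree < (n : WithBot ℕ) := by
  constructor
  · rintro ⟨h1, h2⟩
    have h3 : R.degree = n := by rw [degree_eq_natDegree h1.ne_zero, h2]
    have := degree_sub_lt_left (p := R) (q := X ^ n) (by rw [h3, degree_X_pow]) h1.ne_zero
      (by rw [h1.leadingCoeff, (monic_X_pow n).leadingCoeff])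
    rwa [h3] at this
  · intro h
    have h1 : R = X ^ n + (R - X ^ n) := by ring
    constructor
    · rw [h1]; exact monic_X_pow_add h
    · rw [h1, natDegree_add_eq_left_of_degree_lt (by rwa [degree_X_pow]), natDegree_X_pow]

lemma IsGapSystem.existsUnique_monic (hab : IsGapSystem a b) {w : ℝ[X]} (hw0 : w ≠ 0)
    (hw : ∀ k, ∀ x ∈ Icc (a k) (b k), 0 ≤ w.eval x) :
    ∃! R : ℝ[X], (R.Monic ∧ R.natDegree = n) ∧ ∀ k, hab.gapFun k (w * R) = 0 := by
  simp only [monic_natDegree_iff]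
  obtain ⟨S, ⟨hS1, hS2⟩, huniq⟩ := hab.existsUnique_gapFun hw0 hw
    fun k => -hab.gapFun k (w * X ^ n)
  refine ⟨X ^ n + S, ⟨by simpa using hS1, fun k => ?_⟩, fun R hR => ?_⟩
  · rw [mul_add, map_add, hS2]; ring
  · rw [← huniq (R - X ^ n) ⟨hR.1, fun k => ?_⟩]
    · ring
    · rw [mul_sub, map_sub, hR.2]; ring

lemma IsGapSystem.bPeriod_eq_zero_iff (hab : IsGapSystem a b) (R : ℝ[X]) (k : Fin n) :
    bPeriod a b R k = 0 ↔ hab.gapFun k R = 0 := by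
  rw [hab.bPeriod_eq]
  simp

lemma IsGapSystem.isSpacePoly_iff (hab : IsGapSystem a b) (P : ℝ[X]) :
    IsSpacePoly a b P ↔ (P.Monic ∧ P.natDegree = n) ∧ ∀ k, hab.gapFun k (1 * P) = 0 := by
  simp only [one_mul, ← hab.bPeriod_eq_zero_iff]
  exact ⟨fun h => ⟨⟨h.1, h.2⟩, h.3⟩, fun h => ⟨h.1.1, h.1.2, h.2⟩⟩

lemma IsGapSystem.isCubicPoly_iff (hab : IsGapSystem a b) (P : ℝ[X]) :
    IsCubicPoly a b P ↔ (P.Monic ∧ P.natDegree = n) ∧ ∀ k, hab.gapFun k (X * P) = 0 := by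
  simp only [← hab.bPeriod_eq_zero_iff]
  exact ⟨fun h => ⟨⟨h.1, h.2⟩, h.3⟩, fun h => ⟨h.1.1, h.1.2, h.2⟩⟩

lemma IsGapSystem.isFirstKindPoly_iff (hab : IsGapSystem a b) (k : Fin n) (R : ℝ[X]) :
    IsFirstKindPoly a b k R ↔ R.degree < n ∧
      ∀ j, hab.gapFun j (1 * R) = if k = j then -((-1) ^ (k : ℕ) * π) else 0 := by
  have key : ∀ j, (1 / (2 * (π : ℂ) * Complex.I) * bPeriod a b R j = if k = j then 1 else 0) ↔
      hab.gapFun j R = if k = j then -((-1) ^ (k : ℕ) * π) else 0 := by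
    intro j
    have hpi : (π : ℂ) ≠ 0 := Complex.ofReal_ne_zero.2 pi_ne_zero
    have h1 : 1 / (2 * (π : ℂ) * Complex.I) * bPeriod a b R j =
        ((-((-1) ^ (j : ℕ) * hab.gapFun j R / π) : ℝ) : ℂ) := by
      rw [hab.bPeriod_eq]
      push_cast
      field_simp
    have h2 : ((-1 : ℝ) ^ (j : ℕ)) * (-1) ^ (j : ℕ) = 1 := by rw [← mul_pow]; norm_num
    rw [h1]
    split_ifs with hkj
    · subst hkj
      rw [Complex.ofReal_eq_one, neg_eq_iff_eq_neg, div_eq_iff pi_ne_zero]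
      constructor
      · intro h
        linear_combination (-1 : ℝ) ^ (k : ℕ) * h - hab.gapFun k R * h2
      · intro h; rw [h]; linear_combination -π * h2
    · rw [Complex.ofReal_eq_zero]
      simp [pi_ne_zero]
  simp only [one_mul]
  exact ⟨fun h => ⟨h.1, fun j => (key j).1 (h.2 j)⟩, fun h => ⟨h.1, fun j => (key j).2 (h.2 j)⟩⟩

theorem IsGapSystem.existsUnique_isSpacePoly (hab : IsGapSystem a b) :
    ∃! P, IsSpacePoly a b P := by
  simp only [hab.isSpacePoly_iff]
  exact hab.existsUnique_monic one_ne_zero fun k x _ => by simp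

theorem IsGapSystem.existsUnique_isCubicPoly (hab : IsGapSystem a b) :
    ∃! P, IsCubicPoly a b P := by
  simp only [hab.isCubicPoly_iff]
  exact hab.existsUnique_monic X_ne_zero fun k x hx => by
    rw [eval_X]; exact (hab.pos k).le.trans hx.1

theorem IsGapSystem.existsUnique_isFirstKindPoly (hab : IsGapSystem a b) (k : Fin n) :
    ∃! R, IsFirstKindPoly a b k R := by
  simp only [hab.isFirstKindPoly_iff]
  exact hab.existsUnique_gapFun one_ne_zero (fun k x _ => by simp) _

lemma IsGapSystem.isSpacePoly (hab : IsGapSystem a b) : IsSpacePoly a b (spacePoly a b) :=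
  Classical.epsilon_spec hab.existsUnique_isSpacePoly.exists

lemma IsGapSystem.isFirstKindPoly (hab : IsGapSystem a b) (k : Fin n) :
    IsFirstKindPoly a b k (firstKindPoly a b k) :=
  Classical.epsilon_spec (hab.existsUnique_isFirstKindPoly k).exists

lemma IsGapSystem.exists_isCubicPoly (hab : IsGapSystem a b) :
    ∃ P₁, IsCubicPoly a b P₁ ∧ cubicPoly a b = X * P₁ :=
  ⟨_, Classical.epsilon_spec hab.existsUnique_isCubicPoly.exists, rfl⟩

lemma IsGapSystem.gapFun_spacePoly (hab : IsGapSystem a b) (k : Fin n) :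
    hab.gapFun k (spacePoly a b) = 0 :=
  (hab.bPeriod_eq_zero_iff _ _).1 (hab.isSpacePoly.bPeriod_eq_zero k)

lemma IsGapSystem.gapFun_timePoly (hab : IsGapSystem a b) (k : Fin n) :
    hab.gapFun k (timePoly a b) = 0 := by
  obtain ⟨P₁, h1, h2⟩ := hab.exists_isCubicPoly
  rw [timePoly, map_sub, h2, ← smul_eq_C_mul, map_smul, hab.gapFun_spacePoly,
    (hab.bPeriod_eq_zero_iff _ _).1 (h1.bPeriod_eq_zero k)]
  simp

lemma IsGapSystem.gapFun_firstKindPoly (hab : IsGapSystem a b) (k j : Fin n) :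
    hab.gapFun j (firstKindPoly a b k) = if k = j then -((-1) ^ (k : ℕ) * π) else 0 := by
  have := ((hab.isFirstKindPoly_iff k _).1 (hab.isFirstKindPoly k)).2 j
  rwa [one_mul] at this

end Uniqueness

/-! ### Differentials with vanishing B-periods -/

section Representation

open Real Set Filter Topology MeasureTheory

variable {n : ℕ} {a b : Fin n → ℝ}

/-- The integral of `R dz / √T` from `x` to `y` as a linear function of `R`. -/
noncomputable def IsGapSystem.abelLin (hab : IsGapSystem a b) (x y : ℝ) : ℝ[X] →ₗ[ℝ] ℂ where
  toFun R := abelInt a b R x y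
  map_add' R S := by
    rw [abelInt, abelInt, abelInt, ← intervalIntegral.integral_add (hab.intervalIntegrable R x y)
      (hab.intervalIntegrable S x y)]
    refine intervalIntegral.integral_congr fun t _ => ?_
    simp only [eval_add]; push_cast; ring
  map_smul' c R := by
    rw [abelInt, abelInt, RingHom.id_apply, Complex.real_smul, ← intervalIntegral.integral_const_mul]
    refine intervalIntegral.integral_congr fun t _ => ?_
    simp only [eval_smul, smul_eq_mul]; push_cast; ring

lemma IsGapSystem.abelLin_apply (hab : IsGapSystem a b) (x y : ℝ) (R : ℝ[X]) :
    hab.abelLin x y R = abelInt a b R x y := rfl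

/-- The lower end of the band below the `k`-th gap. -/
noncomputable def bandStart (b : Fin n → ℝ) (k : Fin n) : ℝ :=
  if h : (k : ℕ) + 1 < n then b ⟨k + 1, h⟩ else 0

lemma IsGapSystem.bandStart_nonneg (hab : IsGapSystem a b) (k : Fin n) : 0 ≤ bandStart b k := by
  unfold bandStart
  split_ifs with h
  · exact (hab.b_pos _).le
  · exact le_rfl

lemma IsGapSystem.bandStart_lt (hab : IsGapSystem a b) (k : Fin n) : bandStart b k < a k := by
  unfold bandStart
  split_ifs with h
  · exact hab.sep _ _ (Fin.lt_def.2 (Nat.lt_succ_self _))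
  · exact hab.pos k

lemma IsGapSystem.b_le_bandStart (hab : IsGapSystem a b) {i k : Fin n} (hki : k < i) :
    b i ≤ bandStart b k := by
  have hlt := Fin.lt_def.1 hki
  unfold bandStart
  rw [dif_pos (by omega)]
  rcases Nat.lt_or_ge ((k : ℕ) + 1) i with h | h
  · exact ((hab.sep ⟨k + 1, by omega⟩ i (Fin.lt_def.2 h)).trans (hab.lt _)).le
  · have : i = ⟨k + 1, by omega⟩ := Fin.ext (by simp only; omega)
    exact (congrArg b this).le

lemma IsGapSystem.lt_a_of_mem_band (hab : IsGapSystem a b) {i k : Fin n} (hik : i ≤ k) {x : ℝ}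
    (hx : x < a k) : x < a i := by
  rcases hik.lt_or_eq with h | h
  · exact hx.trans (hab.a_lt_a h)
  · rwa [h]

lemma IsGapSystem.abelInt_band (hab : IsGapSystem a b) (D : ℝ[X]) (k : Fin n) :
    abelInt a b D (bandStart b k) (a k) = (((-1) ^ ((k : ℕ) + 1) *
      ∫ x in bandStart b k..a k, D.eval x / √((curvePoly a b).eval x) : ℝ) : ℂ) ∧
    IntervalIntegrable (fun x => D.eval x / √((curvePoly a b).eval x)) volume (bandStart b k) (a k) ∧
    ∀ x ∈ Ioo (bandStart b k) (a k), 0 < (curvePoly a b).eval x := by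
  have hlt := hab.bandStart_lt k
  have hband : ∀ x ∈ Ioo (bandStart b k) (a k), ∀ i, x < a i ∨ b i < x := fun x hx i => by
    rcases le_or_gt i k with h | h
    · exact Or.inl (hab.lt_a_of_mem_band h hx.2)
    · exact Or.inr ((hab.b_le_bandStart h).trans_lt hx.1)
  have hx0 : ∀ x ∈ Ioo (bandStart b k) (a k), 0 < x := fun x hx =>
    (hab.bandStart_nonneg k).trans_lt hx.1
  have hT : ∀ x ∈ Ioo (bandStart b k) (a k), 0 < (curvePoly a b).eval x := fun x hx =>
    hab.curvePoly_pos_band (hx0 x hx) (hband x hx)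
  have hroot : ∀ x ∈ Ioo (bandStart b k) (a k), rootT a b (x : ℂ) =
      (-1) ^ ((k : ℕ) + 1) * (√((curvePoly a b).eval x) : ℝ) := fun x hx => by
    rw [hab.rootT_band (hx0 x hx).le (hband x hx)]
    have : (Finset.univ.filter fun i => x < a i) = Finset.univ.filter fun i => i ≤ k := by
      ext i
      simp only [Finset.mem_filter, Finset.mem_univ, true_and]
      refine ⟨fun h => ?_, fun h => hab.lt_a_of_mem_band h hx.2⟩
      by_contra hik
      linarith [hab.b_le_bandStart (not_le.1 hik), hx.1, hab.lt i]
    rw [this, card_filter_le]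
  have hsq : ((-1 : ℝ) ^ ((k : ℕ) + 1)) * (-1) ^ ((k : ℕ) + 1) = 1 := by rw [← mul_pow]; norm_num
  have heq : ∀ x ∈ Ioo (bandStart b k) (a k), ((D.eval x : ℝ) : ℂ) / rootT a b (x : ℂ) =
      (((-1) ^ ((k : ℕ) + 1) * (D.eval x / √((curvePoly a b).eval x)) : ℝ) : ℂ) := fun x hx => by
    rw [hroot x hx, div_eq_iff]
    · have h2 : (√((curvePoly a b).eval x) : ℂ) ≠ 0 :=
        Complex.ofReal_ne_zero.2 (sqrt_pos.2 (hT x hx)).ne'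
      have h3 : ((-1 : ℂ) ^ ((k : ℕ) + 1)) * (-1) ^ ((k : ℕ) + 1) = 1 := by exact_mod_cast hsq
      push_cast
      rw [show ∀ u v w : ℂ, u * (v / w) * (u * w) = (u * u) * (v / w * w) by intros; ring, h3,
        div_mul_cancel₀ _ h2, one_mul]
    · exact mul_ne_zero (pow_ne_zero _ (by norm_num))
        (Complex.ofReal_ne_zero.2 (sqrt_pos.2 (hT x hx)).ne')
  refine ⟨?_, ?_, hT⟩
  · rw [← intervalIntegral.integral_const_mul, ← intervalIntegral.integral_ofReal, abelInt,
      intervalIntegral.integral_of_le hlt.le, intervalIntegral.integral_of_le hlt.le,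
      integral_Ioc_eq_integral_Ioo, integral_Ioc_eq_integral_Ioo]
    exact setIntegral_congr_fun measurableSet_Ioo heq
  · have h1 := hab.intervalIntegrable D (bandStart b k) (a k)
    rw [intervalIntegrable_iff_integrableOn_Ioo_of_le hlt.le] at h1 ⊢
    have h2 : IntegrableOn (fun x : ℝ => (-1) ^ ((k : ℕ) + 1) *
        (((D.eval x : ℝ) : ℂ) / rootT a b (x : ℂ)).re) (Ioo (bandStart b k) (a k)) :=
      (Integrable.re h1).const_mul _
    refine h2.congr_fun (fun x hx => ?_) measurableSet_Ioo
    simp only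
    rw [heq x hx, Complex.ofReal_re, ← mul_assoc, hsq, one_mul]

lemma IsGapSystem.exists_root_band (hab : IsGapSystem a b) {D : ℝ[X]} {k : Fin n}
    (h : (abelInt a b D (bandStart b k) (a k)).re = 0) :
    ∃ x ∈ Ioo (bandStart b k) (a k), D.eval x = 0 := by
  obtain ⟨h1, h2, h3⟩ := hab.abelInt_band D k
  rw [h1, Complex.ofReal_re, mul_eq_zero, or_iff_right (pow_ne_zero _ (by norm_num))] at h
  by_contra hcon
  push Not at hcon
  rcases pos_or_neg_of_forall_ne_zero isPreconnected_Ioo D.continuousOn hcon with hD | hD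
  · exact (intervalIntegral.intervalIntegral_pos_of_pos_on h2
      (fun x hx => div_pos (hD x hx) (sqrt_pos.2 (h3 x hx))) (hab.bandStart_lt k)).ne' h
  · have := intervalIntegral.intervalIntegral_pos_of_pos_on h2.neg
      (fun x hx => neg_pos.2 (div_neg_of_neg_of_pos (hD x hx) (sqrt_pos.2 (h3 x hx))))
      (hab.bandStart_lt k)
    simp only [Pi.neg_apply, intervalIntegral.integral_neg] at this
    rw [h] at this
    simp at this

lemma IsGapSystem.abelInt_band_re (hab : IsGapSystem a b) {D : ℝ[X]}
    (h : ∀ k, hab.gapFun k D = 0) (h' : ∀ k, (abelInt a b D 0 (a k)).re = 0) (k : Fin n) :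
    (abelInt a b D (bandStart b k) (a k)).re = 0 := by
  have h1 := h' k
  rw [← hab.abelInt_add D 0 (bandStart b k) (a k), Complex.add_re] at h1
  suffices (abelInt a b D 0 (bandStart b k)).re = 0 by rwa [this, zero_add] at h1
  unfold bandStart
  split_ifs with hk
  · rw [← hab.abelInt_add D 0 (a ⟨k + 1, hk⟩), hab.abelInt_gap, h, Complex.add_re, h']
    simp
  · simp [abelInt]

/-- Subtracting consecutive periods, the integral over each band also vanishes. As `√T` has constant
phase on every gap and band, `D` has a root in each, and these `2n` interlacing roots exceed its
degree. -/
lemma IsGapSystem.eq_zero_of_periods (hab : IsGapSystem a b) {D : ℝ[X]} (hD : D.degree < 2 * n)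
    (h : ∀ k, hab.gapFun k D = 0) (h' : ∀ k, (abelInt a b D 0 (a k)).re = 0) : D = 0 := by
  choose x hx hx0 using fun k => hab.exists_root_gap' (h k)
  choose y hy hy0 using fun k => hab.exists_root_band (hab.abelInt_band_re h h' k)
  have hyx : ∀ k, y k < x k := fun k => (hy k).2.trans (hx k).1
  have hlt : ∀ i j, i < j → x j < y i := fun i j hij =>
    (hx j).2.trans_le ((hab.b_le_bandStart hij).trans (hy i).1.le)
  have hinj : Function.Injective (Sum.elim x y) := by
    rintro (i | i) (j | j) hij <;> simp only [Sum.elim_inl, Sum.elim_inr] at hij <;>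
      rcases lt_trichotomy i j with hlt' | rfl | hlt'
    · linarith [hlt i j hlt', hyx i]
    · rfl
    · linarith [hlt j i hlt', hyx j]
    · linarith [hlt i j hlt', hyx i, hyx j]
    · linarith [hyx i]
    · linarith [hlt j i hlt']
    · linarith [hlt i j hlt']
    · linarith [hyx i]
    · linarith [hlt j i hlt', hyx i, hyx j]
    · linarith [hlt i j hlt', hyx j]
    · rfl
    · linarith [hlt j i hlt', hyx i]
  refine eq_zero_of_degree_lt_of_eval_index_eq_zero (v := Sum.elim x y) (s := Finset.univ)
    hinj.injOn ?_ ?_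
  · simpa [two_mul] using hD
  · rintro (k | k) _
    · exact hx0 k
    · exact hy0 k

lemma monic_curvePoly (a b : Fin n → ℝ) : (curvePoly a b).Monic :=
  monic_X.mul (monic_prod_of_monic _ _ fun _ _ => (monic_X_sub_C _).mul (monic_X_sub_C _))

lemma natDegree_curvePoly (a b : Fin n → ℝ) : (curvePoly a b).natDegree = 2 * n + 1 := by
  rw [curvePoly, monic_X.natDegree_mul (monic_prod_of_monic _ _ fun _ _ =>
      (monic_X_sub_C _).mul (monic_X_sub_C _)), natDegree_X,
    natDegree_prod_of_monic _ _ fun _ _ => (monic_X_sub_C _).mul (monic_X_sub_C _)]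
  simp only [(monic_X_sub_C _).natDegree_mul (monic_X_sub_C _), natDegree_X_sub_C]
  simp; ring

lemma coeff_curvePoly_top (a b : Fin n → ℝ) : (curvePoly a b).coeff (2 * n + 1) = 1 := by
  rw [← natDegree_curvePoly a b]; exact monic_curvePoly a b

lemma coeff_dualPoly_curvePoly (a b : Fin n → ℝ) (ℓ : ℝ[X] →ₗ[ℝ] ℝ) {i : ℕ} (hi : 2 * n ≤ i) :
    (dualPoly (curvePoly a b) ℓ).coeff i = 0 := by
  rw [coeff_dualPoly]
  refine Finset.sum_eq_zero fun j _ => ?_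
  rw [coeff_eq_zero_of_natDegree_lt (by rw [natDegree_curvePoly]; omega), zero_mul, zero_mul]

/-- The coefficient `c` in `R = c T' + ∑ ρ_k gapDual k`. -/
noncomputable def exactCoeff (n : ℕ) (R : ℝ[X]) : ℝ := R.coeff (2 * n) / (2 * n + 1)

/-- The coefficients `ρ_k` in `R = c T' + ∑ ρ_k gapDual k`. -/
noncomputable def dualCoeff (a b : Fin n → ℝ) (R : ℝ[X]) (k : Fin n) : ℝ :=
  (-1) ^ (k : ℕ) * (abelInt a b R 0 (a k)).re / π

/-- The functional `∑ ρ_k ℓ_k` with `R = c T' + dualPoly T (∑ ρ_k ℓ_k)`. -/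
noncomputable def IsGapSystem.dualFun (hab : IsGapSystem a b) (R : ℝ[X]) : ℝ[X] →ₗ[ℝ] ℝ :=
  ∑ k, dualCoeff a b R k • hab.gapFun k

/-- Both sides have zero gap integrals and the same real parts of the half `A`-periods: `T' dz / √T
= 2 d√T` contributes nothing, and the `gapDual k` form a dual basis. Then `eq_zero_of_periods`
applies, and the half `A`-periods turn out to be real. -/
theorem IsGapSystem.representation (hab : IsGapSystem a b) {R : ℝ[X]} (hR : R.natDegree ≤ 2 * n)
    (h : ∀ k, hab.gapFun k R = 0) :
    R = C (exactCoeff n R) * (curvePoly a b).derivative + dualPoly (curvePoly a b) (hab.dualFun R) ∧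
    ∀ k, abelInt a b R 0 (a k) = (((-1) ^ (k : ℕ) * π * dualCoeff a b R k : ℝ) : ℂ) := by
  set T := curvePoly a b with hT
  set R' := C (exactCoeff n R) * T.derivative + dualPoly T (hab.dualFun R) with hR'
  have hsum : dualPoly T (hab.dualFun R) = ∑ k, C (dualCoeff a b R k) * hab.gapDual k :=
    dualPoly_sum _ _ _ _
  have hgap : ∀ k, hab.gapFun k R' = 0 := by
    intro k
    have h1 : hab.gapFun k T.derivative = 0 := by
      rw [hT, curvePoly_eq_branchPoly]; exact (hab.isGap k).gapLin_derivative_branchPoly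
    rw [hR', hsum, map_add, map_sum, ← smul_eq_C_mul, map_smul, h1]
    simp only [← smul_eq_C_mul, map_smul, hab.gapFun_gapDual, smul_zero, Finset.sum_const_zero,
      add_zero]
  have habel : ∀ k, abelInt a b R' 0 (a k) = (((-1) ^ (k : ℕ) * π * dualCoeff a b R k : ℝ) : ℂ) := by
    intro k
    have h1 : abelInt a b T.derivative 0 (a k) = 0 := by
      rw [hT, hab.abelInt_derivative_curvePoly (hab.pos k).le, rootT_eq_zero (eval_curvePoly_a a b k),
        rootT_eq_zero (eval_curvePoly_zero a b)]
      simp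
    have h2 : ∀ i, hab.abelLin 0 (a k) (C (dualCoeff a b R i) * hab.gapDual i) =
        dualCoeff a b R i • abelInt a b (hab.gapDual i) 0 (a k) := fun i => by
      rw [← smul_eq_C_mul, map_smul, hab.abelLin_apply]
    rw [← hab.abelLin_apply, hR', hsum, map_add, map_sum, ← smul_eq_C_mul, map_smul,
      hab.abelLin_apply, h1]
    simp only [h2, hab.abelInt_gapDual_eq, smul_zero, zero_add]
    simp only [smul_ite, smul_zero, Finset.sum_ite_eq', Finset.mem_univ, if_true,
      Complex.real_smul]
    push_cast; ring
  have hre : ∀ k, (abelInt a b R' 0 (a k)).re = (abelInt a b R 0 (a k)).re := by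
    intro k
    rw [habel, Complex.ofReal_re, dualCoeff]
    have h2 : ((-1 : ℝ) ^ (k : ℕ)) * (-1) ^ (k : ℕ) = 1 := by rw [← mul_pow]; norm_num
    have := pi_ne_zero
    field_simp
    rw [sq, h2, one_mul]
  have hD : R - R' = 0 := by
    refine hab.eq_zero_of_periods ?_ (fun k => by rw [map_sub, h, hgap, sub_zero]) fun k => ?_
    -- The coefficient of degree `2n` cancels because `T'` has leading coefficient `2n + 1`, the
    -- denominator in `exactCoeff`; `dualPoly` has no terms of degree `2n` or more.
    · have : (R - R').degree < ((2 * n : ℕ) : WithBot ℕ) := by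
        rw [degree_lt_iff_coeff_zero]
        intro i hi
        rw [coeff_sub, hR', coeff_add, coeff_dualPoly_curvePoly a b _ hi, add_zero, coeff_C_mul,
          coeff_derivative]
        rcases hi.lt_or_eq with hlt | rfl
        · rw [coeff_eq_zero_of_natDegree_lt (hR.trans_lt hlt), coeff_eq_zero_of_natDegree_lt
            (by rw [hT, natDegree_curvePoly]; omega)]
          ring
        · rw [hT, coeff_curvePoly_top, exactCoeff]
          have : (2 * (n : ℝ) + 1) ≠ 0 := by positivity
          push_cast
          field_simp
          ring
      exact_mod_cast this
    · rw [← hab.abelLin_apply, map_sub, hab.abelLin_apply, hab.abelLin_apply, Complex.sub_re, hre,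
        sub_self]
  have hRR : R = R' := sub_eq_zero.1 hD
  exact ⟨hRR, fun k => by rw [← habel k, ← hRR]⟩

end Representation


/-! ### Low moments from top coefficients -/

section Moments

variable {n : ℕ} {T R O : ℝ[X]} {ℓ : ℝ[X] →ₗ[ℝ] ℝ} {c : ℝ}

lemma apply_eq_sum_of_degree_lt (ℓ : ℝ[X] →ₗ[ℝ] ℝ) (hO : O.degree < n) :
    ℓ O = ∑ j ∈ Finset.range n, O.coeff j * ℓ (X ^ j) := by
  have h1 : O = ∑ j ∈ Finset.range n, O.coeff j • X ^ j := by
    ext i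
    simp only [finsetSum_coeff, coeff_smul, coeff_X_pow, smul_eq_mul, mul_ite, mul_one, mul_zero,
      Finset.sum_ite_eq, Finset.mem_range]
    split_ifs with hi
    · rfl
    · exact (degree_lt_iff_coeff_zero O n).1 hO i (not_lt.1 hi)
  conv_lhs => rw [h1]
  simp only [map_sum, map_smul, smul_eq_mul]

/-- Moments with `j < m` vanish by assumption, and `j > m` asks for a coefficient of `T` above its
degree; only the leading coefficient of `T` is left. -/
lemma coeff_dualPoly_of_lower_eq_zero (hT : T.natDegree = 2 * n + 1) (hT1 : T.Monic) {m i : ℕ}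
    (hi : i + m + 1 = 2 * n) (h : ∀ j < m, ℓ (X ^ j) = 0) :
    (dualPoly T ℓ).coeff i = ((i : ℝ) - m) / 2 * ℓ (X ^ m) := by
  have htop : T.coeff (2 * n + 1) = 1 := by rw [← hT]; exact hT1
  rw [coeff_dualPoly, Finset.sum_eq_single_of_mem m (Finset.mem_range.2 (by omega))]
  · rw [show i + m + 2 = 2 * n + 1 by omega, htop, one_mul]
  · intro j _ hj
    rcases lt_or_gt_of_ne hj with hlt | hlt
    · rw [h j hlt, mul_zero]
    · rw [coeff_eq_zero_of_natDegree_lt (by omega), zero_mul, zero_mul]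

lemma coeff_dualPoly_of_lower_eq_zero' (hT : T.natDegree = 2 * n + 1) (hT1 : T.Monic) {m i : ℕ}
    (hi : i + m + 2 = 2 * n) (h : ∀ j < m, ℓ (X ^ j) = 0) :
    (dualPoly T ℓ).coeff i = T.coeff (2 * n) * (((i : ℝ) - m) / 2) * ℓ (X ^ m) +
      ((i : ℝ) - (m + 1)) / 2 * ℓ (X ^ (m + 1)) := by
  have htop : T.coeff (2 * n + 1) = 1 := by rw [← hT]; exact hT1
  rw [coeff_dualPoly, Finset.sum_eq_add_of_mem m (m + 1) (Finset.mem_range.2 (by omega))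
    (Finset.mem_range.2 (by omega)) (by omega)]
  · rw [show i + (m + 1) + 2 = 2 * n + 1 by omega, hi, htop, one_mul]
    push_cast; rfl
  · intro j _ hj
    rcases lt_or_ge j m with hlt | hlt
    · rw [h j hlt, mul_zero]
    · rw [coeff_eq_zero_of_natDegree_lt (by omega), zero_mul, zero_mul]

/-- The low moments of `ℓ` read off from `R = c T' + dualPoly T ℓ` with `deg R ≤ n + 1`. -/
theorem apply_eq_of_representation (hT : T.natDegree = 2 * n + 1) (hT1 : T.Monic) (hn : 0 < n)
    (hdeg : R.natDegree ≤ n + 1) (hR : R = C (exactCoeff n R) * T.derivative + dualPoly T ℓ)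
    (hO : O.degree < n) :
    ℓ O = 2 * (R.coeff n - 2 / 3 * T.coeff (2 * n) * R.coeff (n + 1)) * O.coeff (n - 1) +
      2 / 3 * R.coeff (n + 1) * (X * O).coeff (n - 1) := by
  have hcoeff : ∀ i, R.coeff i = exactCoeff n R * (T.coeff (i + 1) * (i + 1)) +
      (dualPoly T ℓ).coeff i := fun i => by
    conv_lhs => rw [hR]
    rw [coeff_add, coeff_C_mul, coeff_derivative]
  rw [apply_eq_sum_of_degree_lt ℓ hO]
  -- The case `n = 1` is separate because only there `n + 1 = 2n`, so that the `T'` term of the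
  -- representation can be nonzero.
  obtain _ | _ | m := n
  · omega
  · have h1 := hcoeff 1
    rw [coeff_dualPoly_of_lower_eq_zero hT hT1 (m := 0) (by norm_num) (by simp)] at h1
    simp only [exactCoeff] at h1
    norm_num at h1 ⊢
    rw [h1]
    ring
  · have hc : exactCoeff (m + 2) R = 0 := by
      rw [exactCoeff, coeff_eq_zero_of_natDegree_lt (by omega), zero_div]
    simp only [hc, zero_mul, zero_add] at hcoeff
    -- The coefficient of `R` of degree `2n - 1 - j` is zero, since this exceeds `n + 1`. It is also
    -- a nonzero multiple of the moment of order `j` once all lower moments vanish.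
    have hzero : ∀ j < m, ℓ (X ^ j) = 0 := by
      intro j
      induction j using Nat.strong_induction_on with
      | _ j ih =>
        intro hj
        have h1 := hcoeff (2 * m + 3 - j)
        rw [coeff_dualPoly_of_lower_eq_zero hT hT1 (m := j) (by omega)
          (fun i hi => ih i hi (hi.trans hj)), coeff_eq_zero_of_natDegree_lt (by omega)] at h1
        have h2 : ((2 * m + 3 - j : ℕ) : ℝ) - j ≠ 0 := by
          have : (j : ℝ) < ((2 * m + 3 - j : ℕ) : ℝ) := by exact_mod_cast (by omega)
          linarith
        have := h1.symm
        simpa [h2] using this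
    have h1 := hcoeff (m + 3)
    rw [coeff_dualPoly_of_lower_eq_zero hT hT1 (m := m) (by omega) hzero] at h1
    have h2 := hcoeff (m + 2)
    rw [coeff_dualPoly_of_lower_eq_zero' hT hT1 (m := m) (by omega) hzero] at h2
    rw [Finset.sum_range_succ, Finset.sum_range_succ, Finset.sum_eq_zero fun j hj => by
      rw [hzero j (Finset.mem_range.1 hj), mul_zero]]
    have h3 : (X * O).coeff (m + 1 + 1 - 1) = O.coeff m := coeff_X_mul O m
    rw [h3, show m + 1 + 1 + 1 = m + 3 from rfl, show m + 1 + 1 = m + 2 from rfl,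
      show m + 2 - 1 = m + 1 from rfl, h1, h2]
    push_cast
    ring

lemma coeff_divByMonic_X_sub_C (hO : O.degree < (n + 2 : ℕ)) (x : ℝ) :
    (O /ₘ (X - C x)).degree < (n + 1 : ℕ) ∧ (O /ₘ (X - C x)).coeff n = O.coeff (n + 1) := by
  have h1 : (O /ₘ (X - C x)).degree < (n + 1 : ℕ) := by
    by_cases h0 : O /ₘ (X - C x) = 0
    · rw [h0, degree_zero]; exact WithBot.bot_lt_coe _
    · rw [degree_eq_natDegree h0, natDegree_divByMonic _ (monic_X_sub_C x), natDegree_X_sub_C]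
      have hO0 : O ≠ 0 := fun h => h0 (by rw [h, zero_divByMonic])
      rw [degree_eq_natDegree hO0] at hO
      have : O.natDegree < n + 2 := by exact_mod_cast hO
      exact_mod_cast (show O.natDegree - 1 < n + 1 by omega)
  refine ⟨h1, ?_⟩
  have h2 := congrArg (fun S => S.coeff (n + 1)) (modByMonic_add_div O (X - C x))
  simp only [modByMonic_X_sub_C_eq_C_eval, coeff_add, sub_mul, coeff_sub, coeff_X_mul, coeff_C_mul,
    coeff_C_succ, zero_add] at h2
  rw [(degree_lt_iff_coeff_zero _ _).1 h1 (n + 1) le_rfl] at h2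
  rw [← h2]; ring

/-- Since `ℓ (K(x, ·))` is the value of `dualPoly T ℓ` at `x`, it equals `R(x) - c T'(x)`, which
gives the main term. The leftover `c O(x)` and half of `ℓ (O /ₘ (X - C x))` combine into a constant
independent of `x`. -/
theorem apply_endpointDeriv (hT : T.natDegree = 2 * n + 1) (hT1 : T.Monic) (hn : 0 < n)
    (hdeg : R.natDegree ≤ n + 1) (hR : R = C (exactCoeff n R) * T.derivative + dualPoly T ℓ)
    (hO : O.degree < n) {x : ℝ} (hx : T.derivative.eval x ≠ 0) :
    ℓ (endpointDeriv T O x) = -(O.eval x * R.eval x / T.derivative.eval x) +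
      1 / 3 * R.coeff (n + 1) * O.coeff (n - 1) := by
  have h1 : ℓ (kernelPoly T x) = R.eval x - exactCoeff n R * T.derivative.eval x := by
    rw [← eval_dualPoly]
    conv_rhs => rw [hR]
    simp only [eval_add, eval_mul, eval_C]
    rw [← hR]; ring
  rw [endpointDeriv, map_add, ← smul_eq_C_mul, ← smul_eq_C_mul, map_smul, map_smul, h1,
    smul_eq_mul, smul_eq_mul]
  have h2 : 1 / 2 * ℓ (O /ₘ (X - C x)) + exactCoeff n R * O.eval x =
      1 / 3 * R.coeff (n + 1) * O.coeff (n - 1) := by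
    -- For `n = 1` the quotient is zero and `exactCoeff` supplies the constant; for `n ≥ 2` it is
    -- the other way round.
    obtain _ | _ | m := n
    · omega
    · have hO' : O = C (O.coeff 0) := eq_C_of_degree_le_zero (by
        rw [Nat.cast_withBot] at hO
        exact Order.lt_succ_iff.1 hO)
      rw [hO']
      have : (C (O.coeff 0) : ℝ[X]) /ₘ (X - C x) = 0 :=
        (divByMonic_eq_zero_iff (monic_X_sub_C x)).2
          (by rw [degree_X_sub_C]; exact degree_C_lt)
      rw [this, map_zero, exactCoeff, eval_C, show 0 + 1 - 1 = 0 from rfl, coeff_C_zero,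
        show 2 * (0 + 1) = 0 + 1 + 1 from rfl]
      push_cast
      ring
    · obtain ⟨h3, h4⟩ := coeff_divByMonic_X_sub_C (n := m) hO x
      have hc : exactCoeff (m + 2) R = 0 := by
        rw [exactCoeff, coeff_eq_zero_of_natDegree_lt (by omega), zero_div]
      rw [apply_eq_of_representation hT hT1 hn hdeg hR (h3.trans (by exact_mod_cast Nat.lt_succ_self _)), hc]
      have h5 : (X * (O /ₘ (X - C x))).coeff (m + 1 + 1 - 1) = (O /ₘ (X - C x)).coeff m :=
        coeff_X_mul _ m
      rw [h5, h4, show m + 1 + 1 - 1 = m + 1 from rfl,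
        (degree_lt_iff_coeff_zero _ _).1 h3 (m + 1) le_rfl]
      ring
  rw [← h2]
  field_simp
  ring

end Moments

/-! ### Frequencies as coefficients of the first kind differentials -/

section Frequencies

open Real

variable {n : ℕ} {a b : Fin n → ℝ}

/-- The normalization of `O⁽ᵏ⁾` isolates `ρ_k`; together with `representation` the value is minus
the half `A`-period of `R`, which is the bilinear relation. -/
lemma IsGapSystem.dualFun_firstKindPoly (hab : IsGapSystem a b) (R : ℝ[X]) (k : Fin n) :
    hab.dualFun R (firstKindPoly a b k) = -((-1) ^ (k : ℕ) * π * dualCoeff a b R k) := by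
  simp only [dualFun, LinearMap.sum_apply, LinearMap.smul_apply, smul_eq_mul,
    hab.gapFun_firstKindPoly, mul_ite, mul_zero, Finset.sum_ite_eq, Finset.mem_univ, if_true]
  ring

/-- The half `A`-period of a differential with vanishing `B`-periods. -/
theorem IsGapSystem.abelInt_eq_coeff (hab : IsGapSystem a b) {R : ℝ[X]} (hR : R.natDegree ≤ n + 1)
    (h : ∀ k, hab.gapFun k R = 0) (k : Fin n) :
    abelInt a b R 0 (a k) =
      ((-(2 * (R.coeff n - 2 / 3 * (curvePoly a b).coeff (2 * n) * R.coeff (n + 1)) *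
          (firstKindPoly a b k).coeff (n - 1) +
        2 / 3 * R.coeff (n + 1) * (X * firstKindPoly a b k).coeff (n - 1)) : ℝ) : ℂ) := by
  have hn : 0 < n := k.pos
  obtain ⟨h1, h2⟩ := hab.representation (hR.trans (by omega)) h
  rw [← apply_eq_of_representation (natDegree_curvePoly a b) (monic_curvePoly a b) hn hR h1
    (hab.isFirstKindPoly k).degree_lt, hab.dualFun_firstKindPoly, neg_neg, h2]

/-- The shift is chosen exactly to replace the subleading coefficient `A_Q` by `A_T / 2`. -/
lemma IsGapSystem.natDegree_timePoly (hab : IsGapSystem a b) :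
    (timePoly a b).natDegree ≤ n + 1 ∧ (timePoly a b).coeff (n + 1) = 1 ∧
      (timePoly a b).coeff n = (curvePoly a b).coeff (2 * n) / 2 := by
  obtain ⟨P₁, h1, h2⟩ := hab.exists_isCubicPoly
  have h3 := hab.isSpacePoly
  have hlead : (spacePoly a b).coeff n = 1 := by
    have := h3.monic
    rwa [Monic, leadingCoeff, h3.natDegree_eq] at this
  have hlead' : P₁.coeff n = 1 := by rw [← h1.natDegree_eq]; exact h1.monic
  have htop : (spacePoly a b).coeff (n + 1) = 0 :=
    coeff_eq_zero_of_natDegree_lt (by rw [h3.natDegree_eq]; omega)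
  refine ⟨?_, ?_, ?_⟩
  · refine (natDegree_sub_le _ _).trans (max_le ?_ ?_)
    · rw [h2, monic_X.natDegree_mul h1.monic, h1.natDegree_eq, natDegree_X, add_comm]
    · exact (natDegree_C_mul_le _ _).trans (by rw [h3.natDegree_eq]; omega)
  · rw [timePoly, coeff_sub, coeff_C_mul, htop, h2, coeff_X_mul, hlead']; ring
  · rw [timePoly, coeff_sub, coeff_C_mul, hlead, shiftConst]; ring

lemma IsGapSystem.natDegree_spacePoly (hab : IsGapSystem a b) :
    (spacePoly a b).natDegree ≤ n + 1 ∧ (spacePoly a b).coeff (n + 1) = 0 ∧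
      (spacePoly a b).coeff n = 1 := by
  have h3 := hab.isSpacePoly
  refine ⟨by rw [h3.natDegree_eq]; omega,
    coeff_eq_zero_of_natDegree_lt (by rw [h3.natDegree_eq]; omega), ?_⟩
  have := h3.monic
  rwa [Monic, leadingCoeff, h3.natDegree_eq] at this

theorem IsGapSystem.spaceFreq_eq (hab : IsGapSystem a b) (k : Fin n) :
    1 / 2 * (1 / 2 * aPeriod a b (spacePoly a b) k) = (spaceFreq a b k : ℂ) ∧
      spaceFreq a b k = -(firstKindPoly a b k).coeff (n - 1) := by
  obtain ⟨h1, h2, h3⟩ := hab.natDegree_spacePoly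
  have h4 : 1 / 2 * (1 / 2 * aPeriod a b (spacePoly a b) k) =
      ((-(firstKindPoly a b k).coeff (n - 1) : ℝ) : ℂ) := by
    rw [aPeriod, hab.abelInt_eq_coeff h1 hab.gapFun_spacePoly k, h2, h3]
    push_cast; ring
  have h5 : spaceFreq a b k = -(firstKindPoly a b k).coeff (n - 1) := by
    rw [spaceFreq, h4, Complex.ofReal_re]
  exact ⟨by rw [h5, h4], h5⟩

/-- The second coefficient is taken from `X * O` at `n - 1`, not from `O` at `n - 2`: for `n = 1`
truncated subtraction would return the constant term instead of the required zero. -/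
theorem IsGapSystem.timeFreq_eq (hab : IsGapSystem a b) (k : Fin n) :
    1 / 2 * (3 / 2 * aPeriod a b (timePoly a b) k) = (timeFreq a b k : ℂ) ∧
      timeFreq a b k = (curvePoly a b).coeff (2 * n) / 2 * (firstKindPoly a b k).coeff (n - 1) -
        (X * firstKindPoly a b k).coeff (n - 1) := by
  obtain ⟨h1, h2, h3⟩ := hab.natDegree_timePoly
  have h4 : 1 / 2 * (3 / 2 * aPeriod a b (timePoly a b) k) =
      (((curvePoly a b).coeff (2 * n) / 2 * (firstKindPoly a b k).coeff (n - 1) -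
        (X * firstKindPoly a b k).coeff (n - 1) : ℝ) : ℂ) := by
    rw [aPeriod, hab.abelInt_eq_coeff h1 hab.gapFun_timePoly k, h2, h3]
    push_cast; ring
  have h5 : timeFreq a b k = (curvePoly a b).coeff (2 * n) / 2 *
      (firstKindPoly a b k).coeff (n - 1) - (X * firstKindPoly a b k).coeff (n - 1) := by
    rw [timeFreq, h4, Complex.ofReal_re]
  exact ⟨by rw [h5, h4], h5⟩

end Frequencies


/-! ### Differentiating the first kind polynomials -/

section Derivative

open Filter Topology

variable {n : ℕ} {a b : Fin n → ℝ}

/-- Invertible operators form an open set on which inversion is strictly differentiable, so near `p`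
the solution is `o = A⁻¹ c`. Differentiating `A o = c` then gives the formula. -/
lemma exists_hasStrictFDerivAt_of_apply_eq {E V : Type*} [NormedAddCommGroup E] [NormedSpace ℝ E]
    [NormedAddCommGroup V] [NormedSpace ℝ V] [CompleteSpace V] {A : E → V →L[ℝ] V}
    {A' : E →L[ℝ] V →L[ℝ] V} {p : E} (hA : HasStrictFDerivAt A A' p) (hu : IsUnit (A p))
    {o : E → V} {c : V} (ho : ∀ᶠ q in 𝓝 p, A q (o q) = c) :
    ∃ o' : E →L[ℝ] V, HasStrictFDerivAt o o' p ∧ ∀ v, A p (o' v) = -(A' v) (o p) := by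
  have hunit : ∀ᶠ q in 𝓝 p, IsUnit (A q) := hA.continuousAt.eventually (Units.isOpen.mem_nhds hu)
  obtain ⟨J, hinv⟩ : ∃ J : E →L[ℝ] V, HasStrictFDerivAt (fun q => Ring.inverse (A q) c) J p := by
    obtain ⟨u, hu⟩ := hu
    have h1 := hasStrictFDerivAt_ringInverse (𝕜 := ℝ) u
    rw [hu] at h1
    exact ⟨_, (h1.comp p hA).clm_apply (hasStrictFDerivAt_const c p)⟩
  have h2 := hinv.congr_of_eventuallyEq (f₁ := o) (by
    filter_upwards [hunit, ho] with q hq hq'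
    rw [← hq', ← mul_apply_eq_comp, Ring.inverse_mul_cancel _ hq,
      one_apply_eq_self])
  refine ⟨_, h2, fun v => ?_⟩
  have h3 := (hA.clm_apply h2).hasFDerivAt
  have h4 : HasFDerivAt (fun q => A q (o q)) (0 : E →L[ℝ] V) p :=
    (hasFDerivAt_const c p).congr_of_eventuallyEq ho
  have h5 := DFunLike.congr_fun (h3.unique h4) v
  rw [add_apply, ContinuousLinearMap.comp_apply,
    ContinuousLinearMap.flip_apply, zero_apply] at h5
  exact eq_neg_of_add_eq_zero_left h5

/-- The polynomial of degree less than `n` with the given coefficients. -/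
noncomputable def ofCoeffs (n : ℕ) : (Fin n → ℝ) →ₗ[ℝ] ℝ[X] :=
  Fintype.linearCombination ℝ fun m : Fin n => (X : ℝ[X]) ^ (m : ℕ)

lemma ofCoeffs_apply (o : Fin n → ℝ) : ofCoeffs n o = ∑ m, o m • (X : ℝ[X]) ^ (m : ℕ) :=
  Fintype.linearCombination_apply _ _ _

lemma coeff_ofCoeffs (o : Fin n → ℝ) (m : Fin n) : (ofCoeffs n o).coeff m = o m := by
  simp [ofCoeffs_apply, finsetSum_coeff, coeff_X_pow, Fin.val_inj]

lemma degree_ofCoeffs_lt (o : Fin n → ℝ) : (ofCoeffs n o).degree < n := by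
  rw [degree_lt_iff_coeff_zero]
  intro m hm
  rw [ofCoeffs_apply, finsetSum_coeff]
  refine Finset.sum_eq_zero fun i _ => ?_
  rw [coeff_smul, coeff_X_pow, if_neg (by omega), smul_zero]

lemma ofCoeffs_coeff {O : ℝ[X]} (hO : O.degree < n) : ofCoeffs n (fun m => O.coeff m) = O := by
  ext i
  by_cases hi : i < n
  · exact coeff_ofCoeffs (fun m => O.coeff m) ⟨i, hi⟩
  · rw [(degree_lt_iff_coeff_zero _ _).1 hO i (not_lt.1 hi),
      (degree_lt_iff_coeff_zero _ _).1 (degree_ofCoeffs_lt _) i (not_lt.1 hi)]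

lemma X_sub_C_mul_divByMonic (R : ℝ[X]) (x : ℝ) :
    (X - C x) * (R /ₘ (X - C x)) = R - C (R.eval x) := by
  rw [eq_sub_iff_add_eq, add_comm, ← modByMonic_X_sub_C_eq_C_eval, modByMonic_add_div]

lemma endpointDeriv_sum_smul {ι : Type*} (s : Finset ι) (T : ℝ[X]) (o : ι → ℝ) (R : ι → ℝ[X])
    (x : ℝ) :
    endpointDeriv T (∑ m ∈ s, o m • R m) x = ∑ m ∈ s, o m • endpointDeriv T (R m) x := by
  have h1 : (∑ m ∈ s, o m • R m) /ₘ (X - C x) = ∑ m ∈ s, o m • (R m /ₘ (X - C x)) := by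
    refine mul_left_cancel₀ (X_sub_C_ne_zero x) ?_
    simp only [X_sub_C_mul_divByMonic, Finset.mul_sum, mul_smul_comm, smul_sub, Finset.sum_sub_distrib,
      eval_finsetSum, eval_smul, map_sum, smul_C]
  simp only [endpointDeriv, h1, smul_add, Finset.sum_add_distrib, Finset.mul_sum, mul_smul_comm,
    eval_finsetSum, eval_smul, Finset.sum_div, ← Finset.sum_neg_distrib, map_sum, Finset.sum_mul]
  congr 1
  refine Finset.sum_congr rfl fun m _ => ?_
  rw [← smul_mul_assoc, smul_C, smul_eq_mul, smul_eq_mul]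
  congr 2
  ring

lemma isOpen_isGapSystem (n : ℕ) : IsOpen {e : Fin n ⊕ Fin n → ℝ |
    IsGapSystem (fun k => e (.inl k)) fun k => e (.inr k)} := by
  rw [isOpen_iff_eventually]
  intro e he
  have h1 : ∀ᶠ e' : Fin n ⊕ Fin n → ℝ in 𝓝 e, ∀ k, 0 < e' (.inl k) := eventually_all.2 fun k =>
    (continuous_apply _).continuousAt.eventually (lt_mem_nhds (he.pos k))
  have h2 : ∀ᶠ e' : Fin n ⊕ Fin n → ℝ in 𝓝 e, ∀ k, e' (.inl k) < e' (.inr k) :=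
    eventually_all.2 fun k => (continuous_apply _).continuousAt.eventually_lt
      (continuous_apply _).continuousAt (he.lt k)
  have h3 : ∀ᶠ e' : Fin n ⊕ Fin n → ℝ in 𝓝 e, ∀ i j, i < j → e' (.inr j) < e' (.inl i) :=
    eventually_all.2 fun i => eventually_all.2 fun j => eventually_imp_distrib_left.2 fun hij =>
      (continuous_apply _).continuousAt.eventually_lt (continuous_apply _).continuousAt
        (he.sep i j hij)
  filter_upwards [h1, h2, h3] with e' h1 h2 h3 using ⟨h1, h2, h3⟩

/-- `endpoints` as a continuous linear map. -/
noncomputable def endpointsCLM (n : ℕ) :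
    ((Fin n → ℝ) × (Fin n → ℝ)) →L[ℝ] (Fin n ⊕ Fin n → ℝ) :=
  ContinuousLinearMap.pi (Sum.elim
    (fun k => (ContinuousLinearMap.proj k).comp (ContinuousLinearMap.fst ℝ _ _))
    fun k => (ContinuousLinearMap.proj k).comp (ContinuousLinearMap.snd ℝ _ _))

lemma endpointsCLM_apply (p : (Fin n → ℝ) × (Fin n → ℝ)) :
    endpointsCLM n p = endpoints p.1 p.2 := by
  ext (k | k) <;> rfl

lemma IsGapSystem.eventually (hab : IsGapSystem a b) :
    ∀ᶠ p : (Fin n → ℝ) × (Fin n → ℝ) in 𝓝 (a, b), IsGapSystem p.1 p.2 := by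
  have h1 := (isOpen_isGapSystem n).preimage (endpointsCLM n).continuous
  exact h1.mem_nhds (x := (a, b)) hab

lemma IsGapSystem.eval_derivative_ne_zero (hab : IsGapSystem a b) (s : Fin n ⊕ Fin n) :
    (curvePoly a b).derivative.eval (endpoints a b s) ≠ 0 := by
  have h1 : branchPoly (endpoints a b) = (X - C (endpoints a b s)) *
      (X * ∏ i ∈ Finset.univ.erase s, (X - C (endpoints a b i))) := by
    rw [branchPoly, ← Finset.mul_prod_erase _ _ (Finset.mem_univ s)]; ring
  rw [curvePoly_eq_branchPoly, h1, derivative_mul, eval_add, eval_mul, eval_mul, derivative_X_sub_C,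
    eval_one, one_mul, eval_mul (p := X - C _), eval_sub, eval_X, eval_C, sub_self, zero_mul,
    add_zero, eval_prod]
  refine mul_ne_zero (hab.endpoints_pos s).ne' (Finset.prod_ne_zero_iff.2 fun i hi => ?_)
  rw [eval_sub, eval_X, eval_C]
  exact sub_ne_zero.2 fun h => (Finset.mem_erase.1 hi).1 (hab.injective_endpoints h).symm

theorem IsGapSystem.hasStrictFDerivAt_gapInt (hab : IsGapSystem a b) (k : Fin n) (R : ℝ[X]) :
    HasStrictFDerivAt (fun p : (Fin n → ℝ) × (Fin n → ℝ) =>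
        gapInt (endpoints p.1 p.2) (.inl k) (.inr k) fun y => R.eval y)
      ((∑ s, hab.gapFun k (endpointDeriv (curvePoly a b) R (endpoints a b s)) •
        (ContinuousLinearMap.proj s : (Fin n ⊕ Fin n → ℝ) →L[ℝ] ℝ)).comp (endpointsCLM n))
      (a, b) := by
  have h1 := KdVGaps.hasStrictFDerivAt_gapInt (isOpen_isGapSystem n) (s := .inl k) (s' := .inr k)
    (e := endpoints a b) (fun e he => by
      have : e = endpoints (fun k => e (.inl k)) fun k => e (.inr k) := by ext (k | k) <;> rfl
      rw [this]; exact he.isGap k) hab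
    (fun s => by rw [← curvePoly_eq_branchPoly]; exact hab.eval_derivative_ne_zero s) R
  rw [← curvePoly_eq_branchPoly] at h1
  have h2 : HasStrictFDerivAt (endpointsCLM n) (endpointsCLM n) (a, b) :=
    (endpointsCLM n).hasStrictFDerivAt
  have h3 := HasStrictFDerivAt.comp (a, b) (g := fun e : Fin n ⊕ Fin n → ℝ =>
    gapInt e (.inl k) (.inr k) fun y => R.eval y) (f := endpointsCLM n)
    (by rw [endpointsCLM_apply]; exact h1) h2
  refine h3.congr_of_eventuallyEq (Eventually.of_forall fun p => ?_)
  simp only [endpointsCLM_apply]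

/-- The derivative of the normalized differentials of the first kind in the branch points. -/
theorem IsGapSystem.exists_hasStrictFDerivAt_firstKindPoly (hab : IsGapSystem a b) (k : Fin n) :
    ∃ D : ((Fin n → ℝ) × (Fin n → ℝ)) →L[ℝ] (Fin n → ℝ),
      (∀ v j, hab.gapFun j (ofCoeffs n (D v)) = -∑ s, endpointsCLM n v s *
        hab.gapFun j (endpointDeriv (curvePoly a b) (firstKindPoly a b k) (endpoints a b s))) ∧
      ∀ lam : ℝ[X] →ₗ[ℝ] ℝ, HasStrictFDerivAt
        (fun p : (Fin n → ℝ) × (Fin n → ℝ) => lam (firstKindPoly p.1 p.2 k))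
        ((lam ∘ₗ ofCoeffs n).toContinuousLinearMap.comp D) (a, b) := by
  set G : Fin n → Fin n → (Fin n → ℝ) × (Fin n → ℝ) → ℝ := fun m j p =>
    gapInt (endpoints p.1 p.2) (.inl j) (.inr j) fun y => ((X : ℝ[X]) ^ (m : ℕ)).eval y with hG
  set Φ : Fin n → (Fin n → ℝ) →L[ℝ] (Fin n → ℝ) →L[ℝ] (Fin n → ℝ) := fun m =>
    ContinuousLinearMap.smulRightL ℝ (Fin n → ℝ) (Fin n → ℝ) (ContinuousLinearMap.proj m) with hΦ
  -- `A p` sends a coefficient vector to the gap integrals of its polynomial. It is written with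
  -- `gapInt` rather than `gapFun` because `p` need not be a gap system.
  set A : (Fin n → ℝ) × (Fin n → ℝ) → (Fin n → ℝ) →L[ℝ] (Fin n → ℝ) := fun p =>
    ∑ m, Φ m (fun j => G m j p) with hA
  set A' : ((Fin n → ℝ) × (Fin n → ℝ)) →L[ℝ] (Fin n → ℝ) →L[ℝ] (Fin n → ℝ) := ∑ m, (Φ m).comp
    (ContinuousLinearMap.pi fun j => ((∑ s, hab.gapFun j
      (endpointDeriv (curvePoly a b) (X ^ (m : ℕ)) (endpoints a b s)) •
        (ContinuousLinearMap.proj s : (Fin n ⊕ Fin n → ℝ) →L[ℝ] ℝ)).comp (endpointsCLM n))) with hA'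
  have hd : HasStrictFDerivAt A A' (a, b) := by
    refine HasStrictFDerivAt.fun_sum fun m _ => ?_
    exact (Φ m).hasStrictFDerivAt.comp (a, b)
      (hasStrictFDerivAt_pi.2 fun j => hab.hasStrictFDerivAt_gapInt j _)
  have hAapply : ∀ (p) (hp : IsGapSystem p.1 p.2) (o : Fin n → ℝ) (j),
      A p o j = hp.gapFun j (ofCoeffs n o) := by
    intro p hp o j
    rw [ofCoeffs_apply, map_sum, hA]
    simp only [sum_apply, Finset.sum_apply, map_smul, smul_eq_mul]
    rfl
  have hunit : IsUnit (A (a, b)) := by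
    have hinj : Function.Injective (A (a, b)) := by
      rw [injective_iff_map_eq_zero]
      intro o ho
      have h0 : ofCoeffs n o = 0 := hab.eq_zero_of_gapFun one_ne_zero (fun k x _ => by simp)
        (degree_ofCoeffs_lt o) fun j => by rw [one_mul, ← hAapply (a, b) hab, ho]; rfl
      ext m
      rw [← coeff_ofCoeffs o m, h0]; simp
    rw [ContinuousLinearMap.isUnit_iff_bijective]
    exact ⟨hinj, (LinearMap.injective_iff_surjective (f := (A (a, b)).toLinearMap)).1 hinj⟩
  obtain ⟨D, hD1, hD2⟩ := exists_hasStrictFDerivAt_of_apply_eq hd hunit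
    (o := fun p m => (firstKindPoly p.1 p.2 k).coeff m)
    (c := fun j => if k = j then -((-1) ^ (k : ℕ) * Real.pi) else 0) (by
      filter_upwards [hab.eventually] with p hp
      ext j
      rw [hAapply p hp, ofCoeffs_coeff (hp.isFirstKindPoly k).degree_lt, hp.gapFun_firstKindPoly])
  refine ⟨D, fun v j => ?_, fun lam => ?_⟩
  · rw [← hAapply (a, b) hab, hD2 v]
    conv_rhs => rw [← ofCoeffs_coeff (hab.isFirstKindPoly k).degree_lt, ofCoeffs_apply]
    simp only [endpointDeriv_sum_smul, map_sum, map_smul, smul_eq_mul, Finset.mul_sum]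
    rw [Finset.sum_comm]
    simp only [hA', sum_apply, Pi.neg_apply, Finset.sum_apply, neg_inj]
    refine Finset.sum_congr rfl fun m _ => ?_
    simp [hΦ, Finset.mul_sum, -Fintype.sum_sum_type]
    refine Finset.sum_congr rfl fun s _ => ?_
    ring
  · have h1 := (lam ∘ₗ ofCoeffs n).toContinuousLinearMap.hasStrictFDerivAt.comp (a, b) hD1
    refine h1.congr_of_eventuallyEq ?_
    filter_upwards [hab.eventually] with p hp
    simp only [LinearMap.coe_toContinuousLinearMap', LinearMap.comp_apply]
    rw [ofCoeffs_coeff (hp.isFirstKindPoly k).degree_lt]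

end Derivative


/-! ### The variational formula for the frequencies -/

section Variation

open Filter Topology

variable {n : ℕ} {a b : Fin n → ℝ}

lemma coeff_curvePoly_two_mul (hn : 0 < n) (a b : Fin n → ℝ) :
    (curvePoly a b).coeff (2 * n) = -∑ s, endpoints a b s := by
  have h1 : (curvePoly a b).nextCoeff = (curvePoly a b).coeff (2 * n) := by
    rw [nextCoeff_of_natDegree_pos (by rw [natDegree_curvePoly]; omega), natDegree_curvePoly,
      Nat.add_sub_cancel]
  rw [← h1, curvePoly_eq_branchPoly, branchPoly, monic_X.nextCoeff_mul
    (monic_prod_of_monic _ _ fun _ _ => monic_X_sub_C _), Monic.nextCoeff_prod _ _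
    fun _ _ => monic_X_sub_C _]
  simp only [nextCoeff_X_sub_C, Finset.sum_neg_distrib]
  simp [nextCoeff]

/-- `ℓ` applied to the variation of `O⁽ᵏ⁾`, where `R = c T' + dualPoly T ℓ` has vanishing
`B`-periods. -/
lemma IsGapSystem.dualFun_variation (hab : IsGapSystem a b) {R : ℝ[X]} (hR : R.natDegree ≤ n + 1)
    (h : ∀ k, hab.gapFun k R = 0) (k : Fin n) {V : ℝ[X]} {v : Fin n ⊕ Fin n → ℝ}
    (hVdeg : V.degree < n) (hV : ∀ j, hab.gapFun j V = -∑ s, v s *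
        hab.gapFun j (endpointDeriv (curvePoly a b) (firstKindPoly a b k) (endpoints a b s))) :
    2 * (R.coeff n - 2 / 3 * (curvePoly a b).coeff (2 * n) * R.coeff (n + 1)) * V.coeff (n - 1) +
      2 / 3 * R.coeff (n + 1) * (X * V).coeff (n - 1) =
    ∑ s, varCoeff a b R k (endpoints a b s) * v s -
      1 / 3 * R.coeff (n + 1) * (firstKindPoly a b k).coeff (n - 1) * ∑ s, v s := by
  have hn : 0 < n := k.pos
  obtain ⟨h1, -⟩ := hab.representation (hR.trans (by omega)) h
  rw [← apply_eq_of_representation (natDegree_curvePoly a b) (monic_curvePoly a b) hn hR h1 hVdeg]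
  -- `dualFun R` is a combination of the functionals `gapFun j`, so the differentiated normalization
  -- holds for it too.
  have h2 : hab.dualFun R V = -∑ s, v s * hab.dualFun R
      (endpointDeriv (curvePoly a b) (firstKindPoly a b k) (endpoints a b s)) := by
    simp only [dualFun, LinearMap.sum_apply, LinearMap.smul_apply, smul_eq_mul, hV, Finset.mul_sum,
      mul_neg, Finset.sum_neg_distrib]
    rw [Finset.sum_comm]
    congr 1
    exact Finset.sum_congr rfl fun s _ => Finset.sum_congr rfl fun j _ => by ring
  rw [h2, Finset.mul_sum, ← Finset.sum_neg_distrib, ← Finset.sum_sub_distrib]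
  refine Finset.sum_congr rfl fun s _ => ?_
  rw [apply_endpointDeriv (natDegree_curvePoly a b) (monic_curvePoly a b) hn hR h1
    (hab.isFirstKindPoly k).degree_lt (hab.eval_derivative_ne_zero s), varCoeff]
  ring

/-- The derivative of the frequencies in the branch points. -/
theorem IsGapSystem.exists_hasStrictFDerivAt_freq (hab : IsGapSystem a b) (k : Fin n) :
    ∃ L₁ L₂ : ((Fin n → ℝ) × (Fin n → ℝ)) →L[ℝ] ℝ,
      HasStrictFDerivAt (fun p : (Fin n → ℝ) × (Fin n → ℝ) => spaceFreq p.1 p.2 k) L₁ (a, b) ∧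
      HasStrictFDerivAt (fun p : (Fin n → ℝ) × (Fin n → ℝ) => timeFreq p.1 p.2 k) L₂ (a, b) ∧
      (∀ v, -2 * L₁ v =
        ∑ s, varCoeff a b (spacePoly a b) k (endpoints a b s) * endpointsCLM n v s) ∧
      ∀ v, -2 * L₂ v =
        ∑ s, 3 * varCoeff a b (timePoly a b) k (endpoints a b s) * endpointsCLM n v s := by
  obtain ⟨D, hD, hlam⟩ := hab.exists_hasStrictFDerivAt_firstKindPoly k
  have hn : 0 < n := k.pos
  set lam₁ : ℝ[X] →ₗ[ℝ] ℝ := lcoeff ℝ (n - 1)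
  set lam₂ : ℝ[X] →ₗ[ℝ] ℝ := lcoeff ℝ (n - 1) ∘ₗ LinearMap.mulLeft ℝ X
  set σ : ((Fin n → ℝ) × (Fin n → ℝ)) →L[ℝ] ℝ :=
    (∑ s, (ContinuousLinearMap.proj s : (Fin n ⊕ Fin n → ℝ) →L[ℝ] ℝ)).comp (endpointsCLM n) with hS
  have hAT : HasStrictFDerivAt (fun p : (Fin n → ℝ) × (Fin n → ℝ) =>
      (curvePoly p.1 p.2).coeff (2 * n)) (-σ) (a, b) := by
    refine (-σ).hasStrictFDerivAt.congr_of_eventuallyEq (Eventually.of_forall fun p => ?_)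
    simp only [coeff_curvePoly_two_mul hn, ← endpointsCLM_apply]
    simp [hS, -Fintype.sum_sum_type]
  have hσ : ∀ v, σ v = ∑ s, endpointsCLM n v s := fun v => by simp [hS, -Fintype.sum_sum_type]
  have h1 := (hlam lam₁).neg
  have h2 := ((hAT.mul (hlam lam₁)).const_mul (1 / 2)).sub (hlam lam₂)
  refine ⟨_, _, h1.congr_of_eventuallyEq ?_, h2.congr_of_eventuallyEq ?_, fun v => ?_, fun v => ?_⟩
  · filter_upwards [hab.eventually] with p hp
    exact (hp.spaceFreq_eq k).2.symm
  · filter_upwards [hab.eventually] with p hp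
    rw [(hp.timeFreq_eq k).2]
    simp [lam₁, lam₂]
    ring
  · obtain ⟨h3, h4, h5⟩ := hab.natDegree_spacePoly
    have := hab.dualFun_variation h3 hab.gapFun_spacePoly k (degree_ofCoeffs_lt (D v)) (hD v)
    rw [h4, h5] at this
    simp [lam₁, -Fintype.sum_sum_type]
    linarith
  · obtain ⟨h3, h4, h5⟩ := hab.natDegree_timePoly
    have := hab.dualFun_variation h3 hab.gapFun_timePoly k (degree_ofCoeffs_lt (D v)) (hD v)
    -- Here the leading coefficient is `1`, so the constant from `apply_endpointDeriv` enters; it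
    -- cancels against the derivative of `A_T = -∑ e_s` in the formula for the time frequency.
    rw [h4, h5] at this
    simp only [mul_assoc, ← Finset.mul_sum]
    simp [lam₁, lam₂, -Fintype.sum_sum_type, hσ]
    linarith

end Variation


/-! ### Nondegeneracy of the linear system -/

section Determinant

variable {n : ℕ} {a b : Fin n → ℝ}

lemma eq_nodal_of_monic {m : ℕ} {S : ℝ[X]} (hS : S.Monic) (hm : S.natDegree = m) {x : Fin m → ℝ}
    (hinj : Function.Injective x) (hx : ∀ k, S.eval (x k) = 0) :
    S = Lagrange.nodal Finset.univ x := by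
  have hd : S.degree = (Lagrange.nodal Finset.univ x).degree := by
    rw [Lagrange.degree_nodal, degree_eq_natDegree hS.ne_zero, hm]; simp
  refine sub_eq_zero.1 (eq_zero_of_degree_lt_of_eval_index_eq_zero (v := x) (s := Finset.univ)
    hinj.injOn ?_ fun k _ => ?_)
  · have := degree_sub_lt_left hd hS.ne_zero (by rw [hS.leadingCoeff, Lagrange.nodal_monic.leadingCoeff])
    rwa [hd, Lagrange.degree_nodal] at this
  · rw [eval_sub, hx, Lagrange.eval_nodal_at_node (Finset.mem_univ k), sub_zero]

lemma IsGapSystem.eval_ne_zero_of_not_mem_gap (hab : IsGapSystem a b) {S : ℝ[X]} (hS : S.Monic)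
    (hm : S.natDegree = n) (h : ∀ k, ∃ x ∈ Set.Ioo (a k) (b k), S.eval x = 0) {y : ℝ}
    (hy : ∀ k, y ∉ Set.Ioo (a k) (b k)) : S.eval y ≠ 0 := by
  choose x hx hx0 using h
  rw [eq_nodal_of_monic hS hm (hab.injective_of_mem_gap hx) hx0, Lagrange.eval_nodal]
  exact Finset.prod_ne_zero_iff.2 fun k _ => sub_ne_zero.2 fun hyk => hy k (hyk ▸ hx k)

lemma IsGapSystem.a_not_mem_gap (hab : IsGapSystem a b) (k j : Fin n) :
    a k ∉ Set.Ioo (a j) (b j) := fun h => by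
  rcases lt_trichotomy k j with hkj | rfl | hkj
  · linarith [hab.sep k j hkj, h.2]
  · exact lt_irrefl _ h.1
  · linarith [hab.a_lt_a hkj, h.1]

/-- A nonzero combination of two differentials with vanishing `B`-periods has no real double
zero. -/
theorem IsGapSystem.wronskian_ne_zero (hab : IsGapSystem a b) {P S : ℝ[X]} (hP : P.Monic)
    (hPn : P.natDegree = n) (hS : S.Monic) (hSn : S.natDegree = n + 1)
    (hP0 : ∀ k, hab.gapFun k P = 0) (hS0 : ∀ k, hab.gapFun k S = 0) (x : ℝ) :
    S.derivative.eval x * P.eval x - S.eval x * P.derivative.eval x ≠ 0 := by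
  intro hW
  -- A zero of the Wronskian yields a nontrivial combination `F` of `S` and `P` that vanishes at `x`
  -- together with its derivative.
  obtain ⟨v, hv, hv0⟩ := Matrix.exists_mulVec_eq_zero_iff
    (M := !![S.eval x, P.eval x; S.derivative.eval x, P.derivative.eval x]).2
    (by rw [Matrix.det_fin_two_of]; linarith)
  have e0 := congrFun hv0 0
  have e1 := congrFun hv0 1
  simp [Matrix.mulVec, dotProduct, Fin.sum_univ_two] at e0 e1
  set F := C (v 0) * S + C (v 1) * P with hF
  have hFdeg : F.natDegree ≤ n + 1 := by
    refine (natDegree_add_le _ _).trans (max_le ?_ ?_)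
    · exact (natDegree_C_mul_le _ _).trans hSn.le
    · exact (natDegree_C_mul_le _ _).trans (by omega)
  have hF0 : F ≠ 0 := by
    intro h
    have h1 := congrArg (coeff · (n + 1)) h
    have h2 := congrArg (coeff · n) h
    have hSl : S.coeff (n + 1) = 1 := by rw [← hSn]; exact hS
    have hPl : P.coeff n = 1 := by rw [← hPn]; exact hP
    simp only [hF, coeff_add, coeff_C_mul, hSl, coeff_zero,
      coeff_eq_zero_of_natDegree_lt (show P.natDegree < n + 1 by omega)] at h1
    have h3 : v 0 = 0 := by linarith
    simp only [hF, coeff_add, coeff_C_mul, hPl, h3, coeff_zero] at h2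
    have h4 : v 1 = 0 := by linarith
    exact hv (by ext i; fin_cases i <;> [exact h3; exact h4])
  obtain ⟨F₁, hF₁⟩ : (X - C x) ^ 2 ∣ F := by
    have hr : F.eval x = 0 := by simp only [hF, eval_add, eval_mul, eval_C]; linarith
    have hr' : F.derivative.eval x = 0 := by
      simp only [hF, derivative_add, derivative_C_mul, eval_add, eval_mul, eval_C]; linarith
    exact (le_rootMultiplicity_iff hF0).1
      ((one_lt_rootMultiplicity_iff_isRoot hF0).2 ⟨hr, hr'⟩)
  have hF₁0 : F₁ ≠ 0 := fun h => hF0 (by rw [hF₁, h, mul_zero])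
  -- The double factor serves as a nonnegative weight, leaving a quotient of degree at most `n - 1`
  -- that would need `n` roots.
  refine hF₁0 (hab.eq_zero_of_gapFun (w := (X - C x) ^ 2) (pow_ne_zero _ (X_sub_C_ne_zero x))
    (fun k y _ => by rw [eval_pow]; positivity) ?_ fun k => ?_)
  · have h1 : F.natDegree = 2 + F₁.natDegree := by
      rw [hF₁, natDegree_mul (pow_ne_zero _ (X_sub_C_ne_zero x)) hF₁0, natDegree_pow,
        natDegree_X_sub_C]
    rw [degree_eq_natDegree hF₁0]
    exact_mod_cast (show F₁.natDegree < n by omega)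
  · rw [← hF₁, hF, map_add, ← smul_eq_C_mul, ← smul_eq_C_mul, map_smul, map_smul, hP0, hS0]
    simp

lemma exists_eq_C_mul_nodal {ι : Type*} [Fintype ι] {F : ℝ[X]} {e : ι → ℝ}
    (he : Function.Injective e) (hF : F.natDegree ≤ Fintype.card ι) (h : ∀ s, F.eval (e s) = 0) :
    ∃ c : ℝ, F = C c * Lagrange.nodal Finset.univ e := by
  have hd : F.degree ≤ (Lagrange.nodal Finset.univ e).degree := by
    rw [Lagrange.degree_nodal]
    exact degree_le_of_natDegree_le hF
  refine ⟨F.coeff (Fintype.card ι), sub_eq_zero.1 (eq_zero_of_degree_lt_of_eval_index_eq_zero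
    (v := e) (s := Finset.univ) he.injOn ?_ fun k _ => ?_)⟩
  · rw [degree_lt_iff_coeff_zero]
    intro i hi
    rw [coeff_sub, coeff_C_mul]
    have hnat : (Lagrange.nodal Finset.univ e).natDegree = Fintype.card ι := Lagrange.natDegree_nodal
    rcases hi.lt_or_eq with hi | hi
    · have hi' : Fintype.card ι < i := hi
      rw [coeff_eq_zero_of_natDegree_lt (hF.trans_lt hi'),
        coeff_eq_zero_of_natDegree_lt (hnat.trans_lt hi')]; ring
    · have hi' : i = Fintype.card ι := hi.symm
      have : (Lagrange.nodal Finset.univ e).coeff (Fintype.card ι) = 1 := by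
        rw [← hnat]; exact Lagrange.nodal_monic
      rw [hi', this]; ring
  · rw [eval_sub, h, eval_mul, Lagrange.eval_nodal_at_node (Finset.mem_univ k)]; ring

lemma IsGapSystem.eval_nodal_endpoints_neg (hab : IsGapSystem a b) {k : Fin n} {x : ℝ}
    (hx : x ∈ Set.Ioo (a k) (b k)) :
    (Lagrange.nodal Finset.univ (endpoints a b)).eval x < 0 := by
  rw [Lagrange.eval_nodal, Fintype.prod_sum_type, ← Finset.prod_mul_distrib,
    ← Finset.mul_prod_erase _ _ (Finset.mem_univ k)]
  refine mul_neg_of_neg_of_pos (mul_neg_of_pos_of_neg (sub_pos.2 hx.1) (sub_neg.2 hx.2))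
    (Finset.prod_pos fun i hi => ?_)
  exact hab.pair_pos (Finset.mem_erase.1 hi).1 (Set.Ioo_subset_Icc_self hx)

/-- The independence statement behind the nondegeneracy of the linear system. -/
theorem IsGapSystem.eq_zero_of_eval_endpoints (hab : IsGapSystem a b) {P Q L M : ℝ[X]}
    (hP : P.Monic) (hPn : P.natDegree = n) (hQ : Q.Monic) (hQn : Q.natDegree = n + 1)
    (hP0 : ∀ k, hab.gapFun k P = 0) (hQ0 : ∀ k, hab.gapFun k Q = 0)
    (hL : L.degree < n) (hM : M.degree < n)
    (h : ∀ s, (L * P + M * Q).eval (endpoints a b s) = 0) : L = 0 ∧ M = 0 := by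
  obtain rfl | hn := Nat.eq_zero_or_pos n
  · exact ⟨degree_eq_bot.1 (Nat.WithBot.lt_zero_iff.1 hL),
      degree_eq_bot.1 (Nat.WithBot.lt_zero_iff.1 hM)⟩
  have hLn : L.natDegree ≤ n - 1 := natDegree_le_iff_coeff_eq_zero.2 fun i hi =>
    (degree_lt_iff_coeff_zero _ _).1 hL i (by omega)
  have hMn : M.natDegree ≤ n - 1 := natDegree_le_iff_coeff_eq_zero.2 fun i hi =>
    (degree_lt_iff_coeff_zero _ _).1 hM i (by omega)
  set α := a ⟨0, hn⟩ with hα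
  have hPα : P.eval α ≠ 0 := hab.eval_ne_zero_of_not_mem_gap hP hPn
    (fun k => hab.exists_root_gap' (hP0 k)) fun k => hab.a_not_mem_gap _ k
  -- Subtracting `t P` makes `S` vanish at the branch point `α`; its other roots are then the `n`
  -- points `x k`, one in each gap.
  set t := Q.eval α / P.eval α with ht
  set S := Q - C t * P with hSdef
  have hdlt : (C t * P).natDegree < Q.natDegree := (natDegree_C_mul_le _ _).trans_lt (by omega)
  have hS : S.Monic := hQ.sub_of_left (degree_lt_degree hdlt)
  have hSn : S.natDegree = n + 1 := by rw [hSdef, natDegree_sub_eq_left_of_natDegree_lt hdlt, hQn]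
  have hS0 : ∀ k, hab.gapFun k S = 0 := fun k => by
    rw [hSdef, map_sub, ← smul_eq_C_mul, map_smul, hP0, hQ0]; simp
  have hSα : S.eval α = 0 := by
    rw [hSdef, eval_sub, eval_mul, eval_C, ht, div_mul_cancel₀ _ hPα, sub_self]
  have hW := hab.wronskian_ne_zero hP hPn hS hSn hP0 hS0
  choose x hx hx0 using fun k => hab.exists_root_gap' (hS0 k)
  have hxα : ∀ k, x k - α ≠ 0 := fun k => sub_ne_zero.2 fun h =>
    hab.a_not_mem_gap ⟨0, hn⟩ k (by rw [← hα, ← h]; exact hx k)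
  have hxinj := hab.injective_of_mem_gap hx
  -- factor `S`
  obtain ⟨S₁, hS₁⟩ : X - C α ∣ S := dvd_iff_isRoot.2 hSα
  have hS₁m : S₁.Monic := (monic_X_sub_C α).of_mul_monic_left (hS₁ ▸ hS)
  have hS₁n : S₁.natDegree = n := by
    have := hSn
    rw [hS₁, (monic_X_sub_C α).natDegree_mul hS₁m, natDegree_X_sub_C] at this
    omega
  have hS₁0 : ∀ k, S₁.eval (x k) = 0 := fun k => by
    have := hx0 k
    rw [hS₁, eval_mul, eval_sub, eval_X, eval_C] at this
    exact (mul_eq_zero.1 this).resolve_left (hxα k)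
  have hS₁nodal := eq_nodal_of_monic hS₁m hS₁n hxinj hS₁0
  have hS' : ∀ k, S.derivative.eval (x k) =
      (x k - α) * ∏ j ∈ Finset.univ.erase k, (x k - x j) := fun k => by
    have h1 : S₁.derivative.eval (x k) = ∏ j ∈ Finset.univ.erase k, (x k - x j) := by
      rw [hS₁nodal, Lagrange.eval_nodal_derivative_eval_node_eq (Finset.mem_univ k),
        Lagrange.eval_nodal]
    rw [hS₁, derivative_mul, eval_add, eval_mul, eval_mul, hS₁0, h1]
    simp
  have hWx : ∀ k, S.derivative.eval (x k) * P.eval (x k) ≠ 0 := fun k => by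
    have := hW (x k)
    rwa [hx0, zero_mul, sub_zero] at this
  -- the common multiple of the branch polynomial
  set U := Lagrange.nodal Finset.univ (endpoints a b) with hU
  obtain ⟨c, hc⟩ := exists_eq_C_mul_nodal hab.injective_endpoints (F := L * P + M * Q) (by
    have hcard : Fintype.card (Fin n ⊕ Fin n) = 2 * n := by simp [two_mul]
    rw [hcard]
    refine (natDegree_add_le _ _).trans (max_le ?_ ?_) <;>
      refine natDegree_mul_le.trans (by omega)) h
  have hUα : U.eval α = 0 := Lagrange.eval_nodal_at_node (v := endpoints a b)
    (Finset.mem_univ (Sum.inl (⟨0, hn⟩ : Fin n)))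
  have hident : (L + C t * M) * P + M * S = C c * U := by rw [← hc, hSdef]; ring
  -- At `α` both `S` and `U` vanish while `P` does not. Extracting this factor lowers the degree by
  -- one, which is what makes the interpolation sum below vanish.
  obtain ⟨L₁, hL₁⟩ : X - C α ∣ L + C t * M := by
    rw [dvd_iff_isRoot]
    have := congrArg (eval α) hident
    rw [eval_add, eval_mul, eval_mul, eval_mul, hSα, hUα, mul_zero, mul_zero, add_zero] at this
    exact (mul_eq_zero.1 this).resolve_right hPα
  have hL₁deg : L₁.degree < (n - 1 : ℕ) := by
    by_cases h0 : L₁ = 0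
    · rw [h0, degree_zero]; exact WithBot.bot_lt_coe _
    have h1 : (L + C t * M).natDegree ≤ n - 1 := (natDegree_add_le _ _).trans
      (max_le hLn ((natDegree_C_mul_le _ _).trans hMn))
    rw [hL₁, natDegree_mul (X_sub_C_ne_zero α) h0, natDegree_X_sub_C] at h1
    rw [degree_eq_natDegree h0]
    exact_mod_cast (show L₁.natDegree < n - 1 by omega)
  have hL₁deg' : L₁.degree < ((Finset.univ : Finset (Fin n)).card : ℕ) := by
    rw [Finset.card_univ, Fintype.card_fin]
    exact hL₁deg.trans_le (by exact_mod_cast Nat.sub_le n 1)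
  have hL₁x : ∀ k, (x k - α) * L₁.eval (x k) * P.eval (x k) = c * U.eval (x k) := fun k => by
    have := congrArg (eval (x k)) hident
    rw [hL₁, eval_add, eval_mul, eval_mul, eval_mul, eval_mul, hx0, mul_zero, add_zero] at this
    simpa using this
  -- Interpolating `L₁` at the `n` nodes `x k` expresses its coefficient of degree `n - 1`, which is
  -- zero.
  have hsum := Lagrange.coeff_eq_sum hxinj.injOn hL₁deg'
  rw [Finset.card_univ, Fintype.card_fin, (degree_lt_iff_coeff_zero _ _).1 hL₁deg _ le_rfl] at hsum
  have hterm : ∀ k, L₁.eval (x k) / ∏ j ∈ Finset.univ.erase k, (x k - x j) =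
      c * (U.eval (x k) / (S.derivative.eval (x k) * P.eval (x k))) := fun k => by
    have h1 := hWx k
    rw [hS'] at h1 ⊢
    have h2 := right_ne_zero_of_mul (left_ne_zero_of_mul h1)
    have h3 := right_ne_zero_of_mul h1
    have h4 := hxα k
    rw [← mul_div_assoc, ← hL₁x, div_eq_div_iff h2 h1]
    ring
  simp only [hterm] at hsum
  rw [← Finset.mul_sum] at hsum
  -- At the roots of `S` the denominators `S' P` are values of the Wronskian, of one sign on the
  -- whole line, and `U` is negative in every gap. The sum multiplying `c` therefore cannot vanish.
  have hc0 : c = 0 := by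
    refine (mul_eq_zero.1 hsum.symm).resolve_right ?_
    have hne : (Finset.univ : Finset (Fin n)).Nonempty := ⟨⟨0, hn⟩, Finset.mem_univ _⟩
    have hcont : ContinuousOn (fun y => S.derivative.eval y * P.eval y -
        S.eval y * P.derivative.eval y) Set.univ := by fun_prop
    rcases pos_or_neg_of_forall_ne_zero isPreconnected_univ hcont (fun y _ => hW y) with hs | hs
    · refine (Finset.sum_neg (fun k _ => div_neg_of_neg_of_pos
        (hab.eval_nodal_endpoints_neg (hx k)) ?_) hne).ne
      have := hs (x k) trivial
      rwa [hx0, zero_mul, sub_zero] at this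
    · refine (Finset.sum_pos (fun k _ => div_pos_of_neg_of_neg
        (hab.eval_nodal_endpoints_neg (hx k)) ?_) hne).ne'
      have := hs (x k) trivial
      simp only [hx0, zero_mul, sub_zero] at this
      exact this
  have hL₁0 : L₁ = 0 := eq_zero_of_degree_lt_of_eval_index_eq_zero (v := x) (s := Finset.univ)
    hxinj.injOn hL₁deg' fun k _ => by
      have h1 := hL₁x k
      rw [hc0, zero_mul] at h1
      exact (mul_eq_zero.1 ((mul_eq_zero.1 h1).resolve_right
        (right_ne_zero_of_mul (hWx k)))).resolve_left (hxα k)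
  rw [hL₁0, mul_zero] at hL₁
  have hM0 : M = 0 := by
    rw [hL₁, hc0, zero_mul, zero_add, C_0, zero_mul] at hident
    exact (mul_eq_zero.1 hident).resolve_right hS.ne_zero
  rw [hM0, mul_zero, add_zero] at hL₁
  exact ⟨hL₁, hM0⟩

lemma IsGapSystem.monic_timePoly (hab : IsGapSystem a b) :
    (timePoly a b).Monic ∧ (timePoly a b).natDegree = n + 1 := by
  obtain ⟨h1, h2, -⟩ := hab.natDegree_timePoly
  exact ⟨monic_of_natDegree_le_of_coeff_eq_one _ h1 h2,
    natDegree_eq_of_le_of_coeff_ne_zero h1 (by rw [h2]; exact one_ne_zero)⟩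

lemma IsGapSystem.firstKindPoly_sum_degree (hab : IsGapSystem a b) (c : Fin n → ℝ) :
    (∑ k, c k • firstKindPoly a b k).degree < n :=
  mem_degreeLT.1 (Submodule.sum_mem _ fun k _ =>
    Submodule.smul_mem _ _ (mem_degreeLT.2 (hab.isFirstKindPoly k).degree_lt))

lemma IsGapSystem.eq_zero_of_firstKindPoly_sum (hab : IsGapSystem a b) {c : Fin n → ℝ}
    (h : ∑ k, c k • firstKindPoly a b k = 0) : c = 0 := by
  ext j
  have h1 := congrArg (hab.gapFun j) h
  simp only [map_sum, map_smul, hab.gapFun_firstKindPoly, map_zero, smul_eq_mul, mul_ite, mul_zero,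
    Finset.sum_ite_eq', Finset.mem_univ, if_true] at h1
  have h2 : -((-1) ^ (j : ℕ) * Real.pi) ≠ 0 :=
    neg_ne_zero.2 (mul_ne_zero (pow_ne_zero _ (by norm_num)) Real.pi_ne_zero)
  exact (mul_eq_zero.1 h1).resolve_right h2

lemma varMatrix_inl (a b : Fin n → ℝ) (k : Fin n) (s : Fin n ⊕ Fin n) :
    varMatrix a b (.inl k) s = varCoeff a b (spacePoly a b) k (endpoints a b s) := by
  rcases s with s | s <;> rfl

lemma varMatrix_inr (a b : Fin n → ℝ) (k : Fin n) (s : Fin n ⊕ Fin n) :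
    varMatrix a b (.inr k) s = 3 * varCoeff a b (timePoly a b) k (endpoints a b s) := by
  rcases s with s | s <;> rfl

/-- A left null vector, with column `s` multiplied by `T'(e_s)`, gives `L` and `M` as combinations
of the `O⁽ᵏ⁾`, which are linearly independent by their normalization. The factor `3` of the time
rows is absorbed into `M`. -/
theorem IsGapSystem.det_varMatrix_ne_zero (hab : IsGapSystem a b) : (varMatrix a b).det ≠ 0 := by
  intro hdet
  obtain ⟨u, hu, hu0⟩ := Matrix.exists_vecMul_eq_zero_iff.2 hdet
  refine hu ?_
  obtain ⟨hL, hM⟩ := hab.eq_zero_of_eval_endpoints hab.isSpacePoly.monic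
    hab.isSpacePoly.natDegree_eq hab.monic_timePoly.1 hab.monic_timePoly.2 hab.gapFun_spacePoly
    hab.gapFun_timePoly (hab.firstKindPoly_sum_degree fun k => u (.inl k))
    (hab.firstKindPoly_sum_degree fun k => 3 * u (.inr k)) fun s => by
      have h1 := congrFun hu0 s
      simp only [Matrix.vecMul, dotProduct, Fintype.sum_sum_type, varMatrix_inl, varMatrix_inr,
        varCoeff, Pi.zero_apply] at h1
      have h2 := hab.eval_derivative_ne_zero s
      set d := (curvePoly a b).derivative.eval (endpoints a b s)
      simp only [eval_add, eval_mul, eval_finsetSum, eval_smul, smul_eq_mul, Finset.sum_mul]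
      rw [← mul_zero d, ← h1, mul_add, Finset.mul_sum, Finset.mul_sum]
      congr 1 <;> refine Finset.sum_congr rfl fun k _ => ?_ <;> field_simp
  have h1 := hab.eq_zero_of_firstKindPoly_sum hL
  have h2 := hab.eq_zero_of_firstKindPoly_sum hM
  ext (k | k)
  · exact congrFun h1 k
  · have := congrFun h2 k
    simpa using this

end Determinant

end KdVGaps

theorem theorem4p4 (n : ℕ) (a b : Fin n → ℝ) (hab : KdVGaps.IsGapSystem a b) :
    -- the polynomials that form the abelian differentials exist and are unique
    (∃! P, KdVGaps.IsSpacePoly a b P) ∧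
    (∃! P₁, KdVGaps.IsCubicPoly a b P₁) ∧
    (∀ k, ∃! R, KdVGaps.IsFirstKindPoly a b k R) ∧
    -- the half-periods that define the frequencies are real
    (∀ k, 1 / 2 * (1 / 2 * KdVGaps.aPeriod a b (KdVGaps.spacePoly a b) k) =
      (KdVGaps.spaceFreq a b k : ℂ)) ∧
    (∀ k, 1 / 2 * (3 / 2 * KdVGaps.aPeriod a b (KdVGaps.timePoly a b) k) =
      (KdVGaps.timeFreq a b k : ℂ)) ∧
    -- variations of the frequencies and variations of the endpoints
    (∃ L : ((Fin n → ℝ) × (Fin n → ℝ)) →L[ℝ] ((Fin n → ℝ) × (Fin n → ℝ)),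
      HasStrictFDerivAt KdVGaps.freqMap L (a, b) ∧
      (∀ dη dηt : Fin n → ℝ, ∃! v : (Fin n → ℝ) × (Fin n → ℝ), L v = (dη, dηt)) ∧
      (∀ da db dη dηt : Fin n → ℝ, L (da, db) = (dη, dηt) ↔
        (KdVGaps.varMatrix a b).mulVec (Sum.elim da db) =
          (-2 : ℝ) • (Sum.elim dη dηt : Fin n ⊕ Fin n → ℝ))) ∧
    (KdVGaps.varMatrix a b).det ≠ 0 := by
  refine ⟨hab.existsUnique_isSpacePoly, hab.existsUnique_isCubicPoly,
    hab.existsUnique_isFirstKindPoly, fun k => (hab.spaceFreq_eq k).1, fun k => (hab.timeFreq_eq k).1,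
    ?_, hab.det_varMatrix_ne_zero⟩
  choose L₁ L₂ hL₁ hL₂ hv₁ hv₂ using hab.exists_hasStrictFDerivAt_freq
  have hiff : ∀ da db dη dηt : Fin n → ℝ,
      ((ContinuousLinearMap.pi L₁).prod (ContinuousLinearMap.pi L₂)) (da, db) = (dη, dηt) ↔
        (KdVGaps.varMatrix a b).mulVec (Sum.elim da db) =
          (-2 : ℝ) • (Sum.elim dη dηt : Fin n ⊕ Fin n → ℝ) := by
    intro da db dη dηt
    have h1 : (KdVGaps.varMatrix a b).mulVec (Sum.elim da db) =
        (-2 : ℝ) • Sum.elim (fun k => L₁ k (da, db)) fun k => L₂ k (da, db) := by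
      ext (k | k)
      · rw [Pi.smul_apply, Sum.elim_inl, smul_eq_mul, hv₁, KdVGaps.endpointsCLM_apply]
        simp only [Matrix.mulVec, dotProduct, KdVGaps.varMatrix_inl]
        rfl
      · rw [Pi.smul_apply, Sum.elim_inr, smul_eq_mul, hv₂, KdVGaps.endpointsCLM_apply]
        simp only [Matrix.mulVec, dotProduct, KdVGaps.varMatrix_inr]
        rfl
    rw [h1, (smul_right_injective (Fin n ⊕ Fin n → ℝ) (by norm_num : (-2 : ℝ) ≠ 0)).eq_iff]
    refine ⟨fun h => ?_, fun h => Prod.ext (funext fun k => congrFun h (.inl k))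
      (funext fun k => congrFun h (.inr k))⟩
    ext (k | k)
    · exact congrFun (congrArg Prod.fst h) k
    · exact congrFun (congrArg Prod.snd h) k
  refine ⟨(ContinuousLinearMap.pi L₁).prod (ContinuousLinearMap.pi L₂),
    (hasStrictFDerivAt_pi.2 hL₁).prodMk (hasStrictFDerivAt_pi.2 hL₂), fun dη dηt => ?_, hiff⟩
  have hunit : IsUnit (KdVGaps.varMatrix a b) :=
    (Matrix.isUnit_iff_isUnit_det _).2 hab.det_varMatrix_ne_zero.isUnit
  obtain ⟨w, hw⟩ := Matrix.mulVec_surjective_iff_isUnit.2 hunit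
    ((-2 : ℝ) • (Sum.elim dη dηt : Fin n ⊕ Fin n → ℝ))
  refine ⟨(fun k => w (.inl k), fun k => w (.inr k)), (hiff _ _ _ _).2 ?_, fun v hv => ?_⟩
  · rw [← hw]
    congr 1
    ext (k | k) <;> rfl
  · have h1 := (hiff v.1 v.2 dη dηt).1 hv
    rw [← hw] at h1
    have h2 := Matrix.mulVec_injective_iff_isUnit.2 hunit h1
    rw [← h2]
    rfl
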